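/- **Setting.** Let $L>0$, $\Omega=[0,L]^3$ the periodic torus, $\lambda_1=4\pi^2/L^2$. For $s\ge 0$ let $\dot V_s$ be the space of real, mean-zero, divergence-free fields $u(x)=\sum_{K\in\mathbb Z^3\setminus\{0\}}\hat u_K e^{2\pi i K\cdot x/L}$ with $\|u\|_{\dot V_s}^2=L^3\sum_K(2\pi|K|/L)^{2s}|\hat u_K|^2<\infty$; write $H=\dot V_0$, $V=\dot V_1$, $D(A)=\dot V_2$, so that $\|u\|_{H}=\|u\|$, $\|u\|_V=\|\nabla u\|$, $\|u\|_{D(A)}=\|Au\|$ ($L^2$ norms), where $A=-\Delta$. Let $\mathcal P$ be the Helmholtz–Leray projection, $B(u,v)=\mathcal P[(u\cdot\nabla)v]$, and $P_N$ the projection onto the Fourier modes $0<|K|<N$. Let $c>0$ be a constant for which $\|g\|_{L^3}\le c\|g\|^{1/2}\|\nabla g\|^{1/2}$, $\|g\|_{L^4}\le c\|g\|^{1/4}\|\nabla g\|^{3/4}$ and $\|g\|_{L^6}\le c\|\nabla g\|$ for all $g\in V$. Let $\nu>0$, $0<\alpha_0\le\alpha\le\alpha_1$, $f\in L^\infty([0,\infty);H)$,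 $F=\operatorname{ess\,sup}_{s\ge0}\|f(s)\|$, and let $u$ be a solution on $[0,\infty)$ of $$\frac{dv}{dt}+\nu Av+B(u,u)=f,\qquad v=u+\alpha^2Au,$$ with $u(0)\in D(A)$, $\|u(0)\|\le M_A$, $\|\nabla u(0)\|\le M_B$, $\|Au(0)\|\le M_C$ for positive constants $M_A,M_B,M_C$. Let $0\le t_n<t_{n+1}$, $\beta_n>0$, $\eta_n>0$, let $N_n\ge1$ be an integer, and let $w_n$ be a solution on $[t_n,t_{n+1}]$ of the nudged system $$\frac{dz_n}{dt}+\nu Az_n+B(w_n,w_n)=f-\eta_n(I+\beta_n^2A)\mathcal P(P_{N_n}w_n-P_{N_n}u),\qquad z_n=w_n+\beta_n^2Aw_n .$$ (A solution on an interval $[a,b]$ means a function in $C([a,b];V)\cap L^2(a,b;D(A))$ that satisfies the equation in $D(A)'$; no further condition is placed on $w_n(t_n)\in V$.) Put $$M_1^2(t)=e^{-\nu\lambda_1t}(M_A^2+\alpha_1^2M_B^2)+\frac{F^2}{\lambda_1^2\nu^2},$$ $$M_2^2(t)=e^{-\nu\lambda_1t}(M_B^2+\alpha_1^2M_C^2)+\frac{2c^4}{\alpha_0^5\nu^2\lambda_1}e^{-\nu\lambda_1t}(M_A^2+\alpha_1^2M_B^2)^2+\frac{F^2}{\nu^2\lambda_1}+\frac{2c^4F^4}{\alpha_0^5\nu^6\lambda_1^5},$$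 $$M_3(t)=\frac{\nu}{\alpha_0}M_2(t)+\frac{c^2}{\alpha_0^4\lambda_1^{3/4}}M_1^2(t)+F .$$ **Proposition.** Assume $$\frac{27c^4M_1^4(t_n)}{8\nu^3\alpha_0^4}\le\eta_n\qquad\text{and}\qquad\frac{\eta_n}{N_n^2}\le\frac{\nu\lambda_1}{2}.$$ Then $g_n:=w_n-u$ satisfies, for all $t\in[t_n,t_{n+1}]$, $$\|g_n(t)\|^2+\beta_n^2\|\nabla g_n(t)\|^2\le e^{-\frac{\eta_n}{2}(t-t_n)}\left(\|g_n(t_n)\|^2+\beta_n^2\|\nabla g_n(t_n)\|^2\right)+4\left(\frac1\nu M_3^2(t_n)+\frac{\nu}{\alpha_0^2}M_2^2(t_n)\right)\frac{|\beta_n^2-\alpha^2|^2}{\eta_n\beta_n^2}.$$ -/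

import Mathlib

open MeasureTheory Filter Topology
open scoped ENNReal ComplexConjugate

namespace Bardina

/-- The three-dimensional torus of side `L`, with its volume of total mass `L ^ 3`. -/
abbrev Torus (L : ℝ) : Type := Fin 3 → AddCircle L

/-- A vector field on the torus, given by the family of its (vector-valued) Fourier coefficients:
`u` stands for the Fourier series `u(x) = ∑ K, u K * exp (2 π i K ⬝ x / L)`. -/
abbrev VField : Type := (Fin 3 → ℤ) → EuclideanSpace ℂ (Fin 3)

noncomputable section

/-- The Euclidean length `|K|` of a wave number. -/
def kabs (K : Fin 3 → ℤ) : ℝ := √(∑ i, (K i : ℝ) ^ 2)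

/-- The first eigenvalue `4 π² / L²` of the Stokes operator. -/
def lam (L : ℝ) : ℝ := 4 * Real.pi ^ 2 / L ^ 2

/-- Membership in the space `V_s` of real, mean-zero, divergence-free fields with `s` derivatives
in `L²`. Thus `H = V_0`, `V = V_1`, `D(A) = V_2`. -/
structure InV (s : ℕ) (u : VField) : Prop where
  mean_zero : u 0 = 0
  real : ∀ K i, u (-K) i = conj (u K i)
  div_free : ∀ K, ∑ i, u K i * (K i : ℂ) = 0
  summable : Summable fun K => kabs K ^ (2 * s) * ‖u K‖ ^ 2

/-- The norm of `V_s`. For `s = 0, 1, 2` it is `‖u‖`, `‖∇u‖`, `‖Au‖` (norms in `L²`). -/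
def vnorm (L : ℝ) (s : ℕ) (u : VField) : ℝ :=
  √(L ^ 3 * ∑' K, (2 * Real.pi * kabs K / L) ^ (2 * s) * ‖u K‖ ^ 2)

/-- The Helmholtz-Leray projection. -/
def leray (u : VField) : VField := fun K =>
  if K = 0 then 0 else
    WithLp.toLp 2 fun i => u K i - (K i : ℂ) * (∑ j, u K j * (K j : ℂ)) / ((kabs K ^ 2 : ℝ) : ℂ)

/-- The Stokes operator `A = -Δ`. -/
def stokes (L : ℝ) (u : VField) : VField := fun K => (4 * Real.pi ^ 2 * kabs K ^ 2 / L ^ 2) • u K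

/-- The operator `I + α² A`. -/
def helm (L α : ℝ) (u : VField) : VField := u + α ^ 2 • stokes L u

open Classical in
/-- The projection `P_N` onto the Fourier modes with `0 < |K| < N`. -/
def lowModes (N : ℕ) (u : VField) : VField := fun K =>
  if 0 < kabs K ∧ kabs K < N then u K else 0

/-- The Fourier coefficients of `∂u / ∂x_i`. -/
def partialDeriv (L : ℝ) (i : Fin 3) (u : VField) : VField := fun K =>
  (2 * Real.pi * Complex.I * (K i : ℂ) / (L : ℂ)) • u K

section Torus

variable (L : ℝ) [Fact (0 < L)]

/-- The character `x ↦ exp (2 π i K ⬝ x / L)`. -/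
def mode (K : Fin 3 → ℤ) : C(Torus L, ℂ) where
  toFun x := ∏ i, fourier (K i) (x i)
  continuous_toFun := by fun_prop

/-- The `L²` function `∑ K, a K * exp (2 π i K ⬝ x / L)`, a series converging in `L²`. -/
def series (a : (Fin 3 → ℤ) → ℂ) : Lp ℂ 2 (volume : Measure (Torus L)) :=
  ∑' K, a K • ContinuousMap.toLp 2 (volume : Measure (Torus L)) ℂ (mode L K)

/-- The values of a field: the function on the torus with the given Fourier coefficients. -/
def value (u : VField) (x : Torus L) : EuclideanSpace ℂ (Fin 3) :=
  WithLp.toLp 2 fun j => series L (fun K => u K j) x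

/-- The function `(u ⬝ ∇) v` on the torus. -/
def advect (u v : VField) (x : Torus L) : EuclideanSpace ℂ (Fin 3) :=
  ∑ i, value L u x i • value L (partialDeriv L i v) x

/-- The Fourier coefficients of an integrable function on the torus. -/
def coeff (F : Torus L → EuclideanSpace ℂ (Fin 3)) : VField := fun K =>
  ((L : ℂ) ^ 3)⁻¹ • ∫ x, conj (mode L K x) • F x

/-- The bilinear operator `B(u, v) = P[(u ⬝ ∇) v]`. -/
def bilin (u v : VField) : VField := leray (coeff L (advect L u v))

/-- `c` is a constant for which the three Gagliardo-Nirenberg inequalities hold on `V`. -/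
structure IsGNConst (c : ℝ) : Prop where
  pos : 0 < c
  l3 : ∀ g, InV 1 g → eLpNorm (value L g) 3 volume ≤
    ENNReal.ofReal (c * vnorm L 0 g ^ (1 / 2 : ℝ) * vnorm L 1 g ^ (1 / 2 : ℝ))
  l4 : ∀ g, InV 1 g → eLpNorm (value L g) 4 volume ≤
    ENNReal.ofReal (c * vnorm L 0 g ^ (1 / 4 : ℝ) * vnorm L 1 g ^ (3 / 4 : ℝ))
  l6 : ∀ g, InV 1 g → eLpNorm (value L g) 6 volume ≤ ENNReal.ofReal (c * vnorm L 1 g)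

/-- `u` is a (regular) solution on `[a, b]` of `dv/dt + ν A v + B(u, u) = G`, `v = u + α² A u`:
`u ∈ C([a, b]; V) ∩ L²(a, b; D(A))`, and the equation holds in `D(A)'`, that is, for the
Fourier coefficients, in its form integrated in time. -/
structure IsSolutionOn (ν α : ℝ) (G : ℝ → VField) (a b : ℝ) (u : ℝ → VField) : Prop where
  mem_V : ∀ t ∈ Set.Icc a b, InV 1 (u t)
  continuous_V : ∀ t ∈ Set.Icc a b,
    Tendsto (fun s => vnorm L 1 (u s - u t)) (𝓝[Set.Icc a b] t) (𝓝 0)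
  mem_DA : ∀ᵐ t ∂volume.restrict (Set.Icc a b), InV 2 (u t)
  sq_integrable_DA : IntegrableOn (fun t => vnorm L 2 (u t) ^ 2) (Set.Icc a b)
  equation : ∀ t ∈ Set.Icc a b, ∀ K,
    helm L α (u t) K - helm L α (u a) K =
      ∫ s in a..t, (G s K - ν • stokes L (helm L α (u s)) K - bilin L (u s) (u s) K)

/-- `u` is a solution of the viscous simplified Bardina system on `[0, ∞)`. -/
def IsBardinaSolution (ν α : ℝ) (f u : ℝ → VField) : Prop :=
  ∀ T : ℝ, 0 < T → IsSolutionOn L ν α f 0 T u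

/-- `w` is a solution on `[a, b]` of the nudged system
`dz/dt + ν A z + B(w, w) = f - η (I + β² A) P (P_N w - P_N u)`, `z = w + β² A w`. -/
def IsNudgedSolution (ν β η : ℝ) (N : ℕ) (f u : ℝ → VField) (a b : ℝ) (w : ℝ → VField) : Prop :=
  IsSolutionOn L ν β
    (fun s => f s - η • helm L β (leray (lowModes N (w s) - lowModes N (u s)))) a b w

end Torus

/-- `f ∈ L^∞([0, ∞); H)`. (As `H` is separable, measurability can be tested on coefficients.) -/
structure IsForcing (L : ℝ) (f : ℝ → VField) : Prop where
  measurable : ∀ K, AEStronglyMeasurable (fun t => f t K) (volume.restrict (Set.Ici 0))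
  mem_H : ∀ᵐ t ∂volume.restrict (Set.Ici (0 : ℝ)), InV 0 (f t)
  bounded : ∃ C : ℝ, ∀ᵐ t ∂volume.restrict (Set.Ici (0 : ℝ)), vnorm L 0 (f t) ≤ C

/-- The (essential) supremum of `‖f(s)‖` over `s ≥ 0`. -/
def supNorm (L : ℝ) (f : ℝ → VField) : ℝ :=
  essSup (fun t => vnorm L 0 (f t)) (volume.restrict (Set.Ici (0 : ℝ)))

/-- The square of the function `M_1`; `F` stands for the supremum of `‖f‖`. -/
def M1sq (L ν α₁ MA MB F t : ℝ) : ℝ :=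
  Real.exp (-ν * lam L * t) * (MA ^ 2 + α₁ ^ 2 * MB ^ 2) + 1 / (lam L ^ 2 * ν ^ 2) * F ^ 2

/-- The square of the function `M_2`. -/
def M2sq (L ν c α₀ α₁ MA MB MC F t : ℝ) : ℝ :=
  Real.exp (-ν * lam L * t) * (MB ^ 2 + α₁ ^ 2 * MC ^ 2)
    + 2 * c ^ 4 / (α₀ ^ 5 * ν ^ 2 * lam L) * Real.exp (-ν * lam L * t)
        * (MA ^ 2 + α₁ ^ 2 * MB ^ 2) ^ 2
    + 1 / (ν ^ 2 * lam L) * F ^ 2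
    + 2 * c ^ 4 / (α₀ ^ 5 * ν ^ 6 * lam L ^ 5) * F ^ 4

/-- The function `M_3`. -/
def M3 (L ν c α₀ α₁ MA MB MC F t : ℝ) : ℝ :=
  ν / α₀ * √(M2sq L ν c α₀ α₁ MA MB MC F t)
    + c ^ 2 / (α₀ ^ 4 * lam L ^ (3 / 4 : ℝ)) * M1sq L ν α₁ MA MB F t + F

end

end Bardina

open Bardina

/-!
The difference `g = w - u` satisfies an energy balance, obtained mode by mode and then summed, for
`E = ‖g‖² + β² ‖∇g‖²`. The nonlinear terms, tested against `g`, leave only the trilinear form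
`b(g, g, u)`, because `b(u, v, v) = 0`; the bounds `‖g‖_{L⁴}⁴ ≲ ‖g‖ ‖∇g‖³` and Young's inequality
absorb it into the dissipation and the nudging, the size of `∇u` being controlled by the energy of
`u` and hence by `η`. The nudging acts on the modes `|K| < N` only, but on the others
`η ≤ ν λ₁ N² / 2` lets half of the dissipation do its work. What remains is the residual
`(β² - α²) A (I + α² A)⁻¹ (f - B(u, u))`, paired with `g`: one more use of Young's inequality
turns it into the error term, and Gronwall's inequality concludes.
-/

namespace Bardina

noncomputable section

section Modes

variable (L : ℝ)

lemma mode_add (K J : Fin 3 → ℤ) (x : Torus L) : mode L (K + J) x = mode L K x * mode L J x := by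
  simp only [mode, Pi.add_apply, fourier_add, ContinuousMap.coe_mk, ← Finset.prod_mul_distrib]

lemma mode_neg (K : Fin 3 → ℤ) (x : Torus L) : mode L (-K) x = conj (mode L K x) := by
  simp only [mode, Pi.neg_apply, fourier_neg, ContinuousMap.coe_mk, map_prod]

lemma mode_sub (K J : Fin 3 → ℤ) (x : Torus L) :
    mode L (K - J) x = conj (mode L J x) * mode L K x := by
  rw [sub_eq_add_neg, mode_add, mode_neg, mul_comm]

lemma norm_mode (K : Fin 3 → ℤ) (x : Torus L) : ‖mode L K x‖ = 1 := by
  rw [mode, ContinuousMap.coe_mk, norm_prod]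
  exact Finset.prod_eq_one fun i _ => by rw [fourier_apply, Circle.norm_coe]

variable [hL : Fact (0 < L)]

lemma integral_fourier (n : ℤ) :
    ∫ x : AddCircle L, fourier n x = if n = 0 then (L : ℂ) else 0 := by
  have h := congrFun (fourierCoeff_fourier (T := L) n) 0
  simp only [fourierCoeff, neg_zero, fourier_zero, one_smul] at h
  rw [AddCircle.volume_eq_smul_haarAddCircle, integral_smul_measure, h,
    ENNReal.toReal_ofReal hL.out.le]
  by_cases hn : n = 0
  · subst hn; simp
  · simp [hn, Ne.symm hn]

lemma integral_mode (K : Fin 3 → ℤ) :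
    ∫ x : Torus L, mode L K x = if K = 0 then (L : ℂ) ^ 3 else 0 := by
  have h : ∫ x : Torus L, mode L K x = ∏ i, ∫ x : AddCircle L, fourier (K i) x :=
    integral_fintype_prod_volume_eq_prod (fun i (x : AddCircle L) => fourier (K i) x)
  rw [h]
  simp only [integral_fourier]
  split_ifs with hK
  · subst hK; simp
  · obtain ⟨i, hi⟩ := Function.ne_iff.1 hK
    exact Finset.prod_eq_zero (Finset.mem_univ i) (if_neg hi)

lemma memLp_mode_mul {φ : Torus L → ℂ} {p : ℝ≥0∞} (hφ : MemLp φ p volume) (K : Fin 3 → ℤ) :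
    MemLp (fun x => mode L K x * φ x) p volume :=
  hφ.of_le ((mode L K).continuous.aestronglyMeasurable.mul hφ.1) (ae_of_all _ fun x => by
    simp [norm_mode])

lemma memLp_conj_mode_mul {φ : Torus L → ℂ} {p : ℝ≥0∞} (hφ : MemLp φ p volume) (K : Fin 3 → ℤ) :
    MemLp (fun x => conj (mode L K x) * φ x) p volume := by
  simpa only [mode_neg] using memLp_mode_mul L hφ (-K)

end Modes

section InnerToLp

variable {𝕜 X : Type*} [RCLike 𝕜] [MeasurableSpace X] {μ : Measure X}

lemma inner_toLp {φ : X → 𝕜} (hφ : MemLp φ 2 μ) (ψ : Lp 𝕜 2 μ) :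
    inner 𝕜 (hφ.toLp φ) ψ = ∫ x, conj (φ x) * ψ x ∂μ := by
  rw [L2.inner_def]
  refine integral_congr_ae ?_
  filter_upwards [hφ.coeFn_toLp] with x hx
  rw [hx, RCLike.inner_apply, mul_comm]

lemma norm_toLp_sq {φ : X → 𝕜} (hφ : MemLp φ 2 μ) : ‖hφ.toLp φ‖ ^ 2 = ∫ x, ‖φ x‖ ^ 2 ∂μ := by
  rw [← RCLike.ofReal_inj (K := 𝕜), RCLike.ofReal_pow, ← inner_self_eq_norm_sq_to_K, inner_toLp,
    ← integral_ofReal]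
  refine integral_congr_ae ?_
  filter_upwards [hφ.coeFn_toLp] with x hx
  rw [hx, RCLike.conj_mul, RCLike.ofReal_pow]

lemma sq_integral_mul_le {f g : X → ℝ} (hf : MemLp f 2 μ) (hg : MemLp g 2 μ) :
    (∫ x, f x * g x ∂μ) ^ 2 ≤ (∫ x, f x ^ 2 ∂μ) * ∫ x, g x ^ 2 ∂μ := by
  have hinner : inner ℝ (hf.toLp f) (hg.toLp g) = ∫ x, f x * g x ∂μ := by
    rw [inner_toLp]
    exact integral_congr_ae (hg.coeFn_toLp.mono fun x hx => by simp only [hx, conj_trivial])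
  have h := pow_le_pow_left₀ (abs_nonneg _) (abs_real_inner_le_norm (hf.toLp f) (hg.toLp g)) 2
  simpa only [hinner, sq_abs, mul_pow, norm_toLp_sq, Real.norm_eq_abs] using h

end InnerToLp

section Series

variable (L : ℝ) [hL : Fact (0 < L)]

/-- The character `mode L K` as an element of `L²`. -/
def modeLp (K : Fin 3 → ℤ) : Lp ℂ 2 (volume : Measure (Torus L)) :=
  ContinuousMap.toLp 2 (volume : Measure (Torus L)) ℂ (mode L K)

lemma coeFn_modeLp (K : Fin 3 → ℤ) : modeLp L K =ᵐ[volume] mode L K :=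
  ContinuousMap.coeFn_toLp _ _

lemma inner_modeLp (K : Fin 3 → ℤ) (ψ : Lp ℂ 2 (volume : Measure (Torus L))) :
    inner ℂ (modeLp L K) ψ = ∫ x, conj (mode L K x) * ψ x := by
  rw [L2.inner_def]
  refine integral_congr_ae ?_
  filter_upwards [coeFn_modeLp L K] with x hx
  rw [hx, RCLike.inner_apply, mul_comm]

lemma inner_modeLp_modeLp (K J : Fin 3 → ℤ) :
    inner ℂ (modeLp L K) (modeLp L J) = if K = J then (L : ℂ) ^ 3 else 0 := by
  have h : ∫ x, conj (mode L K x) * modeLp L J x = ∫ x, mode L (J - K) x := by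
    refine integral_congr_ae ?_
    filter_upwards [coeFn_modeLp L J] with x hx
    rw [hx, mode_sub]
  rw [inner_modeLp, h, integral_mode]
  simp [sub_eq_zero, eq_comm]

/-- The `L²` norm `L ^ (3 / 2)` of a character. -/
def modeNorm : ℝ := √(L ^ 3)

lemma modeNorm_sq : modeNorm L ^ 2 = L ^ 3 := Real.sq_sqrt (pow_pos hL.out 3).le

lemma modeNorm_ne_zero : (modeNorm L : ℂ) ≠ 0 := by
  exact_mod_cast (Real.sqrt_pos.2 (pow_pos hL.out 3)).ne'

lemma orthonormal_modes : Orthonormal ℂ (fun K => (modeNorm L : ℂ)⁻¹ • modeLp L K) := by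
  have h0 := modeNorm_ne_zero L
  have hsq : (modeNorm L : ℂ) ^ 2 = (L : ℂ) ^ 3 := by exact_mod_cast modeNorm_sq L
  rw [orthonormal_iff_ite]
  intro K J
  rw [inner_smul_left, inner_smul_right, inner_modeLp_modeLp, ← hsq, map_inv₀, Complex.conj_ofReal]
  split_ifs
  · field_simp
  · simp

lemma hasSum_series {a : (Fin 3 → ℤ) → ℂ} (ha : Summable fun K => ‖a K‖ ^ 2) :
    HasSum (fun K => a K • modeLp L K) (series L a) := by
  have h := (((orthonormal_modes L).orthogonalFamily.summable_iff_norm_sq_summable a).2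
    ha).const_smul (modeNorm L : ℂ)
  refine Summable.hasSum (h.congr fun K => ?_)
  rw [LinearIsometry.toSpanSingleton_apply, smul_comm, smul_inv_smul₀ (modeNorm_ne_zero L)]

lemma integral_conj_mode_mul_series {a : (Fin 3 → ℤ) → ℂ} (ha : Summable fun K => ‖a K‖ ^ 2)
    (K : Fin 3 → ℤ) : ∫ x, conj (mode L K x) * series L a x = (L : ℂ) ^ 3 * a K := by
  have h := (hasSum_series L ha).mapL (innerSL ℂ (modeLp L K))
  simp only [innerSL_apply_apply, inner_smul_right, inner_modeLp_modeLp] at h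
  rw [← inner_modeLp, ← h.tsum_eq, tsum_eq_single K fun J hJ => by rw [if_neg hJ.symm, mul_zero],
    if_pos rfl, mul_comm]

/-- Parseval's identity, polarised without complex conjugation. -/
lemma hasSum_integral_series_mul {a : (Fin 3 → ℤ) → ℂ} (ha : Summable fun K => ‖a K‖ ^ 2)
    {φ : Torus L → ℂ} (hφ : MemLp φ 2 volume) :
    HasSum (fun K => a K * ∫ x, mode L K x * φ x) (∫ x, series L a x * φ x) := by
  have h := (hasSum_series L ha).mapL (innerSL ℂ (hφ.star.toLp _))
  simp only [innerSL_apply_apply, inner_smul_right, inner_toLp, Pi.star_apply, RCLike.star_def,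
    Complex.conj_conj, mul_comm (φ _)] at h
  have hmode : ∀ K, ∫ x, modeLp L K x * φ x = ∫ x, mode L K x * φ x := fun K =>
    integral_congr_ae ((coeFn_modeLp L K).mono fun x hx => by simp only [hx])
  simpa only [hmode] using h

lemma summable_and_tsum_norm_integral_conj_mode_mul_sq_le {φ : Torus L → ℂ}
    (hφ : MemLp φ 2 volume) :
    Summable (fun K => ‖∫ x, conj (mode L K x) * φ x‖ ^ 2) ∧
      ∑' K, ‖∫ x, conj (mode L K x) * φ x‖ ^ 2 ≤ L ^ 3 * ∫ x, ‖φ x‖ ^ 2 := by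
  have h3 : (0 : ℝ) < L ^ 3 := pow_pos hL.out 3
  have hinner : ∀ K, ‖inner ℂ ((modeNorm L : ℂ)⁻¹ • modeLp L K) (hφ.toLp φ)‖ ^ 2 =
      (L ^ 3)⁻¹ * ‖∫ x, conj (mode L K x) * φ x‖ ^ 2 := by
    intro K
    have h : ∫ x, conj (mode L K x) * hφ.toLp φ x = ∫ x, conj (mode L K x) * φ x :=
      integral_congr_ae (hφ.coeFn_toLp.mono fun x hx => by simp only [hx])
    rw [inner_smul_left, inner_modeLp, h, norm_mul, mul_pow, ← modeNorm_sq L]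
    simp
  have hsum := (orthonormal_modes L).inner_products_summable (hφ.toLp φ)
  have hle := (orthonormal_modes L).tsum_inner_products_le (hφ.toLp φ)
  simp only [hinner] at hsum hle
  refine ⟨(hsum.mul_left (L ^ 3)).congr fun K => mul_inv_cancel_left₀ h3.ne' _, ?_⟩
  rwa [tsum_mul_left, norm_toLp_sq, inv_mul_le_iff₀ h3] at hle

lemma memLp_series (a : (Fin 3 → ℤ) → ℂ) : MemLp (series L a) 2 volume := Lp.memLp _

lemma hasSum_integral_conj_mode_mul_mul {a b : (Fin 3 → ℤ) → ℂ}
    (ha : Summable fun K => ‖a K‖ ^ 2) (hb : Summable fun K => ‖b K‖ ^ 2) (K : Fin 3 → ℤ) :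
    HasSum (fun J => (L : ℂ) ^ 3 * (a (K - J) * b J))
      (∫ x, conj (mode L K x) * (series L a x * series L b x)) := by
  convert hasSum_integral_series_mul L hb (memLp_conj_mode_mul L (memLp_series L a) K) using 1
  · ext J
    have h : ∀ x, mode L J x * (conj (mode L K x) * series L a x) =
        conj (mode L (K - J) x) * series L a x := by
      intro x; rw [mode_sub, map_mul, Complex.conj_conj]; ring
    simp only [h, integral_conj_mode_mul_series L ha]; ring
  · congr 1; ext x; ring

lemma integral_norm_sq_series {a : (Fin 3 → ℤ) → ℂ} (ha : Summable fun K => ‖a K‖ ^ 2) :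
    ∫ x, ‖series L a x‖ ^ 2 = L ^ 3 * ∑' K, ‖a K‖ ^ 2 := by
  have hconj : MemLp (fun x => conj (series L a x)) 2 volume := (memLp_series L a).star
  have h := hasSum_integral_series_mul L ha hconj
  have hterm : ∀ K, a K * ∫ x, mode L K x * conj (series L a x) =
      ((L ^ 3 * ‖a K‖ ^ 2 : ℝ) : ℂ) := by
    intro K
    have hstar : ∫ x, mode L K x * conj (series L a x) =
        conj (∫ x, conj (mode L K x) * series L a x) := by
      rw [← integral_conj]; congr 1; ext x; simp
    rw [hstar, integral_conj_mode_mul_series L ha, map_mul, map_pow, Complex.conj_ofReal]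
    push_cast
    rw [← Complex.mul_conj']; ring
  have hval : ∫ x, series L a x * conj (series L a x) = ((∫ x, ‖series L a x‖ ^ 2 : ℝ) : ℂ) := by
    rw [← integral_complex_ofReal]; congr 1; ext x
    simp [Complex.mul_conj']
  simp only [hterm] at h
  rw [hval] at h
  rw [← ((Complex.hasSum_ofReal).1 h).tsum_eq, tsum_mul_left]

lemma series_sub {a b : (Fin 3 → ℤ) → ℂ} (ha : Summable fun K => ‖a K‖ ^ 2)
    (hb : Summable fun K => ‖b K‖ ^ 2) :
    series L (fun K => a K - b K) = series L a - series L b := by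
  have h := (hasSum_series L ha).sub (hasSum_series L hb)
  simp only [← sub_smul] at h
  exact h.tsum_eq

lemma series_finset {a : (Fin 3 → ℤ) → ℂ} {S : Finset (Fin 3 → ℤ)} (ha : ∀ K ∉ S, a K = 0) :
    series L a =ᵐ[volume] fun x => ∑ K ∈ S, a K * mode L K x := by
  have h : series L a = ∑ K ∈ S, a K • modeLp L K :=
    tsum_eq_sum (f := fun K => a K • modeLp L K) fun K hK => by simp [ha K hK]
  have hterm : ∀ᵐ x : Torus L, ∀ K ∈ S, (a K • modeLp L K : Lp ℂ 2 _) x = a K * mode L K x := by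
    rw [Finset.eventually_all]
    intro K _
    filter_upwards [Lp.coeFn_smul (a K) (modeLp L K), coeFn_modeLp L K] with x hx hx'
    rw [hx, Pi.smul_apply, hx', smul_eq_mul]
  rw [h]
  filter_upwards [Lp.coeFn_finsetSum S (fun K => a K • modeLp L K), hterm] with x hx hx'
  rw [hx, Finset.sum_apply]
  exact Finset.sum_congr rfl hx'

end Series

lemma kabs_nonneg (K : Fin 3 → ℤ) : 0 ≤ kabs K := Real.sqrt_nonneg _

lemma kabs_sq (K : Fin 3 → ℤ) : kabs K ^ 2 = ∑ i, (K i : ℝ) ^ 2 :=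
  Real.sq_sqrt (Finset.sum_nonneg fun _ _ => sq_nonneg _)

lemma kabs_zero : kabs 0 = 0 := by simp [kabs]

lemma abs_le_kabs (K : Fin 3 → ℤ) (i : Fin 3) : |(K i : ℝ)| ≤ kabs K := by
  refine abs_le_of_sq_le_sq ?_ (kabs_nonneg K)
  rw [kabs_sq]
  exact Finset.single_le_sum (f := fun i => (K i : ℝ) ^ 2) (fun _ _ => sq_nonneg _)
    (Finset.mem_univ i)

lemma one_le_kabs {K : Fin 3 → ℤ} (hK : K ≠ 0) : 1 ≤ kabs K := by
  obtain ⟨i, hi⟩ := Function.ne_iff.1 hK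
  refine le_trans ?_ (abs_le_kabs K i)
  exact_mod_cast Int.one_le_abs hi

/-- Square-summable mean-zero fields with one derivative in `L²`: the space `V` without the
reality and divergence conditions, which are of no use for the estimates in `L⁴`. -/
structure IsH1 (u : VField) : Prop where
  mean_zero : u 0 = 0
  summable : Summable fun K => kabs K ^ 2 * ‖u K‖ ^ 2

lemma norm_sq_le_kabs_sq_mul {u : VField} (h0 : u 0 = 0) (K : Fin 3 → ℤ) :
    ‖u K‖ ^ 2 ≤ kabs K ^ 2 * ‖u K‖ ^ 2 := by
  by_cases hK : K = 0
  · subst hK; simp [h0]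
  · exact le_mul_of_one_le_left (sq_nonneg _) (one_le_pow₀ (one_le_kabs hK))

lemma IsH1.summable_sq {u : VField} (hu : IsH1 u) : Summable fun K => ‖u K‖ ^ 2 :=
  hu.summable.of_nonneg_of_le (fun _ => sq_nonneg _) (norm_sq_le_kabs_sq_mul hu.mean_zero)

lemma summable_mul_norm_sq_add {ι E : Type*} [SeminormedAddCommGroup E] {a : ι → ℝ}
    (ha : ∀ K, 0 ≤ a K) {u v : ι → E} (hu : Summable fun K => a K * ‖u K‖ ^ 2)
    (hv : Summable fun K => a K * ‖v K‖ ^ 2) : Summable fun K => a K * ‖u K + v K‖ ^ 2 := by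
  refine ((hu.add hv).mul_left 2).of_nonneg_of_le (fun K => mul_nonneg (ha K) (sq_nonneg _))
    fun K => ?_
  calc a K * ‖u K + v K‖ ^ 2 ≤ a K * (‖u K‖ + ‖v K‖) ^ 2 := by
        gcongr
        exacts [ha K, norm_add_le _ _]
    _ ≤ a K * (2 * (‖u K‖ ^ 2 + ‖v K‖ ^ 2)) :=
        mul_le_mul_of_nonneg_left add_sq_le (ha K)
    _ = 2 * (a K * ‖u K‖ ^ 2 + a K * ‖v K‖ ^ 2) := by ring

lemma IsH1.add {u v : VField} (hu : IsH1 u) (hv : IsH1 v) : IsH1 (u + v) :=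
  ⟨by simp [hu.mean_zero, hv.mean_zero],
    summable_mul_norm_sq_add (fun _ => sq_nonneg _) hu.summable hv.summable⟩

lemma IsH1.neg {u : VField} (hu : IsH1 u) : IsH1 (-u) :=
  ⟨by simp [hu.mean_zero], by simpa using hu.summable⟩

lemma IsH1.sub {u v : VField} (hu : IsH1 u) (hv : IsH1 v) : IsH1 (u - v) := by
  rw [sub_eq_add_neg]; exact hu.add hv.neg

lemma summable_coord {u : VField} (hu : Summable fun K => ‖u K‖ ^ 2) (j : Fin 3) :
    Summable fun K => ‖u K j‖ ^ 2 :=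
  hu.of_nonneg_of_le (fun _ => sq_nonneg _) fun _ =>
    pow_le_pow_left₀ (norm_nonneg _) (PiLp.norm_apply_le _ _) 2

lemma InV.isH1 {u : VField} (hu : InV 1 u) : IsH1 u :=
  ⟨hu.mean_zero, by simpa only [mul_one] using hu.summable⟩

/-- The cube of wave numbers with entries of absolute value at most `m`, the truncation to low
frequencies used in the layer-cake argument for Ladyzhenskaya's inequality. -/
def box (m : ℕ) : Finset (Fin 3 → ℤ) :=
  Fintype.piFinset fun _ => Finset.Icc (-(m : ℤ)) m

lemma mem_box {m : ℕ} {K : Fin 3 → ℤ} : K ∈ box m ↔ ∀ i, |K i| ≤ m := by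
  simp [box, abs_le]

lemma notMem_box {m : ℕ} {K : Fin 3 → ℤ} : K ∉ box m ↔ ∃ i, (m : ℤ) < |K i| := by
  simp only [mem_box, not_forall, not_le]

lemma box_mono : Monotone box := fun _ _ h _ hK =>
  mem_box.2 fun i => (mem_box.1 hK i).trans (by exact_mod_cast h)

lemma card_box (m : ℕ) : (box m).card = (2 * m + 1) ^ 3 := by
  simp only [box, Fintype.card_piFinset, Int.card_Icc, Finset.prod_const, Finset.card_univ,
    Fintype.card_fin]
  congr 1; omega

lemma tendsto_box : Tendsto box atTop atTop := by
  refine tendsto_atTop_finset_of_monotone box_mono fun K => ?_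
  refine ⟨∑ i, (K i).natAbs, mem_box.2 fun i => ?_⟩
  rw [Int.abs_eq_natAbs]
  exact_mod_cast Finset.single_le_sum (f := fun i => (K i).natAbs) (fun _ _ => Nat.zero_le _)
    (Finset.mem_univ i)

lemma card_box_succ_sdiff_box (m : ℕ) :
    ((box (m + 1) \ box m).card : ℝ) = 24 * (m + 1) ^ 2 + 2 := by
  rw [Finset.card_sdiff_of_subset (box_mono (Nat.le_succ m)), Nat.cast_sub
    (Finset.card_le_card (box_mono (Nat.le_succ m))), card_box, card_box]
  push_cast; ring

lemma sum_box_inv_kabs_sq_le (m : ℕ) : ∑ K ∈ box m, (kabs K ^ 2)⁻¹ ≤ 26 * m := by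
  induction m with
  | zero =>
    have h0 : ∀ K ∈ box 0, (kabs K ^ 2)⁻¹ = 0 := fun K hK => by
      have hK0 : K = 0 := funext fun i => by simpa using mem_box.1 hK i
      simp [hK0, kabs_zero]
    simp [Finset.sum_eq_zero h0]
  | succ m ih =>
    have hterm : ∀ K ∈ box (m + 1) \ box m, (kabs K ^ 2)⁻¹ ≤ (((m : ℝ) + 1) ^ 2)⁻¹ := by
      intro K hK
      obtain ⟨i, hi⟩ := notMem_box.1 (Finset.mem_sdiff.1 hK).2
      have hmK : (m : ℝ) + 1 ≤ kabs K := le_trans (by exact_mod_cast hi) (abs_le_kabs K i)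
      gcongr
    have hshell : ∑ K ∈ box (m + 1) \ box m, (kabs K ^ 2)⁻¹ ≤ 26 := by
      refine (Finset.sum_le_card_nsmul _ _ _ hterm).trans ?_
      rw [nsmul_eq_mul, card_box_succ_sdiff_box, ← div_eq_mul_inv, div_le_iff₀ (by positivity)]
      nlinarith [(Nat.cast_nonneg m : (0 : ℝ) ≤ m)]
    rw [← Finset.sum_sdiff (box_mono (Nat.le_succ m))]
    push_cast
    linarith

lemma tsum_indicator_compl_box_le (K : Fin 3 → ℤ) (y : ℝ≥0∞) :
    ∑' m, ((box m : Set (Fin 3 → ℤ))ᶜ.indicator (fun _ => y) K) ≤ ENNReal.ofReal (kabs K) * y := by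
  obtain ⟨i, -, hi⟩ := Finset.exists_mem_eq_sup Finset.univ Finset.univ_nonempty
    fun i => (K i).natAbs
  have hbox : ∀ m ∉ Finset.range (K i).natAbs,
      (box m : Set (Fin 3 → ℤ))ᶜ.indicator (fun _ => y) K = 0 := by
    intro m hm
    refine Set.indicator_of_notMem (fun hK => hm ?_) _
    obtain ⟨j, hj⟩ := notMem_box.1 hK
    rw [Int.abs_eq_natAbs] at hj
    have hji : (K j).natAbs ≤ (K i).natAbs :=
      hi ▸ Finset.le_sup (f := fun i => (K i).natAbs) (Finset.mem_univ j)
    rw [Finset.mem_range]; omega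
  have hcard : ((K i).natAbs : ℝ≥0∞) ≤ ENNReal.ofReal (kabs K) := by
    rw [← ENNReal.ofReal_natCast, Nat.cast_natAbs, Int.cast_abs]
    exact ENNReal.ofReal_le_ofReal (abs_le_kabs K i)
  calc ∑' m, ((box m : Set (Fin 3 → ℤ))ᶜ.indicator (fun _ => y) K)
      = ∑ m ∈ Finset.range (K i).natAbs, (box m : Set (Fin 3 → ℤ))ᶜ.indicator (fun _ => y) K :=
        tsum_eq_sum hbox
    _ ≤ ∑ _m ∈ Finset.range (K i).natAbs, y :=
        Finset.sum_le_sum fun m _ => Set.indicator_le_self _ _ _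
    _ ≤ ENNReal.ofReal (kabs K) * y := by
        rw [Finset.sum_const, Finset.card_range, nsmul_eq_mul]
        gcongr

/-- A discrete layer-cake bound: every `m ≤ a ^ 2 / (4 * T)` has `a / 2 ≤ d m`. -/
lemma exists_pow_four_le_sum_sq {a T : ℝ} (ha : 0 ≤ a) (hT : 0 < T) {d : ℕ → ℝ}
    (h : ∀ m : ℕ, a ≤ √(m * T) + d m) :
    ∃ M, a ^ 4 ≤ 16 * T * ∑ m ∈ Finset.range M, d m ^ 2 := by
  set M := ⌊a ^ 2 / (4 * T)⌋₊ + 1 with hM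
  have hle : ∀ m ∈ Finset.range M, a ^ 2 / 4 ≤ d m ^ 2 := by
    intro m hm
    have hmT : (m : ℝ) * T ≤ (a / 2) ^ 2 := by
      have hm' : (m : ℝ) ≤ a ^ 2 / (4 * T) :=
        (Nat.le_floor_iff (by positivity)).1 (Nat.lt_succ_iff.1 (Finset.mem_range.1 hm))
      rw [le_div_iff₀ (by positivity)] at hm'
      linarith
    have hd : a / 2 ≤ d m := by
      have hsqrt : √(m * T) ≤ a / 2 := Real.sqrt_le_iff.2 ⟨by positivity, hmT⟩
      linarith [h m]
    nlinarith
  refine ⟨M, ?_⟩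
  have hlt : a ^ 2 < M * (4 * T) := by
    rw [← div_lt_iff₀ (by positivity)]
    rw [hM, Nat.cast_succ]
    exact Nat.lt_floor_add_one _
  calc a ^ 4 = a ^ 2 * a ^ 2 := by ring
    _ ≤ M * (4 * T) * a ^ 2 := by gcongr
    _ = 16 * T * (M * (a ^ 2 / 4)) := by ring
    _ ≤ 16 * T * ∑ m ∈ Finset.range M, d m ^ 2 := by
        gcongr
        simpa using Finset.card_nsmul_le_sum _ _ _ hle

section Values

variable (L : ℝ) [hL : Fact (0 < L)]

lemma memLp_value_coord (u : VField) (j : Fin 3) :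
    MemLp (fun x => value L u x j) 2 (volume : Measure (Torus L)) := memLp_series L _

lemma memLp_value (u : VField) : MemLp (value L u) 2 (volume : Measure (Torus L)) :=
  MemLp.of_eval_piLp (memLp_value_coord L u)

lemma integral_norm_sq_value {u : VField} (hu : Summable fun K => ‖u K‖ ^ 2) :
    ∫ x : Torus L, ‖value L u x‖ ^ 2 = L ^ 3 * ∑' K, ‖u K‖ ^ 2 := by
  simp only [EuclideanSpace.norm_sq_eq]
  rw [integral_finsetSum _ fun j _ => (memLp_value_coord L u j).integrable_norm_pow two_ne_zero,
    Summable.tsum_finsetSum fun j _ => summable_coord hu j, Finset.mul_sum]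
  exact Finset.sum_congr rfl fun j _ => integral_norm_sq_series L (summable_coord hu j)

lemma lintegral_enorm_sq_value {u : VField} (hu : Summable fun K => ‖u K‖ ^ 2) :
    ∫⁻ x : Torus L, ‖value L u x‖ₑ ^ 2 = ENNReal.ofReal (L ^ 3) * ∑' K, ‖u K‖ₑ ^ 2 := by
  have hsq : ∀ y : EuclideanSpace ℂ (Fin 3), ‖y‖ₑ ^ 2 = ENNReal.ofReal (‖y‖ ^ 2) := fun y => by
    rw [ENNReal.ofReal_pow (norm_nonneg _), ofReal_norm]
  simp only [hsq]
  rw [← ofReal_integral_eq_lintegral_ofReal ((memLp_value L u).integrable_norm_pow two_ne_zero)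
    (ae_of_all _ fun x => sq_nonneg _), integral_norm_sq_value L hu,
    ENNReal.ofReal_mul (pow_pos hL.out 3).le, ENNReal.ofReal_tsum_of_nonneg
    (fun _ => sq_nonneg _) hu]

lemma value_sub {u v : VField} (hu : Summable fun K => ‖u K‖ ^ 2)
    (hv : Summable fun K => ‖v K‖ ^ 2) :
    value L (u - v) =ᵐ[volume] fun x => value L u x - value L v x := by
  have h : ∀ j : Fin 3, ∀ᵐ x : Torus L, value L (u - v) x j = value L u x j - value L v x j := by
    intro j
    have hsub := series_sub L (summable_coord hu j) (summable_coord hv j)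
    filter_upwards [Lp.coeFn_sub (series L fun K => u K j) (series L fun K => v K j)] with x hx
    rw [← hsub] at hx
    exact hx
  filter_upwards [ae_all_iff.2 h] with x hx
  ext j; exact hx j

lemma value_finset {u : VField} {S : Finset (Fin 3 → ℤ)} (hu : ∀ K ∉ S, u K = 0) :
    value L u =ᵐ[volume] fun x => ∑ K ∈ S, mode L K x • u K := by
  have h : ∀ j : Fin 3, ∀ᵐ x : Torus L, value L u x j = ∑ K ∈ S, u K j * mode L K x :=
    fun j => series_finset L fun K hK => by simp [hu K hK]
  filter_upwards [ae_all_iff.2 h] with x hx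
  ext j
  rw [hx j]
  simp [mul_comm]

/-- The bound comes from Cauchy–Schwarz applied to `‖u K‖ = |K|⁻¹ * (|K| * ‖u K‖)`. -/
lemma norm_value_indicator_box_le {u : VField} (hu : IsH1 u) (m : ℕ) :
    ∀ᵐ x : Torus L, ‖value L ((box m : Set (Fin 3 → ℤ)).indicator u) x‖ ≤
      √(m * (26 * ∑' K, kabs K ^ 2 * ‖u K‖ ^ 2)) := by
  have hsupp : ∀ K ∉ box m, (box m : Set (Fin 3 → ℤ)).indicator u K = 0 := fun K hK =>
    Set.indicator_of_notMem (by simpa using hK) u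
  filter_upwards [value_finset L hsupp] with x hx
  rw [hx]
  refine Real.le_sqrt_of_sq_le ?_
  have hnorm : ‖∑ K ∈ box m, mode L K x • (box m : Set (Fin 3 → ℤ)).indicator u K‖ ≤
      ∑ K ∈ box m, (kabs K)⁻¹ * (kabs K * ‖u K‖) := by
    refine (norm_sum_le _ _).trans (Finset.sum_le_sum fun K _ => ?_)
    rw [norm_smul, norm_mode, one_mul]
    refine (norm_indicator_le_norm_self u K).trans (le_of_eq ?_)
    by_cases hK : K = 0
    · subst hK; simp [hu.mean_zero]
    · rw [inv_mul_cancel_left₀ (zero_lt_one.trans_le (one_le_kabs hK)).ne']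
  calc ‖∑ K ∈ box m, mode L K x • (box m : Set (Fin 3 → ℤ)).indicator u K‖ ^ 2
      ≤ (∑ K ∈ box m, (kabs K)⁻¹ * (kabs K * ‖u K‖)) ^ 2 := by gcongr
    _ ≤ (∑ K ∈ box m, (kabs K)⁻¹ ^ 2) * ∑ K ∈ box m, (kabs K * ‖u K‖) ^ 2 :=
        Finset.sum_mul_sq_le_sq_mul_sq _ _ _
    _ ≤ (26 * m) * ∑' K, kabs K ^ 2 * ‖u K‖ ^ 2 := by
        simp only [inv_pow, mul_pow]
        gcongr
        · exact sum_box_inv_kabs_sq_le m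
        · exact hu.summable.sum_le_tsum _ fun _ _ => by positivity
    _ = m * (26 * ∑' K, kabs K ^ 2 * ‖u K‖ ^ 2) := by ring

lemma summable_norm_sq_indicator {u : VField} (hu : Summable fun K => ‖u K‖ ^ 2)
    (S : Set (Fin 3 → ℤ)) : Summable fun K => ‖S.indicator u K‖ ^ 2 :=
  hu.of_nonneg_of_le (fun _ => sq_nonneg _) fun K =>
    pow_le_pow_left₀ (norm_nonneg _) (norm_indicator_le_norm_self u K) 2

lemma norm_value_le_sqrt_add {u : VField} (hu : IsH1 u) :
    ∀ᵐ x : Torus L, ∀ m : ℕ, ‖value L u x‖ ≤ √(m * (26 * ∑' K, kabs K ^ 2 * ‖u K‖ ^ 2)) +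
      ‖value L ((box m : Set (Fin 3 → ℤ))ᶜ.indicator u) x‖ := by
  refine ae_all_iff.2 fun m => ?_
  filter_upwards [norm_value_indicator_box_le L hu m, value_sub L hu.summable_sq
    (summable_norm_sq_indicator hu.summable_sq (box m))] with x hlow hsub
  rw [Set.indicator_compl, hsub]
  exact (norm_le_norm_add_norm_sub' _ _).trans (by gcongr)

lemma tsum_lintegral_enorm_sq_value_indicator_le {u : VField}
    (hu : Summable fun K => ‖u K‖ ^ 2) :
    ∑' m, ∫⁻ x : Torus L, ‖value L ((box m : Set (Fin 3 → ℤ))ᶜ.indicator u) x‖ₑ ^ 2 ≤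
      ENNReal.ofReal (L ^ 3) * ∑' K, ENNReal.ofReal (kabs K) * ‖u K‖ₑ ^ 2 := by
  have hind : ∀ m K, ‖(box m : Set (Fin 3 → ℤ))ᶜ.indicator u K‖ₑ ^ 2 =
      (box m : Set (Fin 3 → ℤ))ᶜ.indicator (fun _ => ‖u K‖ₑ ^ 2) K := by
    intro m K
    by_cases hK : K ∈ (box m : Set (Fin 3 → ℤ))ᶜ <;> simp [hK]
  calc ∑' m, ∫⁻ x : Torus L, ‖value L ((box m : Set (Fin 3 → ℤ))ᶜ.indicator u) x‖ₑ ^ 2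
      = ∑' m, ENNReal.ofReal (L ^ 3) *
          ∑' K, (box m : Set (Fin 3 → ℤ))ᶜ.indicator (fun _ => ‖u K‖ₑ ^ 2) K := by
        simp only [lintegral_enorm_sq_value L (summable_norm_sq_indicator hu _), hind]
    _ = ENNReal.ofReal (L ^ 3) *
          ∑' K, ∑' m, (box m : Set (Fin 3 → ℤ))ᶜ.indicator (fun _ => ‖u K‖ₑ ^ 2) K := by
        rw [ENNReal.tsum_mul_left, ENNReal.tsum_comm]
    _ ≤ ENNReal.ofReal (L ^ 3) * ∑' K, ENNReal.ofReal (kabs K) * ‖u K‖ₑ ^ 2 := by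
        gcongr with K
        exact tsum_indicator_compl_box_le K _

lemma lintegral_enorm_pow_four_value_le {u : VField} (hu : IsH1 u) {T : ℝ} (hT : 0 < T)
    (hDT : 26 * ∑' K, kabs K ^ 2 * ‖u K‖ ^ 2 ≤ T) :
    ∫⁻ x : Torus L, ‖value L u x‖ₑ ^ 4 ≤ ENNReal.ofReal (16 * T) *
      (ENNReal.ofReal (L ^ 3) * ∑' K, ENNReal.ofReal (kabs K) * ‖u K‖ₑ ^ 2) := by
  set tail : ℕ → Torus L → EuclideanSpace ℂ (Fin 3) := fun m =>
    value L ((box m : Set (Fin 3 → ℤ))ᶜ.indicator u)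
  have hpt : ∀ᵐ x : Torus L,
      ‖value L u x‖ₑ ^ 4 ≤ ENNReal.ofReal (16 * T) * ∑' m, ‖tail m x‖ₑ ^ 2 := by
    filter_upwards [norm_value_le_sqrt_add L hu] with x hx
    obtain ⟨M, hM⟩ := exists_pow_four_le_sum_sq (norm_nonneg (value L u x)) hT
      (d := fun m => ‖tail m x‖) fun m => (hx m).trans (by gcongr)
    calc ‖value L u x‖ₑ ^ 4 = ENNReal.ofReal (‖value L u x‖ ^ 4) := by
          rw [ENNReal.ofReal_pow (norm_nonneg _), ofReal_norm]
      _ ≤ ENNReal.ofReal (16 * T * ∑ m ∈ Finset.range M, ‖tail m x‖ ^ 2) :=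
          ENNReal.ofReal_le_ofReal hM
      _ = ENNReal.ofReal (16 * T) * ∑ m ∈ Finset.range M, ‖tail m x‖ₑ ^ 2 := by
          rw [ENNReal.ofReal_mul (by positivity), ENNReal.ofReal_sum_of_nonneg
            fun _ _ => sq_nonneg _]
          simp only [ENNReal.ofReal_pow (norm_nonneg _), ofReal_norm]
      _ ≤ ENNReal.ofReal (16 * T) * ∑' m, ‖tail m x‖ₑ ^ 2 := by
          gcongr
          exact ENNReal.sum_le_tsum _
  calc ∫⁻ x : Torus L, ‖value L u x‖ₑ ^ 4
      ≤ ∫⁻ x : Torus L, ENNReal.ofReal (16 * T) * ∑' m, ‖tail m x‖ₑ ^ 2 := lintegral_mono_ae hpt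
    _ = ENNReal.ofReal (16 * T) * ∑' m, ∫⁻ x : Torus L, ‖tail m x‖ₑ ^ 2 := by
        rw [lintegral_const_mul' _ _ ENNReal.ofReal_ne_top, lintegral_tsum fun m =>
          (memLp_value L _).1.enorm.pow_const 2]
    _ ≤ _ := by
        gcongr
        exact tsum_lintegral_enorm_sq_value_indicator_le L hu.summable_sq

end Values

lemma vnorm_nonneg (L : ℝ) (s : ℕ) (u : VField) : 0 ≤ vnorm L s u := Real.sqrt_nonneg _

section Norms

variable (L : ℝ) [hL : Fact (0 < L)]

lemma vnorm_sq (s : ℕ) (u : VField) :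
    vnorm L s u ^ 2 = L ^ 3 * ∑' K, (2 * Real.pi * kabs K / L) ^ (2 * s) * ‖u K‖ ^ 2 := by
  refine Real.sq_sqrt (mul_nonneg (pow_pos hL.out 3).le (tsum_nonneg fun K => ?_))
  rw [pow_mul]; positivity

lemma vnorm_zero_sq (u : VField) : vnorm L 0 u ^ 2 = L ^ 3 * ∑' K, ‖u K‖ ^ 2 := by
  simp only [vnorm_sq, mul_zero, pow_zero, one_mul]

lemma vnorm_one_sq (u : VField) :
    vnorm L 1 u ^ 2 = L ^ 3 * ((2 * Real.pi / L) ^ 2 * ∑' K, kabs K ^ 2 * ‖u K‖ ^ 2) := by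
  rw [vnorm_sq, ← tsum_mul_left (a := (2 * Real.pi / L) ^ 2)]
  exact congrArg _ (tsum_congr fun K => by ring)

lemma vnorm_zero_eq (u : VField) : vnorm L 0 u = √(L ^ 3) * √(∑' K, ‖u K‖ ^ 2) := by
  rw [← Real.sqrt_mul (pow_pos hL.out 3).le, ← vnorm_zero_sq, Real.sqrt_sq (vnorm_nonneg L 0 u)]

lemma vnorm_one_eq (u : VField) :
    vnorm L 1 u = √(L ^ 3) * (2 * Real.pi / L) * √(∑' K, kabs K ^ 2 * ‖u K‖ ^ 2) := by
  have hpi : 0 ≤ 2 * Real.pi / L := div_nonneg (by positivity) hL.out.le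
  have hsqrt : vnorm L 1 u = √(vnorm L 1 u ^ 2) := (Real.sqrt_sq (vnorm_nonneg L 1 u)).symm
  rw [hsqrt, vnorm_one_sq, Real.sqrt_mul (pow_pos hL.out 3).le, Real.sqrt_mul (sq_nonneg _),
    Real.sqrt_sq hpi, mul_assoc]

end Norms

section FourthPower

variable {X E : Type*} [MeasurableSpace X] {μ : Measure X} [NormedAddCommGroup E] {f : X → E}

lemma eLpNorm_four_pow_four : eLpNorm f 4 μ ^ 4 = ∫⁻ x, ‖f x‖ₑ ^ 4 ∂μ := by
  simpa using eLpNorm_nnreal_pow_eq_lintegral (μ := μ) (f := f) (p := 4) (by norm_num)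

lemma memLp_four_and_integral_le (hf : AEStronglyMeasurable f μ) {C : ℝ} (hC : 0 ≤ C)
    (h : ∫⁻ x, ‖f x‖ₑ ^ 4 ∂μ ≤ ENNReal.ofReal C) :
    MemLp f 4 μ ∧ ∫ x, ‖f x‖ ^ 4 ∂μ ≤ C := by
  refine ⟨⟨hf, ?_⟩, ?_⟩
  · refine (ENNReal.pow_lt_top_iff.1 ?_).resolve_right four_ne_zero
    rw [eLpNorm_four_pow_four]
    exact h.trans_lt ENNReal.ofReal_lt_top
  · have hmeas : AEStronglyMeasurable (fun x => ‖f x‖ ^ 4) μ := hf.norm.pow 4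
    rw [integral_eq_lintegral_of_nonneg_ae (ae_of_all _ fun _ => pow_nonneg (norm_nonneg _) 4)
      hmeas]
    refine ENNReal.toReal_le_of_le_ofReal hC (le_of_eq_of_le (lintegral_congr fun x => ?_) h)
    rw [ENNReal.ofReal_pow (norm_nonneg _), ofReal_norm]

end FourthPower

lemma summable_mul_and_tsum_mul_le {ι : Type*} {a b : ι → ℝ} (ha : ∀ i, 0 ≤ a i)
    (hb : ∀ i, 0 ≤ b i) (ha' : Summable fun i => a i ^ 2) (hb' : Summable fun i => b i ^ 2) :
    Summable (fun i => a i * b i) ∧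
      ∑' i, a i * b i ≤ √(∑' i, a i ^ 2) * √(∑' i, b i ^ 2) := by
  simpa only [Real.rpow_two, ← Real.sqrt_eq_rpow] using
    Real.summable_and_inner_le_Lp_mul_Lq_tsum_of_nonneg Real.HolderConjugate.two_two ha hb
      (by simpa only [Real.rpow_two] using ha') (by simpa only [Real.rpow_two] using hb')

section Ladyzhenskaya

variable (L : ℝ) [hL : Fact (0 < L)]

lemma IsH1.tsum_kabs_mul_le {u : VField} (hu : IsH1 u) :
    ∑' K, ENNReal.ofReal (kabs K) * ‖u K‖ₑ ^ 2 ≤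
      ENNReal.ofReal (√(∑' K, ‖u K‖ ^ 2) * √(∑' K, kabs K ^ 2 * ‖u K‖ ^ 2)) := by
  have hterm : ∀ K, ENNReal.ofReal (kabs K) * ‖u K‖ₑ ^ 2 =
      ENNReal.ofReal (‖u K‖ * (kabs K * ‖u K‖)) := by
    intro K
    rw [mul_left_comm, ENNReal.ofReal_mul (kabs_nonneg K), ← sq,
      ENNReal.ofReal_pow (norm_nonneg _), ofReal_norm]
  obtain ⟨hsum, hle⟩ := summable_mul_and_tsum_mul_le (fun K => norm_nonneg (u K))
    (fun K => mul_nonneg (kabs_nonneg K) (norm_nonneg (u K))) hu.summable_sq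
    (by simpa only [mul_pow] using hu.summable)
  simp only [hterm]
  rw [← ENNReal.ofReal_tsum_of_nonneg (fun K => mul_nonneg (norm_nonneg _)
    (mul_nonneg (kabs_nonneg K) (norm_nonneg _))) hsum]
  exact ENNReal.ofReal_le_ofReal (by simpa only [mul_pow] using hle)

lemma IsH1.lintegral_enorm_pow_four_le {u : VField} (hu : IsH1 u) :
    ∫⁻ x : Torus L, ‖value L u x‖ₑ ^ 4 ≤ ENNReal.ofReal
      (416 * L ^ 3 * √(∑' K, ‖u K‖ ^ 2) * √(∑' K, kabs K ^ 2 * ‖u K‖ ^ 2) ^ 3) := by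
  have h3 : 0 < L ^ 3 := pow_pos hL.out 3
  set D := ∑' K, kabs K ^ 2 * ‖u K‖ ^ 2
  have hbound : ∀ T, 0 < T → 26 * D ≤ T → ∫⁻ x : Torus L, ‖value L u x‖ₑ ^ 4 ≤
      ENNReal.ofReal (16 * T * (L ^ 3 * (√(∑' K, ‖u K‖ ^ 2) * √D))) := by
    intro T hT hDT
    rw [ENNReal.ofReal_mul (by positivity), ENNReal.ofReal_mul h3.le]
    refine (lintegral_enorm_pow_four_value_le L hu hT hDT).trans ?_
    gcongr
    exact hu.tsum_kabs_mul_le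
  obtain hD0 | hD0 : 0 = D ∨ 0 < D := (tsum_nonneg fun _ => by positivity : 0 ≤ D).eq_or_lt
  · refine (hbound 1 one_pos (by linarith)).trans (le_of_eq ?_)
    simp [← hD0]
  · refine (hbound (26 * D) (by positivity) le_rfl).trans (le_of_eq ?_)
    nth_rewrite 1 [← Real.sq_sqrt hD0.le]
    ring_nf

lemma IsH1.ladyzhenskaya {u : VField} (hu : IsH1 u) :
    MemLp (value L u) 4 (volume : Measure (Torus L)) ∧
      ∫ x : Torus L, ‖value L u x‖ ^ 4 ≤ 2 * vnorm L 0 u * vnorm L 1 u ^ 3 := by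
  have hLpos := hL.out
  refine memLp_four_and_integral_le (memLp_value L u).1
    (mul_nonneg (mul_nonneg two_pos.le (vnorm_nonneg L 0 u)) (pow_nonneg (vnorm_nonneg L 1 u) 3))
    ((hu.lintegral_enorm_pow_four_le L).trans (ENNReal.ofReal_le_ofReal ?_))
  rw [vnorm_zero_eq, vnorm_one_eq]
  set N := ∑' K, ‖u K‖ ^ 2
  set D := ∑' K, kabs K ^ 2 * ‖u K‖ ^ 2
  have hL6 : √(L ^ 3) ^ 4 = L ^ 6 := by
    rw [show 4 = 2 * 2 from rfl, pow_mul, Real.sq_sqrt (by positivity)]; ring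
  have hpi : 416 ≤ 16 * Real.pi ^ 3 := by
    have := pow_le_pow_left₀ (by norm_num) Real.pi_gt_three.le 3
    linarith
  calc 416 * L ^ 3 * √N * √D ^ 3 ≤ 16 * Real.pi ^ 3 * L ^ 3 * √N * √D ^ 3 := by gcongr
    _ = 2 * (√(L ^ 3) ^ 4 * √N * (2 * Real.pi / L) ^ 3 * √D ^ 3) := by
        rw [hL6]; field_simp; ring
    _ = 2 * (√(L ^ 3) * √N) * (√(L ^ 3) * (2 * Real.pi / L) * √D) ^ 3 := by ring

lemma IsGNConst.integral_pow_four_le {c : ℝ} (hc : IsGNConst L c) {u : VField} (hu : InV 1 u) :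
    ∫ x : Torus L, ‖value L u x‖ ^ 4 ≤ c ^ 4 * vnorm L 0 u * vnorm L 1 u ^ 3 := by
  have h0 := vnorm_nonneg L 0 u
  have h1 := vnorm_nonneg L 1 u
  have hc0 := hc.pos.le
  refine (memLp_four_and_integral_le (memLp_value L u).1 (by positivity) ?_).2
  have hpow : c ^ 4 * vnorm L 0 u * vnorm L 1 u ^ 3 =
      (c * vnorm L 0 u ^ (1 / 4 : ℝ) * vnorm L 1 u ^ (3 / 4 : ℝ)) ^ 4 := by
    rw [mul_pow, mul_pow, ← Real.rpow_natCast (_ ^ (1 / 4 : ℝ)), ← Real.rpow_mul h0,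
      ← Real.rpow_natCast (_ ^ (3 / 4 : ℝ)), ← Real.rpow_mul h1]
    norm_num
  rw [← eLpNorm_four_pow_four, hpow, ENNReal.ofReal_pow (by positivity)]
  gcongr
  exact hc.l4 u hu

end Ladyzhenskaya

instance holderTriple_four_four_two : ENNReal.HolderTriple 4 4 2 where
  inv_add_inv_eq_inv := by
    rw [← two_mul, show (4 : ℝ≥0∞) = 2 * 2 by norm_num,
      ENNReal.mul_inv (Or.inl two_ne_zero) (Or.inl ENNReal.ofNat_ne_top), ← mul_assoc,
      ENNReal.mul_inv_cancel two_ne_zero ENNReal.ofNat_ne_top, one_mul]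

section Gradient

variable (L : ℝ) [hL : Fact (0 < L)]

lemma norm_partialDeriv_sq (i : Fin 3) (u : VField) (K : Fin 3 → ℤ) :
    ‖partialDeriv L i u K‖ ^ 2 = (2 * Real.pi / L) ^ 2 * ((K i : ℝ) ^ 2 * ‖u K‖ ^ 2) := by
  rw [partialDeriv, norm_smul]
  simp only [norm_div, norm_mul, Complex.norm_I, Complex.norm_intCast, Complex.norm_real,
    Real.norm_eq_abs, Complex.norm_ofNat, abs_of_pos hL.out, abs_of_pos Real.pi_pos]
  rw [← sq_abs (K i : ℝ)]
  ring

lemma IsH1.summable_partialDeriv {u : VField} (hu : IsH1 u) (i : Fin 3) :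
    Summable fun K => ‖partialDeriv L i u K‖ ^ 2 := by
  simp only [norm_partialDeriv_sq]
  refine (hu.summable.of_nonneg_of_le (fun _ => by positivity) fun K => ?_).mul_left _
  have hKi : (K i : ℝ) ^ 2 ≤ kabs K ^ 2 := by
    simpa only [sq_abs] using pow_le_pow_left₀ (abs_nonneg _) (abs_le_kabs K i) 2
  gcongr

omit hL in
lemma partialDeriv_sub (i : Fin 3) (u v : VField) :
    partialDeriv L i (u - v) = partialDeriv L i u - partialDeriv L i v := by
  ext K
  simp [partialDeriv, smul_sub]

/-- The length `|∇u|` of the gradient of a field, as a function on the torus. -/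
def gradNorm (u : VField) (x : Torus L) : ℝ :=
  √(∑ i, ‖value L (partialDeriv L i u) x‖ ^ 2)

lemma gradNorm_sq (u : VField) (x : Torus L) :
    gradNorm L u x ^ 2 = ∑ i, ‖value L (partialDeriv L i u) x‖ ^ 2 :=
  Real.sq_sqrt (Finset.sum_nonneg fun _ _ => sq_nonneg _)

lemma memLp_gradNorm (u : VField) : MemLp (gradNorm L u) 2 volume := by
  have hmeas : AEStronglyMeasurable (gradNorm L u) volume :=
    (AEMeasurable.sqrt (Finset.aemeasurable_fun_sum _ fun i _ =>
      ((memLp_value L _).1.norm.aemeasurable.pow_const 2))).aestronglyMeasurable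
  rw [memLp_two_iff_integrable_sq hmeas]
  simp only [gradNorm_sq]
  exact integrable_finsetSum _ fun i _ => (memLp_value L _).integrable_norm_pow two_ne_zero

lemma IsH1.integral_gradNorm_sq {u : VField} (hu : IsH1 u) :
    ∫ x, gradNorm L u x ^ 2 = vnorm L 1 u ^ 2 := by
  simp only [gradNorm_sq]
  rw [integral_finsetSum _ fun i _ => (memLp_value L _).integrable_norm_pow two_ne_zero,
    Finset.sum_congr rfl fun i _ => integral_norm_sq_value L (hu.summable_partialDeriv L i),
    ← Finset.mul_sum, ← Summable.tsum_finsetSum fun i _ => hu.summable_partialDeriv L i,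
    vnorm_one_sq, ← tsum_mul_left (a := (2 * Real.pi / L) ^ 2)]
  refine congrArg _ (tsum_congr fun K => ?_)
  simp only [norm_partialDeriv_sq]
  rw [← Finset.mul_sum, ← Finset.sum_mul, ← kabs_sq]

end Gradient

section Trilinear

variable (L : ℝ) [hL : Fact (0 < L)]

lemma IsH1.memLp_coord_four {u : VField} (hu : IsH1 u) (j : Fin 3) :
    MemLp (fun x => value L u x j) 4 volume :=
  (hu.ladyzhenskaya L).1.of_le (memLp_value_coord L u j).1
    (ae_of_all _ fun _ => PiLp.norm_apply_le _ j)

lemma IsH1.memLp_mul {u v : VField} (hu : IsH1 u) (hv : IsH1 v) (i j : Fin 3) :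
    MemLp (fun x => value L u x i * value L v x j) 2 volume :=
  (hv.memLp_coord_four L j).mul (hu.memLp_coord_four L i)

lemma IsH1.integrable_tri {u v : VField} (hu : IsH1 u) (hv : IsH1 v) (w : VField) (i j : Fin 3) :
    Integrable fun x => value L u x i * value L v x j * value L (partialDeriv L i w) x j :=
  (hu.memLp_mul L hv i j).integrable_mul (memLp_value_coord L _ j)

/-- The trilinear form `∫ (u ⬝ ∇) w ⬝ v` of the Navier–Stokes nonlinearity; the differentiated
field is the *last* argument. -/
def tri (u v w : VField) : ℂ :=
  ∑ i, ∑ j, ∫ x, value L u x i * value L v x j * value L (partialDeriv L i w) x j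

lemma tri_sub_left {u u' v w : VField} (hu : IsH1 u) (hu' : IsH1 u') (hv : IsH1 v) :
    tri L (u - u') v w = tri L u v w - tri L u' v w := by
  simp only [tri, ← Finset.sum_sub_distrib]
  refine Finset.sum_congr rfl fun i _ => Finset.sum_congr rfl fun j _ => ?_
  rw [← integral_sub (hu.integrable_tri L hv w i j) (hu'.integrable_tri L hv w i j)]
  refine integral_congr_ae ?_
  filter_upwards [value_sub L hu.summable_sq hu'.summable_sq] with x hx
  rw [hx, PiLp.sub_apply]
  ring

lemma tri_sub_mid {u v v' w : VField} (hu : IsH1 u) (hv : IsH1 v) (hv' : IsH1 v') :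
    tri L u (v - v') w = tri L u v w - tri L u v' w := by
  simp only [tri, ← Finset.sum_sub_distrib]
  refine Finset.sum_congr rfl fun i _ => Finset.sum_congr rfl fun j _ => ?_
  rw [← integral_sub (hu.integrable_tri L hv w i j) (hu.integrable_tri L hv' w i j)]
  refine integral_congr_ae ?_
  filter_upwards [value_sub L hv.summable_sq hv'.summable_sq] with x hx
  rw [hx, PiLp.sub_apply]
  ring

lemma tri_sub_right {u v w w' : VField} (hu : IsH1 u) (hv : IsH1 v) (hw : IsH1 w)
    (hw' : IsH1 w') : tri L u v (w - w') = tri L u v w - tri L u v w' := by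
  simp only [tri, ← Finset.sum_sub_distrib]
  refine Finset.sum_congr rfl fun i _ => Finset.sum_congr rfl fun j _ => ?_
  rw [← integral_sub (hu.integrable_tri L hv w i j) (hu.integrable_tri L hv w' i j)]
  refine integral_congr_ae ?_
  rw [partialDeriv_sub]
  filter_upwards [value_sub L (hw.summable_partialDeriv L i) (hw'.summable_partialDeriv L i)]
    with x hx
  rw [hx, PiLp.sub_apply]
  ring

lemma norm_sum_sum_mul_le (a b : EuclideanSpace ℂ (Fin 3))
    (m : Fin 3 → EuclideanSpace ℂ (Fin 3)) :
    ‖∑ i, ∑ j, a i * b j * m i j‖ ≤ ‖a‖ * ‖b‖ * √(∑ i, ‖m i‖ ^ 2) := by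
  have hrow : ∀ i, ‖∑ j, b j * m i j‖ ≤ ‖b‖ * ‖m i‖ := by
    intro i
    have hcs := Real.sum_mul_le_sqrt_mul_sqrt Finset.univ (fun j => ‖b j‖) fun j => ‖m i j‖
    rw [← EuclideanSpace.norm_eq, ← EuclideanSpace.norm_eq] at hcs
    simpa only [norm_mul] using (norm_sum_le _ _).trans ((Finset.sum_le_sum fun j _ =>
      (norm_mul (b j) (m i j)).le).trans hcs)
  calc ‖∑ i, ∑ j, a i * b j * m i j‖ ≤ ∑ i, ‖a i‖ * (‖b‖ * ‖m i‖) := by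
        refine norm_sum_le_of_le _ fun i _ => ?_
        simp only [mul_assoc]
        rw [← Finset.mul_sum, norm_mul]
        exact mul_le_mul_of_nonneg_left (hrow i) (norm_nonneg _)
    _ = ‖b‖ * ∑ i, ‖a i‖ * ‖m i‖ := by simp only [Finset.mul_sum, mul_left_comm]
    _ ≤ ‖b‖ * (‖a‖ * √(∑ i, ‖m i‖ ^ 2)) := by
        rw [EuclideanSpace.norm_eq a]
        gcongr
        exact Real.sum_mul_le_sqrt_mul_sqrt _ _ _
    _ = _ := by ring

/-- The fourth power `∫ |u|⁴` of the `L⁴` norm of a field. -/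
def fourthMoment (u : VField) : ℝ := ∫ x, ‖value L u x‖ ^ 4

lemma fourthMoment_nonneg (u : VField) : 0 ≤ fourthMoment L u :=
  integral_nonneg fun _ => by positivity

lemma IsH1.memLp_norm_mul {u v : VField} (hu : IsH1 u) (hv : IsH1 v) :
    MemLp (fun x => ‖value L u x‖ * ‖value L v x‖) 2 volume :=
  (hv.ladyzhenskaya L).1.norm.mul (hu.ladyzhenskaya L).1.norm

lemma IsH1.sq_integral_sq_mul_sq_le {u v : VField} (hu : IsH1 u) (hv : IsH1 v) :
    (∫ x, (‖value L u x‖ * ‖value L v x‖) ^ 2) ^ 2 ≤ fourthMoment L u * fourthMoment L v := by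
  have hsq : ∀ {u : VField}, IsH1 u → MemLp (fun x => ‖value L u x‖ ^ 2) 2 volume := fun hu => by
    simpa only [sq] using hu.memLp_norm_mul L hu
  simpa only [← mul_pow, ← pow_mul, fourthMoment] using sq_integral_mul_le (hsq hu) (hsq hv)

lemma norm_tri_le_integral {u v : VField} (hu : IsH1 u) (hv : IsH1 v) (w : VField) :
    ‖tri L u v w‖ ≤ ∫ x, (‖value L u x‖ * ‖value L v x‖) * gradNorm L w x := by
  have htri : tri L u v w = ∫ x, ∑ i, ∑ j,
      value L u x i * value L v x j * value L (partialDeriv L i w) x j := by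
    rw [tri, integral_finsetSum _ fun i _ =>
      integrable_finsetSum _ fun j _ => hu.integrable_tri L hv w i j]
    exact Finset.sum_congr rfl fun i _ =>
      (integral_finsetSum _ fun j _ => hu.integrable_tri L hv w i j).symm
  rw [htri]
  exact norm_integral_le_of_norm_le
    ((hu.memLp_norm_mul L hv).integrable_mul (memLp_gradNorm L w))
    (ae_of_all _ fun x => norm_sum_sum_mul_le _ _ fun i => value L (partialDeriv L i w) x)

lemma norm_tri_pow_four_le {u v w : VField} (hu : IsH1 u) (hv : IsH1 v) (hw : IsH1 w) :
    ‖tri L u v w‖ ^ 4 ≤ fourthMoment L u * fourthMoment L v * vnorm L 1 w ^ 4 := by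
  have hcs : ‖tri L u v w‖ ^ 2 ≤
      (∫ x, (‖value L u x‖ * ‖value L v x‖) ^ 2) * vnorm L 1 w ^ 2 := by
    rw [← hw.integral_gradNorm_sq L]
    exact (pow_le_pow_left₀ (norm_nonneg _) (norm_tri_le_integral L hu hv w) 2).trans
      (sq_integral_mul_le (hu.memLp_norm_mul L hv) (memLp_gradNorm L w))
  calc ‖tri L u v w‖ ^ 4 = (‖tri L u v w‖ ^ 2) ^ 2 := by ring
    _ ≤ ((∫ x, (‖value L u x‖ * ‖value L v x‖) ^ 2) * vnorm L 1 w ^ 2) ^ 2 :=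
        pow_le_pow_left₀ (sq_nonneg _) hcs 2
    _ = (∫ x, (‖value L u x‖ * ‖value L v x‖) ^ 2) ^ 2 * vnorm L 1 w ^ 4 := by ring
    _ ≤ fourthMoment L u * fourthMoment L v * vnorm L 1 w ^ 4 := by
        gcongr
        exact hu.sq_integral_sq_mul_sq_le L hv

lemma IsH1.vnorm_zero_le {u : VField} (hu : IsH1 u) :
    2 * Real.pi / L * vnorm L 0 u ≤ vnorm L 1 u := by
  have hL0 := hL.out
  have hsum : ∑' K, ‖u K‖ ^ 2 ≤ ∑' K, kabs K ^ 2 * ‖u K‖ ^ 2 :=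
    hu.summable_sq.tsum_le_tsum (norm_sq_le_kabs_sq_mul hu.mean_zero) hu.summable
  calc 2 * Real.pi / L * vnorm L 0 u = √(L ^ 3) * (2 * Real.pi / L) * √(∑' K, ‖u K‖ ^ 2) := by
        rw [vnorm_zero_eq]
        ring
    _ ≤ vnorm L 1 u := by
        rw [vnorm_one_eq]
        gcongr

lemma IsH1.fourthMoment_le {u : VField} (hu : IsH1 u) :
    fourthMoment L u ≤ L / Real.pi * vnorm L 1 u ^ 4 := by
  have hL0 := hL.out
  have hpos := vnorm_nonneg L 1 u
  calc fourthMoment L u ≤ 2 * vnorm L 0 u * vnorm L 1 u ^ 3 := (hu.ladyzhenskaya L).2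
    _ = L / Real.pi * (2 * Real.pi / L * vnorm L 0 u) * vnorm L 1 u ^ 3 := by
        have := Real.pi_pos
        field_simp
    _ ≤ L / Real.pi * vnorm L 1 u * vnorm L 1 u ^ 3 := by
        gcongr
        exact hu.vnorm_zero_le L
    _ = _ := by ring

lemma norm_tri_le {u v w : VField} (hu : IsH1 u) (hv : IsH1 v) (hw : IsH1 w) :
    ‖tri L u v w‖ ≤ √(L / Real.pi) * (vnorm L 1 u * vnorm L 1 v * vnorm L 1 w) := by
  have hL0 := hL.out
  have hnn := fun u => vnorm_nonneg L 1 u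
  have hnn' := fourthMoment_nonneg L v
  refine le_of_pow_le_pow_left₀ four_ne_zero
    (mul_nonneg (Real.sqrt_nonneg _) (mul_nonneg (mul_nonneg (hnn u) (hnn v)) (hnn w))) ?_
  calc ‖tri L u v w‖ ^ 4 ≤ fourthMoment L u * fourthMoment L v * vnorm L 1 w ^ 4 :=
        norm_tri_pow_four_le L hu hv hw
    _ ≤ (L / Real.pi * vnorm L 1 u ^ 4) * (L / Real.pi * vnorm L 1 v ^ 4) * vnorm L 1 w ^ 4 := by
        gcongr
        exacts [hu.fourthMoment_le L, hv.fourthMoment_le L]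
    _ = (√(L / Real.pi) ^ 2) ^ 2 * (vnorm L 1 u * vnorm L 1 v * vnorm L 1 w) ^ 4 := by
        rw [Real.sq_sqrt (by positivity)]
        ring
    _ = _ := by ring

end Trilinear

section Antisymmetry

variable (L : ℝ) [hL : Fact (0 < L)]

/-- The Fourier coefficients of the product `u_i v_j` of components of two fields, without the
normalising factor `L⁻³`. -/
def prodCoeff (u v : VField) (i j : Fin 3) (K : Fin 3 → ℤ) : ℂ :=
  ∫ x, conj (mode L K x) * (value L u x i * value L v x j)

/-- The symbol `2 π i K_i / L` of the partial derivative `∂_i`. -/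
def derivSymbol (i : Fin 3) (K : Fin 3 → ℤ) : ℂ := 2 * Real.pi * Complex.I * (K i : ℂ) / L

omit hL in
lemma partialDeriv_apply (i j : Fin 3) (u : VField) (K : Fin 3 → ℤ) :
    partialDeriv L i u K j = derivSymbol L i K * u K j := rfl

/-- In divergence form, `(w ⬝ ∇) v = ∇ ⬝ (w ⊗ v)`. -/
lemma sum_prodCoeff_partialDeriv {w v : VField} (hw : IsH1 w)
    (hdiv : ∀ K, ∑ i, w K i * (K i : ℂ) = 0) (hv : IsH1 v) (K : Fin 3 → ℤ) (j : Fin 3) :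
    ∑ i, prodCoeff L w (partialDeriv L i v) i j K =
      ∑ i, derivSymbol L i K * prodCoeff L w v i j K := by
  have hlhs := hasSum_sum (s := Finset.univ) fun i (_ : i ∈ Finset.univ) =>
    hasSum_integral_conj_mode_mul_mul L (summable_coord hw.summable_sq i)
      (summable_coord (hv.summable_partialDeriv L i) j) K
  have hrhs := hasSum_sum (s := Finset.univ) fun i (_ : i ∈ Finset.univ) =>
    (hasSum_integral_conj_mode_mul_mul L (summable_coord hw.summable_sq i)
      (summable_coord hv.summable_sq j) K).mul_left (derivSymbol L i K)
  refine hlhs.unique (Eq.mpr (congrArg (HasSum · _) (funext fun J => ?_)) hrhs)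
  have htransport : ∑ i, w (K - J) i * (J i : ℂ) = ∑ i, w (K - J) i * (K i : ℂ) := by
    have := hdiv (K - J)
    simp only [Pi.sub_apply, Int.cast_sub, mul_sub] at this
    rw [Finset.sum_sub_distrib, sub_eq_zero] at this
    exact this.symm
  simp only [partialDeriv_apply, derivSymbol]
  calc _ = (L : ℂ) ^ 3 * (2 * Real.pi * Complex.I / L) * v J j * ∑ i, w (K - J) i * (J i : ℂ) := by
        rw [Finset.mul_sum]
        exact Finset.sum_congr rfl fun i _ => by ring
    _ = _ := by
        rw [htransport, Finset.mul_sum]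
        exact Finset.sum_congr rfl fun i _ => by ring

lemma hasSum_tri {u v g : VField} (hu : IsH1 u) (hv : IsH1 v) (hg : IsH1 g) :
    HasSum (fun K => ∑ j, g (-K) j * ∑ i, derivSymbol L i K * prodCoeff L u v i j K)
      (-tri L u v g) := by
  have hterm : ∀ i j, HasSum (fun K => g (-K) j * (derivSymbol L i K * prodCoeff L u v i j K))
      (-∫ x, value L u x i * value L v x j * value L (partialDeriv L i g) x j) := by
    intro i j
    have h := (hasSum_integral_series_mul L (summable_coord (hg.summable_partialDeriv L i) j)
      (hu.memLp_mul L hv i j)).neg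
    rw [← (Equiv.neg (Fin 3 → ℤ)).hasSum_iff] at h
    have hsummand : (fun K => g (-K) j * (derivSymbol L i K * prodCoeff L u v i j K)) =
        (fun K => -(partialDeriv L i g K j * ∫ x, mode L K x * (value L u x i * value L v x j))) ∘
          Equiv.neg (Fin 3 → ℤ) := by
      funext K
      simp only [Function.comp, Equiv.neg_apply, partialDeriv_apply, derivSymbol, prodCoeff,
        mode_neg, Pi.neg_apply, Int.cast_neg]
      ring
    have hval : ∫ x, value L u x i * value L v x j * value L (partialDeriv L i g) x j =
        ∫ x, series L (fun K => partialDeriv L i g K j) x * (value L u x i * value L v x j) :=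
      integral_congr_ae (ae_of_all _ fun x => mul_comm _ _)
    rw [hsummand, hval]
    exact h
  rw [tri, Finset.sum_comm, ← Finset.sum_neg_distrib]
  simp only [Finset.mul_sum, ← Finset.sum_neg_distrib]
  exact hasSum_sum fun j _ => hasSum_sum fun i _ => hterm i j

lemma tri_swap_of_finite {w v g : VField} (hw : IsH1 w) (hdiv : ∀ K, ∑ i, w K i * (K i : ℂ) = 0)
    (hv : IsH1 v) (hg : IsH1 g) {S : Finset (Fin 3 → ℤ)} (hgS : ∀ K ∉ S, g K = 0) :
    tri L w g v = -tri L w v g := by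
  have hterm : ∀ i j, ∫ x, value L w x i * value L g x j * value L (partialDeriv L i v) x j =
      ∑ K ∈ S, g K j * prodCoeff L w (partialDeriv L i v) i j (-K) := by
    intro i j
    have hint : ∀ K, Integrable fun x => mode L K x * value L w x i *
        value L (partialDeriv L i v) x j := fun K =>
      (memLp_mode_mul L (memLp_value_coord L w i) K).integrable_mul (memLp_value_coord L _ j)
    simp only [prodCoeff, mode_neg, Complex.conj_conj, ← mul_assoc, ← integral_const_mul]
    rw [← integral_finsetSum _ fun K _ => by
      simpa only [mul_assoc] using (hint K).const_mul (g K j)]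
    refine integral_congr_ae ?_
    filter_upwards [value_finset L hgS] with x hx
    simp only [hx, WithLp.ofLp_sum, Finset.sum_apply, PiLp.smul_apply, smul_eq_mul,
      Finset.mul_sum, Finset.sum_mul]
    exact Finset.sum_congr rfl fun K _ => by ring
  have hsum := (Equiv.neg (Fin 3 → ℤ)).hasSum_iff.2 (hasSum_tri L hw hv hg)
  refine Eq.trans ?_ ((hasSum_sum_of_ne_finset_zero (s := S) fun K hK => ?_).unique hsum)
  · simp only [tri, hterm, Function.comp, Equiv.neg_apply, neg_neg,
      ← sum_prodCoeff_partialDeriv L hw hdiv hv, Finset.mul_sum]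
    simp only [Finset.sum_comm (s := Finset.univ) (t := S)]
    exact Finset.sum_congr rfl fun K _ => Finset.sum_comm
  · simp [hgS K hK]

lemma IsH1.indicator {u : VField} (hu : IsH1 u) (S : Set (Fin 3 → ℤ)) : IsH1 (S.indicator u) where
  mean_zero := by simp [Set.indicator, hu.mean_zero]
  summable := hu.summable.of_nonneg_of_le (fun _ => by positivity) fun K => by
    gcongr
    exact norm_indicator_le_norm_self u K

lemma tendsto_vnorm_one_sub_indicator_box (u : VField) :
    Tendsto (fun M => vnorm L 1 (u - (box M : Set (Fin 3 → ℤ)).indicator u)) atTop (𝓝 0) := by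
  have htail := (tendsto_tsum_compl_atTop_zero fun K => kabs K ^ 2 * ‖u K‖ ^ 2).comp tendsto_box
  have hvnorm : ∀ M, vnorm L 1 (u - (box M : Set (Fin 3 → ℤ)).indicator u) =
      √(L ^ 3) * (2 * Real.pi / L) * √(∑' K : {K // K ∉ box M}, kabs K ^ 2 * ‖u K‖ ^ 2) := by
    intro M
    rw [vnorm_one_eq, ← Set.indicator_compl]
    congr 2
    refine Eq.trans (tsum_congr fun K => ?_)
      (tsum_subtype ((box M : Set (Fin 3 → ℤ))ᶜ) fun K => kabs K ^ 2 * ‖u K‖ ^ 2).symm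
    by_cases hK : K ∈ (box M : Set (Fin 3 → ℤ))ᶜ <;> simp [hK]
  simpa [hvnorm] using htail.sqrt.const_mul (√(L ^ 3) * (2 * Real.pi / L))

lemma tri_swap {w v g : VField} (hw : IsH1 w) (hdiv : ∀ K, ∑ i, w K i * (K i : ℂ) = 0)
    (hv : IsH1 v) (hg : IsH1 g) : tri L w g v = -tri L w v g := by
  set trunc : ℕ → VField := fun M => (box M : Set (Fin 3 → ℤ)).indicator g
  have htrunc : ∀ M, IsH1 (trunc M) := fun M => hg.indicator _
  have hdiff : ∀ M, tri L w g v + tri L w v g =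
      tri L w (g - trunc M) v + tri L w v (g - trunc M) := by
    intro M
    have hswap := tri_swap_of_finite L hw hdiv hv (htrunc M) (S := box M)
      fun K hK => Set.indicator_of_notMem hK g
    rw [tri_sub_mid L hw hg (htrunc M), tri_sub_right L hw hv hg (htrunc M), hswap]
    ring
  have hbound : ∀ M, ‖tri L w g v + tri L w v g‖ ≤ 2 * (√(L / Real.pi) *
      (vnorm L 1 w * vnorm L 1 v)) * vnorm L 1 (g - trunc M) := by
    intro M
    rw [hdiff M]
    calc _ ≤ ‖tri L w (g - trunc M) v‖ + ‖tri L w v (g - trunc M)‖ := norm_add_le _ _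
      _ ≤ _ := add_le_add (norm_tri_le L hw (hg.sub (htrunc M)) hv)
        (norm_tri_le L hw hv (hg.sub (htrunc M)))
      _ = _ := by ring
  have hlim := (tendsto_vnorm_one_sub_indicator_box L g).const_mul
    (2 * (√(L / Real.pi) * (vnorm L 1 w * vnorm L 1 v)))
  rw [mul_zero] at hlim
  exact eq_neg_of_add_eq_zero_left (norm_le_zero_iff.1 (ge_of_tendsto' hlim hbound))

lemma tri_self {w v : VField} (hw : IsH1 w) (hdiv : ∀ K, ∑ i, w K i * (K i : ℂ) = 0)
    (hv : IsH1 v) : tri L w v v = 0 :=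
  self_eq_neg.1 (tri_swap L hw hdiv hv hv)

end Antisymmetry

section Leray

lemma leray_zero (X : VField) : leray X 0 = 0 := if_pos rfl

lemma leray_apply (X : VField) {K : Fin 3 → ℤ} (hK : K ≠ 0) (i : Fin 3) :
    leray X K i = X K i - (K i : ℂ) * (∑ j, X K j * (K j : ℂ)) / ((kabs K ^ 2 : ℝ) : ℂ) := by
  rw [leray, if_neg hK]

lemma sum_leray_mul (X : VField) {K : Fin 3 → ℤ} (hK : K ≠ 0) {y : Fin 3 → ℂ}
    (hy : ∑ j, y j * (K j : ℂ) = 0) : ∑ j, leray X K j * y j = ∑ j, X K j * y j := by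
  have hterm : ∀ j, leray X K j * y j = X K j * y j -
      (∑ j, X K j * (K j : ℂ)) / ((kabs K ^ 2 : ℝ) : ℂ) * (y j * (K j : ℂ)) := by
    intro j
    rw [leray_apply X hK]
    ring
  simp only [hterm]
  rw [Finset.sum_sub_distrib, ← Finset.mul_sum, hy, mul_zero, sub_zero]

lemma sum_leray_mul_wave (X : VField) (K : Fin 3 → ℤ) : ∑ i, leray X K i * (K i : ℂ) = 0 := by
  by_cases hK : K = 0
  · simp [hK]
  have hkabs : ((kabs K ^ 2 : ℝ) : ℂ) ≠ 0 := by
    have := one_le_kabs hK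
    exact_mod_cast (by positivity : kabs K ^ 2 ≠ 0)
  have hsum_sq : ∑ i, (K i : ℂ) * (K i : ℂ) = ((kabs K ^ 2 : ℝ) : ℂ) := by
    rw [kabs_sq]
    push_cast
    exact Finset.sum_congr rfl fun i _ => (sq _).symm
  calc ∑ i, leray X K i * (K i : ℂ)
      = ∑ i, (X K i * (K i : ℂ) - (∑ j, X K j * (K j : ℂ)) / ((kabs K ^ 2 : ℝ) : ℂ) *
          ((K i : ℂ) * (K i : ℂ))) :=
        Finset.sum_congr rfl fun i _ => by
          rw [leray_apply X hK]
          ring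
    _ = 0 := by rw [Finset.sum_sub_distrib, ← Finset.mul_sum, hsum_sq, div_mul_cancel₀ _ hkabs,
        sub_self]

lemma norm_leray_le (X : VField) (K : Fin 3 → ℤ) : ‖leray X K‖ ≤ ‖X K‖ := by
  by_cases hK : K = 0
  · rw [hK, leray_zero, norm_zero]
    exact norm_nonneg _
  have hdiv : ∑ j, conj (leray X K j) * (K j : ℂ) = 0 := by
    simpa using congrArg conj (sum_leray_mul_wave X K)
  have hinner : ((‖leray X K‖ ^ 2 : ℝ) : ℂ) = inner ℂ (leray X K) (X K) := by
    rw [EuclideanSpace.norm_sq_eq, PiLp.inner_apply]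
    simp only [RCLike.inner_apply]
    rw [← sum_leray_mul X hK hdiv]
    push_cast
    exact Finset.sum_congr rfl fun j _ => by rw [Complex.mul_conj']
  have hcs : ‖leray X K‖ ^ 2 ≤ ‖leray X K‖ * ‖X K‖ := by
    have h := norm_inner_le_norm (𝕜 := ℂ) (leray X K) (X K)
    rwa [← hinner, Complex.norm_real, Real.norm_of_nonneg (sq_nonneg _)] at h
  by_contra! h
  nlinarith [norm_nonneg (X K)]

lemma leray_eq_self {X : VField} {K : Fin 3 → ℤ} (h0 : X 0 = 0)
    (hdiv : ∑ j, X K j * (K j : ℂ) = 0) : leray X K = X K := by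
  by_cases hK : K = 0
  · rw [hK, leray_zero, h0]
  · ext i
    rw [leray_apply X hK, hdiv, mul_zero, zero_div, sub_zero]

lemma continuousOn_leray {T : Type*} [TopologicalSpace T] {X : T → VField} {K : Fin 3 → ℤ}
    {S : Set T} (hX : ContinuousOn (fun s => X s K) S) :
    ContinuousOn (fun s => leray (X s) K) S := by
  have hcoord : ∀ j, ContinuousOn (fun s => X s K j) S := fun j =>
    (EuclideanSpace.proj (𝕜 := ℂ) j).continuous.comp_continuousOn hX
  by_cases hK : K = 0
  · simp only [hK, leray_zero, continuousOn_const]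
  · simp only [leray, if_neg hK]
    refine (PiLp.continuous_toLp 2 _).comp_continuousOn (continuousOn_pi.2 fun i => ?_)
    exact (hcoord i).sub ((continuousOn_const.mul (continuousOn_finsetSum _ fun j _ =>
      (hcoord j).mul continuousOn_const)).div_const _)

end Leray

section Bilinear

variable (L : ℝ) [hL : Fact (0 < L)]

/-- The length `2 π |K| / L` of a wave vector. -/
def wave (K : Fin 3 → ℤ) : ℝ := 2 * Real.pi * kabs K / L

lemma wave_nonneg (K : Fin 3 → ℤ) : 0 ≤ wave L K :=
  div_nonneg (mul_nonneg (by positivity) (kabs_nonneg K)) hL.out.le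

lemma sum_norm_derivSymbol_sq (K : Fin 3 → ℤ) : ∑ i, ‖derivSymbol L i K‖ ^ 2 = wave L K ^ 2 := by
  simp only [derivSymbol, norm_div, norm_mul, Complex.norm_I, Complex.norm_intCast,
    Complex.norm_real, Real.norm_eq_abs, Complex.norm_ofNat, abs_of_pos hL.out,
    abs_of_pos Real.pi_pos, wave, mul_pow, div_pow, sq_abs, kabs_sq, Finset.mul_sum,
    Finset.sum_div, mul_one]

lemma coeff_advect {w v : VField} (hw : IsH1 w) (hdiv : ∀ K, ∑ i, w K i * (K i : ℂ) = 0)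
    (hv : IsH1 v) (K : Fin 3 → ℤ) (j : Fin 3) : coeff L (advect L w v) K j =
      ((L : ℂ) ^ 3)⁻¹ * ∑ i, derivSymbol L i K * prodCoeff L w v i j K := by
  have hint : ∀ i j, Integrable fun x => conj (mode L K x) *
      (value L w x i * value L (partialDeriv L i v) x j) := fun i j =>
    ((memLp_conj_mode_mul L (memLp_value_coord L w i) K).integrable_mul
      (memLp_value_coord L (partialDeriv L i v) j)).congr (ae_of_all _ fun _ => mul_assoc _ _ _)
  have hcoord : ∀ j x, (conj (mode L K x) • advect L w v x) j =
      ∑ i, conj (mode L K x) * (value L w x i * value L (partialDeriv L i v) x j) := by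
    intro j x
    simp [advect, Finset.mul_sum]
  have hint_coord : ∀ j, Integrable fun x => (conj (mode L K x) • advect L w v x) j := fun j => by
    simpa only [hcoord] using integrable_finsetSum _ fun i _ => hint i j
  rw [coeff, PiLp.smul_apply, smul_eq_mul, eval_integral_piLp hint_coord]
  simp only [hcoord]
  rw [integral_finsetSum _ fun i _ => hint i j, ← sum_prodCoeff_partialDeriv L hw hdiv hv]
  rfl

/-- The size of the Fourier coefficients of the tensor product `u ⊗ v`. -/
def tensorNorm (u v : VField) (K : Fin 3 → ℤ) : ℝ :=
  (L ^ 3)⁻¹ * √(∑ j, ∑ i, ‖prodCoeff L u v i j K‖ ^ 2)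

lemma tensorNorm_nonneg (u v : VField) (K : Fin 3 → ℤ) : 0 ≤ tensorNorm L u v K :=
  mul_nonneg (inv_nonneg.2 (pow_pos hL.out 3).le) (Real.sqrt_nonneg _)

lemma tensorNorm_sq (u v : VField) (K : Fin 3 → ℤ) :
    tensorNorm L u v K ^ 2 = (L ^ 3)⁻¹ ^ 2 * ∑ j, ∑ i, ‖prodCoeff L u v i j K‖ ^ 2 := by
  rw [tensorNorm, mul_pow, Real.sq_sqrt (by positivity)]

lemma norm_bilin_le {u v : VField} (hu : IsH1 u) (hdiv : ∀ K, ∑ i, u K i * (K i : ℂ) = 0)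
    (hv : IsH1 v) (K : Fin 3 → ℤ) : ‖bilin L u v K‖ ≤ wave L K * tensorNorm L u v K := by
  have hL0 := hL.out
  refine (norm_leray_le _ K).trans ?_
  rw [EuclideanSpace.norm_eq]
  refine Real.sqrt_le_iff.2 ⟨mul_nonneg (wave_nonneg L K) (tensorNorm_nonneg L u v K), ?_⟩
  have hcoord : ∀ j, ‖coeff L (advect L u v) K j‖ ^ 2 ≤
      (L ^ 3)⁻¹ ^ 2 * (wave L K ^ 2 * ∑ i, ‖prodCoeff L u v i j K‖ ^ 2) := by
    intro j
    rw [coeff_advect L hu hdiv hv, norm_mul, mul_pow, norm_inv, norm_pow, Complex.norm_real,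
      Real.norm_of_nonneg hL0.le, ← sum_norm_derivSymbol_sq]
    refine mul_le_mul_of_nonneg_left ?_ (by positivity)
    calc ‖∑ i, derivSymbol L i K * prodCoeff L u v i j K‖ ^ 2
        ≤ (∑ i, ‖derivSymbol L i K‖ * ‖prodCoeff L u v i j K‖) ^ 2 := by
          gcongr
          exact norm_sum_le_of_le _ fun i _ => norm_mul_le _ _
      _ ≤ _ := Finset.sum_mul_sq_le_sq_mul_sq _ _ _
  calc ∑ j, ‖coeff L (advect L u v) K j‖ ^ 2
      ≤ ∑ j, (L ^ 3)⁻¹ ^ 2 * (wave L K ^ 2 * ∑ i, ‖prodCoeff L u v i j K‖ ^ 2) :=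
        Finset.sum_le_sum fun j _ => hcoord j
    _ = _ := by
        rw [← Finset.mul_sum, ← Finset.mul_sum, mul_pow, tensorNorm_sq]
        ring

lemma sum_sum_integral_norm_mul_sq {u : VField} (hu : IsH1 u) :
    ∑ j, ∑ i, ∫ x, ‖value L u x i * value L u x j‖ ^ 2 = fourthMoment L u := by
  have hint : ∀ i j, Integrable fun x => ‖value L u x i * value L u x j‖ ^ 2 :=
    fun i j => (hu.memLp_mul L hu i j).integrable_norm_pow two_ne_zero
  rw [fourthMoment, Finset.sum_congr rfl fun j _ => (integral_finsetSum _ fun i _ => hint i j).symm,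
    ← integral_finsetSum _ fun j _ => integrable_finsetSum _ fun i _ => hint i j]
  congr 1
  ext x
  rw [show ‖value L u x‖ ^ 4 = ‖value L u x‖ ^ 2 * ‖value L u x‖ ^ 2 by ring,
    EuclideanSpace.norm_sq_eq, Finset.sum_mul_sum, Finset.sum_comm]
  simp only [norm_mul, mul_pow]

lemma summable_tensorNorm_sq_and_tsum_le {u : VField} (hu : IsH1 u) :
    (Summable fun K => tensorNorm L u u K ^ 2) ∧
      L ^ 3 * ∑' K, tensorNorm L u u K ^ 2 ≤ fourthMoment L u := by
  have hL0 := hL.out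
  have hbessel : ∀ i j, (Summable fun K => ‖prodCoeff L u u i j K‖ ^ 2) ∧
      ∑' K, ‖prodCoeff L u u i j K‖ ^ 2 ≤ L ^ 3 * ∫ x, ‖value L u x i * value L u x j‖ ^ 2 :=
    fun i j => summable_and_tsum_norm_integral_conj_mode_mul_sq_le L (hu.memLp_mul L hu i j)
  have hrow : ∀ j, Summable fun K => ∑ i, ‖prodCoeff L u u i j K‖ ^ 2 := fun j =>
    summable_sum fun i _ => (hbessel i j).1
  simp only [tensorNorm_sq]
  refine ⟨(summable_sum fun j _ => hrow j).mul_left _, ?_⟩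
  have htsum : ∑' K, ∑ j, ∑ i, ‖prodCoeff L u u i j K‖ ^ 2 ≤ L ^ 3 * fourthMoment L u := by
    rw [Summable.tsum_finsetSum fun j _ => hrow j, ← sum_sum_integral_norm_mul_sq L hu]
    simp only [Finset.mul_sum]
    refine Finset.sum_le_sum fun j _ => ?_
    rw [Summable.tsum_finsetSum fun i _ => (hbessel i j).1]
    exact Finset.sum_le_sum fun i _ => (hbessel i j).2
  rw [tsum_mul_left]
  calc _ = (L ^ 3)⁻¹ * ∑' K, ∑ j, ∑ i, ‖prodCoeff L u u i j K‖ ^ 2 := by field_simp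
    _ ≤ (L ^ 3)⁻¹ * (L ^ 3 * fourthMoment L u) := by gcongr
    _ = _ := by field_simp

lemma hasSum_inner_bilin {u v g : VField} (hu : IsH1 u)
    (hdiv : ∀ K, ∑ i, u K i * (K i : ℂ) = 0) (hv : IsH1 v) (hg : InV 1 g) :
    HasSum (fun K => L ^ 3 * (inner ℂ (g K) (bilin L u v K)).re) (-(tri L u v g).re) := by
  have hLc : (L : ℂ) ^ 3 ≠ 0 := by exact_mod_cast (pow_pos hL.out 3).ne'
  have hre := Complex.hasSum_re (hasSum_tri L hu hv hg.isH1)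
  rw [Complex.neg_re] at hre
  refine (congrArg (HasSum · _) (funext fun K => ?_)).mpr hre
  by_cases hK : K = 0
  · simp [hK, hg.mean_zero]
  have hgdiv : ∑ j, g (-K) j * (K j : ℂ) = 0 := by simpa using hg.div_free (-K)
  have hinner : inner ℂ (g K) (bilin L u v K) = ∑ j, coeff L (advect L u v) K j * g (-K) j := by
    rw [← sum_leray_mul _ hK hgdiv, PiLp.inner_apply]
    exact Finset.sum_congr rfl fun j _ => by rw [RCLike.inner_apply, hg.real, bilin]
  rw [← Complex.re_ofReal_mul, hinner, Finset.mul_sum]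
  push_cast
  simp only [coeff_advect L hu hdiv hv, mul_assoc, mul_inv_cancel_left₀ hLc, mul_comm (g (-K) _)]

lemma integral_norm_mul_le {u v : VField} (hu : Summable fun K => ‖u K‖ ^ 2)
    (hv : Summable fun K => ‖v K‖ ^ 2) :
    ∫ x, ‖value L u x‖ * ‖value L v x‖ ≤ vnorm L 0 u * vnorm L 0 v := by
  have h := sq_integral_mul_le (memLp_value L u).norm (memLp_value L v).norm
  rw [integral_norm_sq_value L hu, integral_norm_sq_value L hv, ← vnorm_zero_sq, ← vnorm_zero_sq,
    ← mul_pow] at h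
  exact le_of_sq_le_sq h (mul_nonneg (vnorm_nonneg _ _ _) (vnorm_nonneg _ _ _))

lemma norm_prodCoeff_self_sub_le {u v : VField} (hu : IsH1 u) (hv : IsH1 v) (i j : Fin 3)
    (K : Fin 3 → ℤ) : ‖prodCoeff L u u i j K - prodCoeff L v v i j K‖ ≤
      vnorm L 0 u * vnorm L 0 (u - v) + vnorm L 0 (u - v) * vnorm L 0 v := by
  have hd := hu.sub hv
  have hint : ∀ u v : VField, Integrable fun x => ‖value L u x‖ * ‖value L v x‖ :=
    fun u v => (memLp_value L u).norm.integrable_mul (memLp_value L v).norm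
  have hprod : ∀ {u : VField}, IsH1 u → Integrable fun x =>
      conj (mode L K x) * (value L u x i * value L u x j) := fun hu =>
    (memLp_conj_mode_mul L (hu.memLp_mul L hu i j) K).integrable one_le_two
  refine le_trans ?_ (add_le_add (integral_norm_mul_le L hu.summable_sq hd.summable_sq)
    (integral_norm_mul_le L hd.summable_sq hv.summable_sq))
  rw [prodCoeff, prodCoeff, ← integral_sub (hprod hu) (hprod hv),
    ← integral_add (hint _ _) (hint _ _)]
  refine norm_integral_le_of_norm_le ((hint _ _).add (hint _ _)) ?_
  filter_upwards [value_sub L hu.summable_sq hv.summable_sq] with x hx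
  have hsplit : conj (mode L K x) * (value L u x i * value L u x j) -
      conj (mode L K x) * (value L v x i * value L v x j) =
      conj (mode L K x) * (value L u x i * value L (u - v) x j +
        value L (u - v) x i * value L v x j) := by
    rw [hx, PiLp.sub_apply, PiLp.sub_apply]
    ring
  rw [hsplit, norm_mul, RCLike.norm_conj, norm_mode, one_mul]
  refine (norm_add_le _ _).trans ?_
  rw [norm_mul, norm_mul]
  gcongr <;> exact PiLp.norm_apply_le _ _

end Bilinear

section Primitive

variable {E : Type*} [NormedAddCommGroup E] [NormedSpace ℝ E]

/-- `y` is an integral of `h` on `[a, b]`, that is, `y` is absolutely continuous there with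
`dy/dt = h`. This is the form in which the evolution equation holds for each Fourier mode. -/
structure IsPrimitiveOn (y h : ℝ → E) (a b : ℝ) : Prop where
  intervalIntegrable : IntervalIntegrable h volume a b
  sub_eq : ∀ t ∈ Set.Icc a b, y t - y a = ∫ s in a..t, h s

namespace IsPrimitiveOn

variable {y h : ℝ → E} {a b s t : ℝ}

lemma intervalIntegrable_mono (hy : IsPrimitiveOn y h a b) (has : a ≤ s) (hst : s ≤ t)
    (htb : t ≤ b) : IntervalIntegrable h volume s t := by
  refine hy.intervalIntegrable.mono_set ?_
  rw [Set.uIcc_of_le hst, Set.uIcc_of_le (has.trans (hst.trans htb))]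
  exact Set.Icc_subset_Icc has htb

lemma mono (hy : IsPrimitiveOn y h a b) (has : a ≤ s) (hst : s ≤ t) (htb : t ≤ b) :
    IsPrimitiveOn y h s t where
  intervalIntegrable := hy.intervalIntegrable_mono has hst htb
  sub_eq r hr := by
    have hsb : s ≤ b := hst.trans htb
    have har : a ≤ r := has.trans hr.1
    have hrb : r ≤ b := hr.2.trans htb
    rw [← intervalIntegral.integral_interval_sub_left (hy.intervalIntegrable_mono le_rfl har hrb)
      (hy.intervalIntegrable_mono le_rfl has hsb), ← hy.sub_eq r ⟨har, hrb⟩,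
      ← hy.sub_eq s ⟨has, hsb⟩, sub_sub_sub_cancel_right]

lemma continuousOn (hy : IsPrimitiveOn y h a b) (hab : a ≤ b) : ContinuousOn y (Set.Icc a b) := by
  have hint : ContinuousOn (fun t => ∫ s in a..t, h s) (Set.Icc a b) := by
    have := intervalIntegral.continuousOn_primitive_interval' hy.intervalIntegrable
      Set.left_mem_uIcc
    rwa [Set.uIcc_of_le hab] at this
  exact (hint.add continuousOn_const).congr fun t ht => sub_eq_iff_eq_add.1 (hy.sub_eq t ht)

lemma clm_comp {F : Type*} [NormedAddCommGroup F] [NormedSpace ℝ F] [CompleteSpace E]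
    [CompleteSpace F] (hy : IsPrimitiveOn y h a b) (T : E →L[ℝ] F) :
    IsPrimitiveOn (fun s => T (y s)) (fun s => T (h s)) a b where
  intervalIntegrable :=
    ⟨T.integrable_comp hy.intervalIntegrable.1, T.integrable_comp hy.intervalIntegrable.2⟩
  sub_eq t ht := by
    rw [← map_sub, hy.sub_eq t ht,
      T.intervalIntegral_comp_comm (hy.intervalIntegrable_mono le_rfl ht.1 ht.2)]

lemma sub {y' h' : ℝ → E} (hy : IsPrimitiveOn y h a b) (hy' : IsPrimitiveOn y' h' a b) :
    IsPrimitiveOn (fun s => y s - y' s) (fun s => h s - h' s) a b where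
  intervalIntegrable := hy.intervalIntegrable.sub hy'.intervalIntegrable
  sub_eq t ht := by
    rw [intervalIntegral.integral_sub (hy.intervalIntegrable_mono le_rfl ht.1 ht.2)
      (hy'.intervalIntegrable_mono le_rfl ht.1 ht.2), ← hy.sub_eq t ht, ← hy'.sub_eq t ht,
      sub_sub_sub_comm]

lemma sq_sub_sq {y h : ℝ → ℝ} (hy : IsPrimitiveOn y h a b) (hab : a ≤ b) :
    y b ^ 2 - y a ^ 2 = ∫ s in a..b, 2 * (y s * h s) := by
  set Y : ℝ → ℝ := fun t => (∫ s in a..t, h s) + y a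
  have hYy : ∀ t ∈ Set.Icc a b, Y t = y t := fun t ht =>
    (sub_eq_iff_eq_add.1 (hy.sub_eq t ht)).symm
  have hY : AbsolutelyContinuousOnInterval Y a b :=
    (hy.intervalIntegrable.absolutelyContinuousOnInterval_intervalIntegral
      Set.left_mem_uIcc).add
      (LipschitzWith.const (y a)).lipschitzOnWith.absolutelyContinuousOnInterval
  have hparts := hY.integral_deriv_mul_eq_sub hY
  rw [hYy b ⟨hab, le_rfl⟩, hYy a ⟨le_rfl, hab⟩] at hparts
  rw [sq, sq, ← hparts]
  refine intervalIntegral.integral_congr_ae ?_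
  filter_upwards [hy.intervalIntegrable.ae_hasDerivAt_integral] with t ht hmem
  rw [Set.uIoc_of_le hab] at hmem
  have htab : t ∈ Set.Icc a b := Set.Ioc_subset_Icc_self hmem
  have hderiv : HasDerivAt Y (h t) t :=
    (ht (by rwa [Set.uIcc_of_le hab]) a Set.left_mem_uIcc).add_const _
  rw [hderiv.deriv, hYy t htab]
  ring

lemma norm_sq_sub_norm_sq {ι : Type*} [Fintype ι] {y h : ℝ → EuclideanSpace ℂ ι}
    (hy : IsPrimitiveOn y h a b) (hab : a ≤ b) :
    ‖y b‖ ^ 2 - ‖y a‖ ^ 2 = ∫ s in a..b, 2 * (inner ℂ (y s) (h s)).re := by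
  let re : ι → EuclideanSpace ℂ ι →L[ℝ] ℝ := fun j =>
    Complex.reCLM.comp ((EuclideanSpace.proj (𝕜 := ℂ) j).restrictScalars ℝ)
  let im : ι → EuclideanSpace ℂ ι →L[ℝ] ℝ := fun j =>
    Complex.imCLM.comp ((EuclideanSpace.proj (𝕜 := ℂ) j).restrictScalars ℝ)
  have hre : ∀ j x, re j x = (x j).re := fun _ _ => rfl
  have him : ∀ j x, im j x = (x j).im := fun _ _ => rfl
  have hnorm : ∀ x, ‖x‖ ^ 2 = ∑ j, (re j x ^ 2 + im j x ^ 2) := fun x => by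
    rw [EuclideanSpace.norm_sq_eq]
    refine Finset.sum_congr rfl fun j _ => ?_
    rw [← Complex.normSq_eq_norm_sq, Complex.normSq_apply, hre, him, sq, sq]
  have hinner : ∀ x z : EuclideanSpace ℂ ι, 2 * (inner ℂ x z).re =
      ∑ j, (2 * (re j x * re j z) + 2 * (im j x * im j z)) := fun x z => by
    rw [PiLp.inner_apply, Complex.re_sum, Finset.mul_sum]
    refine Finset.sum_congr rfl fun j _ => ?_
    rw [RCLike.inner_apply, Complex.mul_re, Complex.conj_re, Complex.conj_im]
    simp only [hre, him]
    ring
  have hint : ∀ T : EuclideanSpace ℂ ι →L[ℝ] ℝ,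
      IntervalIntegrable (fun s => 2 * (T (y s) * T (h s))) volume a b := fun T => by
    refine ((hy.clm_comp T).intervalIntegrable.continuousOn_mul ?_).const_mul 2
    rw [Set.uIcc_of_le hab]
    exact T.continuous.comp_continuousOn (hy.continuousOn hab)
  simp only [hnorm, hinner]
  rw [intervalIntegral.integral_finsetSum fun j _ => (hint (re j)).add (hint (im j)),
    ← Finset.sum_sub_distrib]
  refine Finset.sum_congr rfl fun j _ => ?_
  rw [intervalIntegral.integral_add (hint _) (hint _), ← (hy.clm_comp (re j)).sq_sub_sq hab,
    ← (hy.clm_comp (im j)).sq_sub_sq hab]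
  ring

end IsPrimitiveOn

end Primitive

section AbsSumLE

variable {ι : Type*} {a b : ι → ℝ} {A B : ℝ}

/-- Absolute convergence of `∑ a i` with an explicit bound: all finite sums of `|a i|` are at
most `A`. -/
def AbsSumLE (a : ι → ℝ) (A : ℝ) : Prop := ∀ S : Finset ι, ∑ i ∈ S, |a i| ≤ A

namespace AbsSumLE

lemma of_hasSum (hb : HasSum b B) (hab : ∀ i, |a i| ≤ b i) : AbsSumLE a B := fun S =>
  (Finset.sum_le_sum fun i _ => hab i).trans
    (sum_le_hasSum S (fun i _ => (abs_nonneg _).trans (hab i)) hb)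

lemma mono (ha : AbsSumLE a A) (hAB : A ≤ B) : AbsSumLE a B := fun S => (ha S).trans hAB

lemma sub (ha : AbsSumLE a A) (hb : AbsSumLE b B) : AbsSumLE (fun i => a i - b i) (A + B) :=
  fun S => (Finset.sum_le_sum fun i _ => abs_sub (a i) (b i)).trans
    (Finset.sum_add_distrib.trans_le (add_le_add (ha S) (hb S)))

lemma const_mul (ha : AbsSumLE a A) (r : ℝ) : AbsSumLE (fun i => r * a i) (|r| * A) := fun S => by
  simp only [abs_mul, ← Finset.mul_sum]
  exact mul_le_mul_of_nonneg_left (ha S) (abs_nonneg r)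

lemma abs_sum_le (ha : AbsSumLE a A) (S : Finset ι) : |∑ i ∈ S, a i| ≤ A :=
  (Finset.abs_sum_le_sum_abs a S).trans (ha S)

lemma summable_abs (ha : AbsSumLE a A) : Summable fun i => |a i| :=
  summable_of_sum_le (fun _ => abs_nonneg _) ha

lemma summable (ha : AbsSumLE a A) : Summable a := ha.summable_abs.of_abs

lemma abs_tsum_le (ha : AbsSumLE a A) : |∑' i, a i| ≤ A :=
  (norm_tsum_le_tsum_norm (f := a) ha.summable_abs).trans (ha.summable_abs.tsum_le_of_sum_le ha)

end AbsSumLE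

end AbsSumLE

section Energy

lemma le_exp_of_integral_le {E : ℝ → ℝ} {a b k R : ℝ} (hk : 0 < k) (hR : 0 ≤ R)
    (hE : ContinuousOn E (Set.Icc a b))
    (h : ∀ s t, a ≤ s → s ≤ t → t ≤ b → E t - E s ≤ ∫ r in s..t, (-k * E r + R)) :
    ∀ t ∈ Set.Icc a b, E t ≤ Real.exp (-k * (t - a)) * E a + R / k := by
  have hcont : ContinuousOn (fun r => -k * E r + R) (Set.Icc a b) :=
    (continuousOn_const.mul hE).add continuousOn_const
  intro t ht
  have hgronwall := le_gronwallBound_of_liminf_deriv_right_le (f := E)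
    (f' := fun r => -k * E r + R) (δ := E a) (K := -k) (ε := R) hE ?_ le_rfl
    (fun _ _ => le_rfl) t ht
  · rw [gronwallBound_of_K_ne_0 (neg_ne_zero.2 hk.ne'), div_neg] at hgronwall
    have : 0 ≤ R / k * Real.exp (-k * (t - a)) := by positivity
    linarith
  · intro x hx r hr
    obtain ⟨r', hr', hr'r⟩ := exists_between hr
    have hnear : ∀ᶠ z in 𝓝[≥] x, -k * E z + R < r' := by
      have hx_cont : ContinuousWithinAt (fun r => -k * E r + R) (Set.Ico x b) x :=
        (hcont x ⟨hx.1, hx.2.le⟩).mono fun z hz => ⟨hx.1.trans hz.1, hz.2.le⟩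
      rw [← nhdsWithin_Ico_eq_nhdsGE hx.2]
      exact hx_cont.eventually (gt_mem_nhds hr')
    obtain ⟨c, hc, hcr'⟩ := mem_nhdsGE_iff_exists_Ico_subset.1 hnear
    refine Eventually.frequently ?_
    filter_upwards [Ioo_mem_nhdsGT (lt_min hc hx.2)] with z hz
    have hzc : z < c := hz.2.trans_le (min_le_left _ _)
    have hzb : z ≤ b := (hz.2.trans_le (min_le_right _ _)).le
    have hxz : 0 < z - x := sub_pos.2 hz.1
    have hint : ∫ r in x..z, (-k * E r + R) ≤ ∫ _ in x..z, r' := by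
      refine intervalIntegral.integral_mono_on hz.1.le ?_ intervalIntegrable_const fun s hs =>
        (hcr' ⟨hs.1, hs.2.trans_lt hzc⟩).le
      refine (hcont.mono ?_).intervalIntegrable
      rw [Set.uIcc_of_le hz.1.le]
      exact Set.Icc_subset_Icc hx.1 hzb
    rw [intervalIntegral.integral_const, smul_eq_mul] at hint
    rw [inv_mul_lt_iff₀ hxz]
    nlinarith [h x z hx.1 hz.1.le hzb]

lemma hasSum_integral_of_absSumLE {X ι : Type*} [MeasurableSpace X] {μ : Measure X} [Countable ι]
    {G : ι → X → ℝ} {Φ : X → ℝ} (hG : ∀ K, AEStronglyMeasurable (G K) μ) (hΦ : Integrable Φ μ)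
    (hle : ∀ᵐ x ∂μ, AbsSumLE (fun K => G K x) (Φ x)) :
    Integrable (fun x => ∑' K, G K x) μ ∧
      HasSum (fun K => ∫ x, G K x ∂μ) (∫ x, ∑' K, G K x ∂μ) := by
  have hGi : ∀ K, Integrable (G K) μ := fun K => by
    refine hΦ.mono' (hG K) ?_
    filter_upwards [hle] with x hx
    simpa only [Finset.sum_singleton, Real.norm_eq_abs] using hx {K}
  have hSm : ∀ S : Finset ι, AEStronglyMeasurable (fun x => ∑ K ∈ S, G K x) μ := fun S =>
    (integrable_finsetSum S fun K _ => hGi K).1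
  have hlim : ∀ᵐ x ∂μ,
      Tendsto (fun S : Finset ι => ∑ K ∈ S, G K x) atTop (𝓝 (∑' K, G K x)) := by
    filter_upwards [hle] with x hx using hx.summable.hasSum
  constructor
  · refine hΦ.mono' (aestronglyMeasurable_of_tendsto_ae atTop hSm hlim) ?_
    filter_upwards [hle] with x hx using hx.abs_tsum_le
  · refine (tendsto_integral_filter_of_dominated_convergence Φ (Eventually.of_forall hSm)
      (Eventually.of_forall fun S => ?_) hΦ hlim).congr fun S =>
        integral_finsetSum S fun K _ => hGi K
    filter_upwards [hle] with x hx using hx.abs_sum_le S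

variable {ι κ : Type*} [Fintype κ] {a b : ℝ} {m : ι → ℝ} {y h : ι → ℝ → EuclideanSpace ℂ κ}
  {E Φ : ℝ → ℝ}

lemma energy_balance [Countable ι] (hab : a ≤ b) (hy : ∀ K, IsPrimitiveOn (y K) (h K) a b)
    (hE : ∀ t ∈ Set.Icc a b, HasSum (fun K => m K * ‖y K t‖ ^ 2) (E t))
    (hΦ : IntegrableOn Φ (Set.Ioc a b))
    (hle : ∀ᵐ s ∂volume.restrict (Set.Ioc a b),
      AbsSumLE (fun K => m K * (2 * (inner ℂ (y K s) (h K s)).re)) (Φ s)) :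
    IntegrableOn (fun s => ∑' K, m K * (2 * (inner ℂ (y K s) (h K s)).re)) (Set.Ioc a b) ∧
      E b - E a = ∫ s in Set.Ioc a b, ∑' K, m K * (2 * (inner ℂ (y K s) (h K s)).re) := by
  have hmeas : ∀ K, AEStronglyMeasurable
      (fun s => m K * (2 * (inner ℂ (y K s) (h K s)).re)) (volume.restrict (Set.Ioc a b)) := by
    intro K
    have hyK := (((hy K).continuousOn hab).mono Set.Ioc_subset_Icc_self).aestronglyMeasurable
      (μ := volume) measurableSet_Ioc
    exact ((Complex.continuous_re.comp_aestronglyMeasurable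
      (hyK.inner (𝕜 := ℂ) (hy K).intervalIntegrable.1.1)).const_mul 2).const_mul (m K)
  obtain ⟨hint, hhas⟩ := hasSum_integral_of_absSumLE hmeas hΦ hle
  refine ⟨hint, HasSum.unique ?_ hhas⟩
  refine ((hE b ⟨hab, le_rfl⟩).sub (hE a ⟨le_rfl, hab⟩)).congr_fun fun K => ?_
  rw [← mul_sub, (hy K).norm_sq_sub_norm_sq hab, intervalIntegral.integral_of_le hab,
    ← integral_const_mul]

lemma energy_le [Countable ι] {k R : ℝ} (hk : 0 < k) (hR : 0 ≤ R)
    (hy : ∀ K, IsPrimitiveOn (y K) (h K) a b)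
    (hE : ∀ t ∈ Set.Icc a b, HasSum (fun K => m K * ‖y K t‖ ^ 2) (E t))
    (hEc : ContinuousOn E (Set.Icc a b)) (hΦ : IntegrableOn Φ (Set.Icc a b))
    (hle : ∀ᵐ s ∂volume.restrict (Set.Icc a b),
      AbsSumLE (fun K => m K * (2 * (inner ℂ (y K s) (h K s)).re)) (Φ s))
    (hD : ∀ᵐ s ∂volume.restrict (Set.Icc a b),
      ∑' K, m K * (2 * (inner ℂ (y K s) (h K s)).re) ≤ -k * E s + R) :
    ∀ t ∈ Set.Icc a b, E t ≤ Real.exp (-k * (t - a)) * E a + R / k := by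
  refine le_exp_of_integral_le hk hR hEc fun s t has hst htb => ?_
  have hsub : Set.Icc s t ⊆ Set.Icc a b := Set.Icc_subset_Icc has htb
  have hsub' : Set.Ioc s t ⊆ Set.Icc a b := Set.Ioc_subset_Icc_self.trans hsub
  obtain ⟨hint, hbalance⟩ := energy_balance hst (fun K => (hy K).mono has hst htb)
    (fun r hr => hE r (hsub hr)) (hΦ.mono_set hsub')
    (ae_restrict_of_ae_restrict_of_subset hsub' hle)
  rw [hbalance, intervalIntegral.integral_of_le hst]
  refine integral_mono_ae hint ?_ (ae_restrict_of_ae_restrict_of_subset hsub' hD)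
  exact (((continuousOn_const.mul hEc).add continuousOn_const).mono
    hsub).integrableOn_Icc.mono_set Set.Ioc_subset_Icc_self

end Energy

section Amplitudes

variable (L : ℝ) [hL : Fact (0 < L)]

lemma modeNorm_pos : 0 < modeNorm L := Real.sqrt_pos.2 (pow_pos hL.out 3)

/-- The amplitude of a mode of a field: the square root of its contribution to the square of the
norm of `V_s`. -/
def amp (s : ℕ) (u : VField) (K : Fin 3 → ℤ) : ℝ :=
  modeNorm L * wave L K ^ s * ‖u K‖

lemma amp_nonneg (s : ℕ) (u : VField) (K : Fin 3 → ℤ) : 0 ≤ amp L s u K :=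
  mul_nonneg (mul_nonneg (modeNorm_pos L).le (pow_nonneg (wave_nonneg L K) s)) (norm_nonneg _)

lemma amp_sq (s : ℕ) (u : VField) (K : Fin 3 → ℤ) :
    amp L s u K ^ 2 = L ^ 3 * (wave L K ^ (2 * s) * ‖u K‖ ^ 2) := by
  rw [amp, mul_pow, mul_pow, modeNorm_sq, ← pow_mul, mul_comm s 2, mul_assoc]

omit hL in
lemma amp_succ (s : ℕ) (u : VField) (K : Fin 3 → ℤ) :
    amp L (s + 1) u K = wave L K * amp L s u K := by
  rw [amp, amp, pow_succ]
  ring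

lemma amp_add_le (s : ℕ) (u v : VField) (K : Fin 3 → ℤ) :
    amp L s (u + v) K ≤ amp L s u K + amp L s v K := by
  rw [amp, amp, amp, ← mul_add]
  exact mul_le_mul_of_nonneg_left (norm_add_le _ _)
    (mul_nonneg (modeNorm_pos L).le (pow_nonneg (wave_nonneg L K) s))

omit hL in
lemma amp_neg (s : ℕ) (u : VField) : amp L s (-u) = amp L s u := by
  funext K
  rw [amp, amp, Pi.neg_apply, norm_neg]

omit hL in
lemma vnorm_neg (s : ℕ) (u : VField) : vnorm L s (-u) = vnorm L s u := by
  simp only [vnorm, Pi.neg_apply, norm_neg]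

lemma vnorm_sq_eq_tsum_amp (s : ℕ) (u : VField) : vnorm L s u ^ 2 = ∑' K, amp L s u K ^ 2 := by
  rw [vnorm_sq, ← tsum_mul_left]
  exact tsum_congr fun K => by rw [amp_sq, wave]

lemma hasSum_amp {s : ℕ} {u : VField} (hu : Summable fun K => amp L s u K ^ 2) :
    HasSum (fun K => amp L s u K ^ 2) (vnorm L s u ^ 2) := by
  rw [vnorm_sq_eq_tsum_amp]
  exact hu.hasSum

lemma InV.summable_amp {s : ℕ} {u : VField} (hu : InV s u) :
    Summable fun K => amp L s u K ^ 2 := by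
  refine (hu.summable.mul_left (L ^ 3 * (2 * Real.pi / L) ^ (2 * s))).congr fun K => ?_
  rw [amp_sq, wave, mul_div_right_comm, mul_pow]
  ring

lemma IsH1.summable_amp_zero {u : VField} (hu : IsH1 u) : Summable fun K => amp L 0 u K ^ 2 := by
  refine (hu.summable_sq.mul_left (L ^ 3)).congr fun K => ?_
  rw [amp_sq, mul_zero, pow_zero, one_mul]

lemma sum_mul_le_of_hasSum {ι : Type*} {a b : ι → ℝ} {A B : ℝ} (hA : 0 ≤ A) (hB : 0 ≤ B)
    (ha : HasSum (fun i => a i ^ 2) (A ^ 2)) (hb : HasSum (fun i => b i ^ 2) (B ^ 2))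
    (S : Finset ι) : ∑ i ∈ S, a i * b i ≤ A * B := by
  refine (Real.sum_mul_le_sqrt_mul_sqrt S a b).trans (mul_le_mul ?_ ?_ (Real.sqrt_nonneg _) hA)
  · exact Real.sqrt_le_iff.2 ⟨hA, sum_le_hasSum S (fun _ _ => sq_nonneg _) ha⟩
  · exact Real.sqrt_le_iff.2 ⟨hB, sum_le_hasSum S (fun _ _ => sq_nonneg _) hb⟩

lemma sum_amp_mul_amp_le {s r : ℕ} {u v : VField} (hu : Summable fun K => amp L s u K ^ 2)
    (hv : Summable fun K => amp L r v K ^ 2) (S : Finset (Fin 3 → ℤ)) :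
    ∑ K ∈ S, amp L s u K * amp L r v K ≤ vnorm L s u * vnorm L r v :=
  sum_mul_le_of_hasSum (vnorm_nonneg _ _ _) (vnorm_nonneg _ _ _) (hasSum_amp L hu)
    (hasSum_amp L hv) S

lemma summable_amp_add {s : ℕ} {u v : VField} (hu : Summable fun K => amp L s u K ^ 2)
    (hv : Summable fun K => amp L s v K ^ 2) : Summable fun K => amp L s (u + v) K ^ 2 := by
  refine ((hu.add hv).mul_left 2).of_nonneg_of_le (fun _ => sq_nonneg _) fun K => ?_
  exact (pow_le_pow_left₀ (amp_nonneg _ _ _ _) (amp_add_le L s u v K) 2).trans add_sq_le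

lemma summable_amp_sub {s : ℕ} {u v : VField} (hu : Summable fun K => amp L s u K ^ 2)
    (hv : Summable fun K => amp L s v K ^ 2) : Summable fun K => amp L s (u - v) K ^ 2 := by
  rw [sub_eq_add_neg]
  exact summable_amp_add L hu (by simpa only [amp_neg] using hv)

lemma vnorm_add_le {s : ℕ} {u v : VField} (hu : Summable fun K => amp L s u K ^ 2)
    (hv : Summable fun K => amp L s v K ^ 2) :
    vnorm L s (u + v) ≤ vnorm L s u + vnorm L s v := by
  refine le_of_sq_le_sq ?_ (add_nonneg (vnorm_nonneg _ _ _) (vnorm_nonneg _ _ _))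
  rw [vnorm_sq_eq_tsum_amp]
  refine (summable_amp_add L hu hv).tsum_le_of_sum_le fun S => ?_
  have hcross := sum_amp_mul_amp_le L hu hv S
  have hu_sum := sum_le_hasSum S (fun _ _ => sq_nonneg _) (hasSum_amp L hu)
  have hv_sum := sum_le_hasSum S (fun _ _ => sq_nonneg _) (hasSum_amp L hv)
  calc ∑ K ∈ S, amp L s (u + v) K ^ 2 ≤ ∑ K ∈ S, (amp L s u K + amp L s v K) ^ 2 :=
        Finset.sum_le_sum fun K _ => pow_le_pow_left₀ (amp_nonneg _ _ _ _) (amp_add_le L s u v K) 2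
    _ = ∑ K ∈ S, amp L s u K ^ 2 + 2 * ∑ K ∈ S, amp L s u K * amp L s v K +
        ∑ K ∈ S, amp L s v K ^ 2 := by
        simp only [add_sq, mul_assoc, Finset.sum_add_distrib, Finset.mul_sum]
    _ ≤ (vnorm L s u + vnorm L s v) ^ 2 := by nlinarith

lemma vnorm_sub_le {s : ℕ} {u v : VField} (hu : Summable fun K => amp L s u K ^ 2)
    (hv : Summable fun K => amp L s v K ^ 2) :
    vnorm L s (u - v) ≤ vnorm L s u + vnorm L s v := by
  rw [sub_eq_add_neg, ← vnorm_neg L s v]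
  exact vnorm_add_le L hu (by simpa only [amp_neg] using hv)

lemma abs_vnorm_sub_le {s : ℕ} {u v : VField} (hu : Summable fun K => amp L s u K ^ 2)
    (hv : Summable fun K => amp L s v K ^ 2) :
    |vnorm L s u - vnorm L s v| ≤ vnorm L s (u - v) := by
  have hsub := summable_amp_sub L hu hv
  have hu_le := vnorm_add_le L hv hsub
  have hv_le := vnorm_sub_le L hu hsub
  rw [add_sub_cancel] at hu_le
  rw [sub_sub_cancel] at hv_le
  rw [abs_le]
  constructor <;> linarith

lemma norm_le_vnorm_zero {u : VField} (hu : Summable fun K => amp L 0 u K ^ 2)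
    (K : Fin 3 → ℤ) : ‖u K‖ ≤ (modeNorm L)⁻¹ * vnorm L 0 u := by
  rw [inv_mul_eq_div, le_div_iff₀' (modeNorm_pos L)]
  have hK := le_hasSum (hasSum_amp L hu) K fun _ _ => sq_nonneg _
  rw [amp, pow_zero, mul_one] at hK
  exact le_of_sq_le_sq hK (vnorm_nonneg _ _ _)

lemma lam_pos : 0 < lam L :=
  div_pos (mul_pos four_pos (pow_pos Real.pi_pos 2)) (pow_pos hL.out 2)

lemma lam_le_wave_sq {K : Fin 3 → ℤ} (hK : K ≠ 0) : lam L ≤ wave L K ^ 2 := by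
  have h : wave L K ^ 2 = lam L * kabs K ^ 2 := by
    rw [wave, lam]
    ring
  rw [h]
  exact le_mul_of_one_le_right (lam_pos L).le (one_le_pow₀ (one_le_kabs hK))

lemma sqrt_lam_mul_wave_le (K : Fin 3 → ℤ) : √(lam L) * wave L K ≤ wave L K ^ 2 := by
  by_cases hK : K = 0
  · simp [hK, wave, kabs_zero]
  · rw [sq]
    exact mul_le_mul_of_nonneg_right
      (Real.sqrt_le_iff.2 ⟨wave_nonneg L K, lam_le_wave_sq L hK⟩) (wave_nonneg L K)

lemma lam_mul_vnorm_sq_le {s : ℕ} {u : VField} (h0 : u 0 = 0)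
    (hu : Summable fun K => amp L s u K ^ 2) (hu' : Summable fun K => amp L (s + 1) u K ^ 2) :
    lam L * vnorm L s u ^ 2 ≤ vnorm L (s + 1) u ^ 2 := by
  refine hasSum_le (fun K => ?_) ((hasSum_amp L hu).mul_left (lam L)) (hasSum_amp L hu')
  by_cases hK : K = 0
  · simp [hK, amp, h0]
  · rw [amp_succ, mul_pow]
    exact mul_le_mul_of_nonneg_right (lam_le_wave_sq L hK) (sq_nonneg _)

lemma InV.sub {s : ℕ} {u v : VField} (hu : InV s u) (hv : InV s v) : InV s (u - v) where
  mean_zero := by rw [Pi.sub_apply, hu.mean_zero, hv.mean_zero, sub_zero]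
  real K i := by simp only [Pi.sub_apply, PiLp.sub_apply, hu.real, hv.real, map_sub]
  div_free K := by
    simp only [Pi.sub_apply, PiLp.sub_apply, sub_mul]
    rw [Finset.sum_sub_distrib, hu.div_free, hv.div_free, sub_zero]
  summable := by
    simp only [Pi.sub_apply, sub_eq_add_neg]
    refine summable_mul_norm_sq_add (fun K => pow_nonneg (kabs_nonneg K) _) hu.summable ?_
    simpa only [norm_neg] using hv.summable

end Amplitudes

section Pairings

lemma re_inner_real_smul {E : Type*} [SeminormedAddCommGroup E] [InnerProductSpace ℂ E] (r : ℝ)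
    (x y : E) : (inner ℂ x (r • y)).re = r * (inner ℂ x y).re := by
  rw [← Complex.coe_smul, inner_smul_right, Complex.re_ofReal_mul]

lemma abs_re_inner_le {E : Type*} [SeminormedAddCommGroup E] [InnerProductSpace ℂ E] (x y : E) :
    |(inner ℂ x y).re| ≤ ‖x‖ * ‖y‖ :=
  (Complex.abs_re_le_norm _).trans (norm_inner_le_norm x y)

variable (L : ℝ) [hL : Fact (0 < L)] {u f g : VField}

lemma absSumLE_inner (hf : Summable fun K => amp L 0 f K ^ 2)
    (hg : Summable fun K => amp L 0 g K ^ 2) :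
    AbsSumLE (fun K => L ^ 3 * (inner ℂ (g K) (f K)).re) (vnorm L 0 f * vnorm L 0 g) := by
  intro S
  refine (Finset.sum_le_sum fun K _ => ?_).trans (sum_amp_mul_amp_le L hf hg S)
  rw [abs_mul, abs_of_nonneg (pow_pos hL.out 3).le, ← modeNorm_sq]
  calc modeNorm L ^ 2 * |(inner ℂ (g K) (f K)).re| ≤ modeNorm L ^ 2 * (‖g K‖ * ‖f K‖) := by
        gcongr
        exact abs_re_inner_le _ _
    _ = amp L 0 f K * amp L 0 g K := by
        rw [amp, amp]
        ring

lemma sum_tensorNorm_mul_amp_le {s : ℕ} (hu : IsH1 u) (hg : Summable fun K => amp L s g K ^ 2)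
    (S : Finset (Fin 3 → ℤ)) :
    ∑ K ∈ S, modeNorm L * tensorNorm L u u K * amp L s g K ≤
      √(fourthMoment L u) * vnorm L s g := by
  obtain ⟨hsum, hle⟩ := summable_tensorNorm_sq_and_tsum_le L hu
  have hL3 : (0 : ℝ) ≤ L ^ 3 := (pow_pos hL.out 3).le
  have hhas : HasSum (fun K => (modeNorm L * tensorNorm L u u K) ^ 2)
      (√(L ^ 3 * ∑' K, tensorNorm L u u K ^ 2) ^ 2) := by
    rw [Real.sq_sqrt (mul_nonneg hL3 (tsum_nonneg fun _ => sq_nonneg _))]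
    simp only [mul_pow, modeNorm_sq]
    exact hsum.hasSum.mul_left _
  exact (sum_mul_le_of_hasSum (Real.sqrt_nonneg _) (vnorm_nonneg _ _ _) hhas
    (hasSum_amp L hg) S).trans
    (mul_le_mul_of_nonneg_right (Real.sqrt_le_sqrt hle) (vnorm_nonneg _ _ _))

lemma absSumLE_inner_bilin (hu : InV 1 u) (hg : Summable fun K => amp L 1 g K ^ 2) :
    AbsSumLE (fun K => L ^ 3 * (inner ℂ (g K) (bilin L u u K)).re)
      (√(fourthMoment L u) * vnorm L 1 g) := by
  intro S
  refine (Finset.sum_le_sum fun K _ => ?_).trans (sum_tensorNorm_mul_amp_le L hu.isH1 hg S)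
  rw [abs_mul, abs_of_nonneg (pow_pos hL.out 3).le, ← modeNorm_sq]
  calc modeNorm L ^ 2 * |(inner ℂ (g K) (bilin L u u K)).re|
      ≤ modeNorm L ^ 2 * (‖g K‖ * (wave L K * tensorNorm L u u K)) := by
        gcongr
        exact (abs_re_inner_le _ _).trans
          (mul_le_mul_of_nonneg_left (norm_bilin_le L hu.isH1 hu.div_free hu.isH1 K)
            (norm_nonneg _))
    _ = modeNorm L * tensorNorm L u u K * amp L 1 g K := by
        rw [amp]
        ring

lemma norm_sub_bilin_le {α : ℝ} (hα : 0 < α) (hu : InV 1 u) (K : Fin 3 → ℤ) :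
    ‖f K - bilin L u u K‖ ≤ (1 + α ^ 2 * wave L K ^ 2) *
      (‖f K‖ + (α ^ 2 * √(lam L))⁻¹ * tensorNorm L u u K) := by
  have hlam : 0 < √(lam L) := Real.sqrt_pos.2 (lam_pos L)
  refine (norm_sub_le _ _).trans ?_
  rw [mul_add]
  refine add_le_add (le_mul_of_one_le_left (norm_nonneg _)
    (le_add_of_nonneg_right (by positivity))) ?_
  rw [← mul_assoc]
  refine (norm_bilin_le L hu.isH1 hu.div_free hu.isH1 K).trans
    (mul_le_mul_of_nonneg_right ?_ (tensorNorm_nonneg L u u K))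
  rw [← div_eq_mul_inv, le_div_iff₀ (by positivity)]
  calc wave L K * (α ^ 2 * √(lam L)) = α ^ 2 * (√(lam L) * wave L K) := by ring
    _ ≤ α ^ 2 * wave L K ^ 2 := by
        gcongr
        exact sqrt_lam_mul_wave_le L K
    _ ≤ 1 + α ^ 2 * wave L K ^ 2 := le_add_of_nonneg_left zero_le_one

/-- The multiplier is the symbol of `A (I + α² A)⁻¹`. -/
lemma absSumLE_inner_residual {α : ℝ} (hα : 0 < α) (hu : InV 1 u)
    (hg : Summable fun K => amp L 2 g K ^ 2) (hf : Summable fun K => amp L 0 f K ^ 2) :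
    AbsSumLE (fun K => L ^ 3 * (wave L K ^ 2 / (1 + α ^ 2 * wave L K ^ 2) *
      (inner ℂ (g K) (f K - bilin L u u K)).re))
      ((vnorm L 0 f + √(fourthMoment L u) / (α ^ 2 * √(lam L))) * vnorm L 2 g) := by
  intro S
  have hlam : 0 < √(lam L) := Real.sqrt_pos.2 (lam_pos L)
  have hmode : ∀ K, |L ^ 3 * (wave L K ^ 2 / (1 + α ^ 2 * wave L K ^ 2) *
      (inner ℂ (g K) (f K - bilin L u u K)).re)| ≤ amp L 0 f K * amp L 2 g K +
      (α ^ 2 * √(lam L))⁻¹ * (modeNorm L * tensorNorm L u u K * amp L 2 g K) := by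
    intro K
    rw [abs_mul, abs_mul, abs_of_nonneg (pow_pos hL.out 3).le, abs_of_nonneg (by positivity),
      ← modeNorm_sq]
    calc modeNorm L ^ 2 * (wave L K ^ 2 / (1 + α ^ 2 * wave L K ^ 2) *
          |(inner ℂ (g K) (f K - bilin L u u K)).re|)
        ≤ modeNorm L ^ 2 * (wave L K ^ 2 / (1 + α ^ 2 * wave L K ^ 2) *
          (‖g K‖ * ((1 + α ^ 2 * wave L K ^ 2) *
            (‖f K‖ + (α ^ 2 * √(lam L))⁻¹ * tensorNorm L u u K)))) := by
          gcongr
          exact (abs_re_inner_le _ _).trans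
            (mul_le_mul_of_nonneg_left (norm_sub_bilin_le L hα hu K) (norm_nonneg _))
      _ = _ := by
          rw [amp, amp]
          field_simp
  calc _ ≤ ∑ K ∈ S, (amp L 0 f K * amp L 2 g K +
        (α ^ 2 * √(lam L))⁻¹ * (modeNorm L * tensorNorm L u u K * amp L 2 g K)) :=
        Finset.sum_le_sum fun K _ => hmode K
    _ = ∑ K ∈ S, amp L 0 f K * amp L 2 g K +
        (α ^ 2 * √(lam L))⁻¹ * ∑ K ∈ S, modeNorm L * tensorNorm L u u K * amp L 2 g K := by
        rw [Finset.sum_add_distrib, Finset.mul_sum]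
    _ ≤ vnorm L 0 f * vnorm L 2 g + (α ^ 2 * √(lam L))⁻¹ *
        (√(fourthMoment L u) * vnorm L 2 g) := by
        gcongr
        · exact sum_amp_mul_amp_le L hf hg S
        · exact sum_tensorNorm_mul_amp_le L hu.isH1 hg S
    _ = _ := by
        rw [div_eq_inv_mul]
        ring

end Pairings

section Paths

variable (L : ℝ) [hL : Fact (0 < L)]

/-- `u` is a continuous function on `I` with values in `V`. -/
structure IsPath (I : Set ℝ) (u : ℝ → VField) : Prop where
  mem : ∀ t ∈ I, InV 1 (u t)
  tendsto : ∀ t ∈ I, Tendsto (fun s => vnorm L 1 (u s - u t)) (𝓝[I] t) (𝓝 0)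

variable {L}

lemma IsSolutionOn.isPath {ν α : ℝ} {G : ℝ → VField} {a b : ℝ} {u : ℝ → VField}
    (hu : IsSolutionOn L ν α G a b u) : IsPath L (Set.Icc a b) u := ⟨hu.mem_V, hu.continuous_V⟩

lemma continuousOn_of_dist_le {X Y : Type*} [TopologicalSpace X] [PseudoMetricSpace Y]
    {I : Set X} {g : X → Y} {r : X → X → ℝ} (hr : ∀ t ∈ I, Tendsto (r t) (𝓝[I] t) (𝓝 0))
    (hle : ∀ s ∈ I, ∀ t ∈ I, dist (g s) (g t) ≤ r t s) : ContinuousOn g I := fun t ht =>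
  tendsto_iff_dist_tendsto_zero.2 (squeeze_zero' (Eventually.of_forall fun _ => dist_nonneg)
    (eventually_nhdsWithin_of_forall fun s hs => hle s hs t ht) (hr t ht))

namespace IsPath

variable {I J : Set ℝ} {u v : ℝ → VField}

omit hL in
lemma mono (hu : IsPath L I u) (h : J ⊆ I) : IsPath L J u :=
  ⟨fun t ht => hu.mem t (h ht), fun t ht => (hu.tendsto t (h ht)).mono_left (nhdsWithin_mono t h)⟩

lemma sub (hu : IsPath L I u) (hv : IsPath L I v) : IsPath L I (fun t => u t - v t) := by
  refine ⟨fun t ht => (hu.mem t ht).sub (hv.mem t ht), fun t ht => ?_⟩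
  have hadd := (hu.tendsto t ht).add (hv.tendsto t ht)
  rw [add_zero] at hadd
  refine squeeze_zero' (Eventually.of_forall fun _ => vnorm_nonneg _ _ _) ?_ hadd
  filter_upwards [self_mem_nhdsWithin] with s hs
  rw [sub_sub_sub_comm]
  exact vnorm_sub_le L (((hu.mem s hs).sub (hu.mem t ht)).summable_amp L)
    (((hv.mem s hs).sub (hv.mem t ht)).summable_amp L)

lemma tendsto_zero (hu : IsPath L I u) {t : ℝ} (ht : t ∈ I) :
    Tendsto (fun s => vnorm L 0 (u s - u t)) (𝓝[I] t) (𝓝 0) := by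
  have hpos : 0 < 2 * Real.pi / L := div_pos Real.two_pi_pos hL.out
  have hmul := (hu.tendsto t ht).const_mul (2 * Real.pi / L)⁻¹
  rw [mul_zero] at hmul
  refine squeeze_zero' (Eventually.of_forall fun _ => vnorm_nonneg _ _ _) ?_ hmul
  filter_upwards [self_mem_nhdsWithin] with s hs
  exact (le_inv_mul_iff₀ hpos).2 (((hu.mem s hs).sub (hu.mem t ht)).isH1.vnorm_zero_le L)

lemma continuousOn_vnorm_zero (hu : IsPath L I u) : ContinuousOn (fun s => vnorm L 0 (u s)) I :=
  continuousOn_of_dist_le (fun _ => hu.tendsto_zero) fun s hs t ht =>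
    abs_vnorm_sub_le L ((hu.mem s hs).isH1.summable_amp_zero L)
      ((hu.mem t ht).isH1.summable_amp_zero L)

lemma continuousOn_vnorm_one (hu : IsPath L I u) : ContinuousOn (fun s => vnorm L 1 (u s)) I :=
  continuousOn_of_dist_le hu.tendsto fun s hs t ht =>
    abs_vnorm_sub_le L ((hu.mem s hs).summable_amp L) ((hu.mem t ht).summable_amp L)

lemma continuousOn_mode (hu : IsPath L I u) (K : Fin 3 → ℤ) :
    ContinuousOn (fun s => u s K) I := by
  refine continuousOn_of_dist_le (r := fun t s => (modeNorm L)⁻¹ * vnorm L 0 (u s - u t))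
    (fun t ht => ?_) fun s hs t ht => ?_
  · simpa only [mul_zero] using (hu.tendsto_zero ht).const_mul (modeNorm L)⁻¹
  · rw [dist_eq_norm]
    exact norm_le_vnorm_zero L (((hu.mem s hs).sub (hu.mem t ht)).isH1.summable_amp_zero L) K

lemma continuousOn_prodCoeff (hu : IsPath L I u) (i j : Fin 3) (K : Fin 3 → ℤ) :
    ContinuousOn (fun s => prodCoeff L (u s) (u s) i j K) I := by
  refine continuousOn_of_dist_le (fun t ht => ?_) fun s hs t ht =>
    (dist_eq_norm _ _).trans_le
      (norm_prodCoeff_self_sub_le L (hu.mem s hs).isH1 (hu.mem t ht).isH1 i j K)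
  have hlim := (Tendsto.mul (hu.continuousOn_vnorm_zero t ht) (hu.tendsto_zero ht)).add
    ((hu.tendsto_zero ht).mul_const (vnorm L 0 (u t)))
  rwa [mul_zero, zero_mul, add_zero] at hlim

lemma continuousOn_bilin (hu : IsPath L I u) (K : Fin 3 → ℤ) :
    ContinuousOn (fun s => bilin L (u s) (u s) K) I := by
  refine continuousOn_leray ?_
  have hcont : ContinuousOn (fun s => WithLp.toLp 2 fun j =>
      ((L : ℂ) ^ 3)⁻¹ * ∑ i, derivSymbol L i K * prodCoeff L (u s) (u s) i j K) I := by
    refine (PiLp.continuous_toLp 2 _).comp_continuousOn (continuousOn_pi.2 fun j => ?_)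
    exact continuousOn_const.mul (continuousOn_finsetSum _ fun i _ =>
      continuousOn_const.mul (hu.continuousOn_prodCoeff i j K))
  refine hcont.congr fun s hs => ?_
  ext j
  exact coeff_advect L (hu.mem s hs).isH1 (hu.mem s hs).div_free (hu.mem s hs).isH1 K j

lemma exists_bound {a b : ℝ} (hu : IsPath L (Set.Icc a b) u) :
    ∃ C, 0 ≤ C ∧ ∀ s ∈ Set.Icc a b,
      vnorm L 0 (u s) ≤ C ∧ vnorm L 1 (u s) ≤ C ∧ √(fourthMoment L (u s)) ≤ C := by
  obtain ⟨C₀, hC₀⟩ := isCompact_Icc.exists_bound_of_continuousOn hu.continuousOn_vnorm_zero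
  obtain ⟨C₁, hC₁⟩ := isCompact_Icc.exists_bound_of_continuousOn hu.continuousOn_vnorm_one
  obtain ⟨C₂, hC₂⟩ := isCompact_Icc.exists_bound_of_continuousOn
    ((hu.continuousOn_vnorm_one.pow 4).const_mul (L / Real.pi)).sqrt
  refine ⟨max 0 (max C₀ (max C₁ C₂)), le_max_left _ _, fun s hs => ⟨?_, ?_, ?_⟩⟩
  · exact (le_abs_self _).trans ((hC₀ s hs).trans (by simp))
  · exact (le_abs_self _).trans ((hC₁ s hs).trans (by simp))
  · exact (Real.sqrt_le_sqrt ((hu.mem s hs).isH1.fourthMoment_le L)).trans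
      ((le_abs_self _).trans ((hC₂ s hs).trans (by simp)))

end IsPath

end Paths

section Modes

variable (L : ℝ)

lemma stokes_apply (u : VField) (K : Fin 3 → ℤ) : stokes L u K = wave L K ^ 2 • u K := by
  rw [stokes, wave, div_pow, mul_pow, mul_pow]
  norm_num

lemma helm_apply (α : ℝ) (u : VField) (K : Fin 3 → ℤ) :
    helm L α u K = (1 + α ^ 2 * wave L K ^ 2) • u K := by
  rw [helm, Pi.add_apply, Pi.smul_apply, stokes_apply, smul_smul, add_smul, one_smul]

lemma one_add_mul_wave_pos (α : ℝ) (K : Fin 3 → ℤ) : 0 < 1 + α ^ 2 * wave L K ^ 2 := by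
  positivity

variable [hL : Fact (0 < L)]

/-- The right-hand side of the equation for a Fourier mode, solved for the time derivative of
`u K`: the `K`-th coefficient of `(I + α² A)⁻¹ (G - B(u, u)) - ν A u`. -/
def modeRhs (ν α : ℝ) (G : VField) (u : VField) (K : Fin 3 → ℤ) : EuclideanSpace ℂ (Fin 3) :=
  (1 + α ^ 2 * wave L K ^ 2)⁻¹ • (G K - bilin L u u K) - (ν * wave L K ^ 2) • u K

variable {L}

lemma IsSolutionOn.isPrimitiveOn {ν α a b : ℝ} {G u : ℝ → VField}
    (hu : IsSolutionOn L ν α G a b u) (hab : a ≤ b) {K : Fin 3 → ℤ}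
    (hG : IntervalIntegrable (fun s => G s K) volume a b) :
    IsPrimitiveOn (fun s => u s K) (fun s => modeRhs L ν α (G s) (u s) K) a b where
  intervalIntegrable := by
    have hbilin := (hu.isPath.continuousOn_bilin K).intervalIntegrable_of_Icc (μ := volume) hab
    have hmode := (hu.isPath.continuousOn_mode K).intervalIntegrable_of_Icc (μ := volume) hab
    have hforce : IntervalIntegrable
        (fun s => (1 + α ^ 2 * wave L K ^ 2)⁻¹ • (G s K - bilin L (u s) (u s) K)) volume a b :=
      (hG.sub hbilin).smul (1 + α ^ 2 * wave L K ^ 2)⁻¹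
    have hvisc : IntervalIntegrable (fun s => (ν * wave L K ^ 2) • u s K) volume a b :=
      hmode.smul (ν * wave L K ^ 2)
    exact hforce.sub hvisc
  sub_eq t ht := by
    have hpos := one_add_mul_wave_pos L α K
    have heq := congrArg (fun x => (1 + α ^ 2 * wave L K ^ 2)⁻¹ • x) (hu.equation t ht K)
    simp only [helm_apply, stokes_apply] at heq
    rw [← smul_sub, inv_smul_smul₀ hpos.ne', ← intervalIntegral.integral_smul] at heq
    rw [heq]
    congr 1
    ext1 r
    rw [modeRhs, sub_right_comm, smul_sub _ (G r K - bilin L (u r) (u r) K),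
      smul_comm (wave L K ^ 2), smul_comm ν, inv_smul_smul₀ hpos.ne', smul_smul]

section Forcing

variable {f : ℝ → VField} (hf : IsForcing L f)
include hf

lemma IsForcing.intervalIntegrable (K : Fin 3 → ℤ) {a b : ℝ} (ha : 0 ≤ a) (hab : a ≤ b) :
    IntervalIntegrable (fun s => f s K) volume a b := by
  obtain ⟨C, hC⟩ := hf.bounded
  rw [intervalIntegrable_iff_integrableOn_Icc_of_le hab]
  have hsub : Set.Icc a b ⊆ Set.Ici 0 := fun s hs => ha.trans hs.1
  refine Integrable.of_bound ((hf.measurable K).mono_set hsub) ((modeNorm L)⁻¹ * C) ?_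
  refine ae_restrict_of_ae_restrict_of_subset hsub ?_
  filter_upwards [hC, hf.mem_H] with s hs hsH
  exact (norm_le_vnorm_zero L (hsH.summable_amp L) K).trans
    (mul_le_mul_of_nonneg_left hs (inv_nonneg.2 (modeNorm_pos L).le))

omit hL in
lemma IsForcing.ae_le_supNorm :
    ∀ᵐ t ∂volume.restrict (Set.Ici (0 : ℝ)), vnorm L 0 (f t) ≤ supNorm L f := by
  obtain ⟨C, hC⟩ := hf.bounded
  exact ae_le_essSup ⟨C, eventually_map.2 hC⟩

omit hL in
lemma IsForcing.supNorm_nonneg : 0 ≤ supNorm L f := by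
  have : (ae (volume.restrict (Set.Ici (0 : ℝ)))).NeBot := by
    rw [ae_neBot, Ne, Measure.restrict_eq_zero, Real.volume_Ici]
    exact ENNReal.top_ne_zero
  obtain ⟨t, ht⟩ := hf.ae_le_supNorm.exists
  exact (vnorm_nonneg _ _ _).trans ht

end Forcing

end Modes

section EnergyRate

variable {L : ℝ} [hL : Fact (0 < L)]

lemma InV.hasSum_energy {u : VField} (hu : InV 1 u) (β : ℝ) :
    HasSum (fun K => L ^ 3 * (1 + β ^ 2 * wave L K ^ 2) * ‖u K‖ ^ 2)
      (vnorm L 0 u ^ 2 + β ^ 2 * vnorm L 1 u ^ 2) := by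
  refine ((hasSum_amp L (hu.isH1.summable_amp_zero L)).add
    ((hasSum_amp L (hu.summable_amp L)).mul_left (β ^ 2))).congr_fun fun K => ?_
  rw [amp_sq, amp_sq]
  ring

variable (L) in
/-- The contribution of the `K`-th mode to the time derivative of `‖g‖² + β² ‖∇g‖²` along a path
of fields through `g` with velocity `h`. -/
def energyRate (β : ℝ) (g h : VField) (K : Fin 3 → ℤ) : ℝ :=
  L ^ 3 * (1 + β ^ 2 * wave L K ^ 2) * (2 * (inner ℂ (g K) (h K)).re)

lemma IsPath.energy_le {a b k R β : ℝ} {g h : ℝ → VField} {Φ : ℝ → ℝ} (hk : 0 < k) (hR : 0 ≤ R)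
    (hg : IsPath L (Set.Icc a b) g)
    (hprim : ∀ K, IsPrimitiveOn (fun s => g s K) (fun s => h s K) a b)
    (hΦ : IntegrableOn Φ (Set.Icc a b))
    (hle : ∀ᵐ s ∂volume.restrict (Set.Icc a b), AbsSumLE (energyRate L β (g s) (h s)) (Φ s))
    (hD : ∀ᵐ s ∂volume.restrict (Set.Icc a b), ∑' K, energyRate L β (g s) (h s) K ≤
      -k * (vnorm L 0 (g s) ^ 2 + β ^ 2 * vnorm L 1 (g s) ^ 2) + R) :
    ∀ t ∈ Set.Icc a b, vnorm L 0 (g t) ^ 2 + β ^ 2 * vnorm L 1 (g t) ^ 2 ≤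
      Real.exp (-k * (t - a)) * (vnorm L 0 (g a) ^ 2 + β ^ 2 * vnorm L 1 (g a) ^ 2) + R / k :=
  Bardina.energy_le (m := fun K => L ^ 3 * (1 + β ^ 2 * wave L K ^ 2))
    (E := fun t => vnorm L 0 (g t) ^ 2 + β ^ 2 * vnorm L 1 (g t) ^ 2) hk hR hprim
    (fun t ht => (hg.mem t ht).hasSum_energy β)
    ((hg.continuousOn_vnorm_zero.pow 2).add
      (continuousOn_const.mul (hg.continuousOn_vnorm_one.pow 2))) hΦ hle hD

end EnergyRate

section BardinaEnergy

variable {L : ℝ} [hL : Fact (0 < L)]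

lemma energyRate_bardina (ν α : ℝ) (f u : VField) :
    energyRate L α u (modeRhs L ν α f u) = fun K =>
      2 * (L ^ 3 * (inner ℂ (u K) (f K)).re) - 2 * (L ^ 3 * (inner ℂ (u K) (bilin L u u K)).re)
        - 2 * ν * (amp L 1 u K ^ 2 + α ^ 2 * amp L 2 u K ^ 2) := by
  funext K
  have hpos := (one_add_mul_wave_pos L α K).ne'
  have hself : (inner ℂ (u K) (u K)).re = ‖u K‖ ^ 2 := inner_self_eq_norm_sq (𝕜 := ℂ) (u K)
  rw [energyRate, modeRhs, inner_sub_right, Complex.sub_re, re_inner_real_smul, re_inner_real_smul,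
    inner_sub_right, Complex.sub_re, hself, amp_sq, amp_sq]
  field_simp
  ring

lemma hasSum_dissipation {g : VField} (hg1 : InV 1 g) (hg2 : InV 2 g) (β : ℝ) :
    HasSum (fun K => amp L 1 g K ^ 2 + β ^ 2 * amp L 2 g K ^ 2)
      (vnorm L 1 g ^ 2 + β ^ 2 * vnorm L 2 g ^ 2) :=
  (hasSum_amp L (hg1.summable_amp L)).add ((hasSum_amp L (hg2.summable_amp L)).mul_left (β ^ 2))

lemma absSumLE_energyRate_bardina {ν : ℝ} (hν : 0 < ν) (α : ℝ) {f u : VField} (hf : InV 0 f)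
    (hu1 : InV 1 u) (hu2 : InV 2 u) :
    AbsSumLE (energyRate L α u (modeRhs L ν α f u))
      (2 * (vnorm L 0 f * vnorm L 0 u) + 2 * (√(fourthMoment L u) * vnorm L 1 u)
        + 2 * ν * (vnorm L 1 u ^ 2 + α ^ 2 * vnorm L 2 u ^ 2)) := by
  have hforce := (absSumLE_inner L (hf.summable_amp L) (hu1.isH1.summable_amp_zero L)).const_mul 2
  have hbilin := (absSumLE_inner_bilin L hu1 (hu1.summable_amp L)).const_mul 2
  have hdiss := (AbsSumLE.of_hasSum (hasSum_dissipation (L := L) hu1 hu2 α)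
    fun K => (abs_of_nonneg (by positivity)).le).const_mul (2 * ν)
  rw [energyRate_bardina]
  simpa only [abs_two, abs_mul, abs_of_pos hν] using (hforce.sub hbilin).sub hdiss

lemma tsum_energyRate_bardina_le {ν F : ℝ} (hν : 0 < ν) (α : ℝ) {f u : VField} (hf : InV 0 f)
    (hF : vnorm L 0 f ≤ F) (hu1 : InV 1 u) (hu2 : InV 2 u) :
    ∑' K, energyRate L α u (modeRhs L ν α f u) K ≤
      -(ν * lam L) * (vnorm L 0 u ^ 2 + α ^ 2 * vnorm L 1 u ^ 2) + F ^ 2 / (ν * lam L) := by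
  have hlam := lam_pos L
  have hsum0 := hu1.isH1.summable_amp_zero L
  have hsum1 := hu1.summable_amp L
  have hforce := absSumLE_inner L (hf.summable_amp L) hsum0
  have hbilin := hasSum_inner_bilin L hu1.isH1 hu1.div_free hu1.isH1 hu1
  rw [tri_self L hu1.isH1 hu1.div_free hu1.isH1, Complex.zero_re, neg_zero] at hbilin
  have hsum := ((hforce.summable.hasSum.mul_left 2).sub (hbilin.mul_left 2)).sub
    ((hasSum_dissipation (L := L) hu1 hu2 α).mul_left (2 * ν))
  rw [energyRate_bardina, hsum.tsum_eq]
  have hpoincare0 := mul_le_mul_of_nonneg_left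
    (lam_mul_vnorm_sq_le L hu1.mean_zero hsum0 hsum1) hν.le
  have hpoincare1 := mul_le_mul_of_nonneg_left
    (lam_mul_vnorm_sq_le L hu1.mean_zero hsum1 (hu2.summable_amp L))
    (mul_nonneg hν.le (sq_nonneg α))
  have hdual := ((le_abs_self _).trans hforce.abs_tsum_le).trans
    (mul_le_mul_of_nonneg_right hF (vnorm_nonneg L 0 u))
  have hyoung := two_mul_le_add_mul_sq (a := vnorm L 0 u) (b := F) (mul_pos hν hlam)
  have hnonneg : 0 ≤ ν * α ^ 2 * vnorm L 2 u ^ 2 := by positivity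
  rw [inv_mul_eq_div] at hyoung
  linarith

omit hL in
lemma IsForcing.ae_Icc {f : ℝ → VField} (hf : IsForcing L f) {a b : ℝ} (ha : 0 ≤ a) :
    ∀ᵐ s ∂volume.restrict (Set.Icc a b), InV 0 (f s) ∧ vnorm L 0 (f s) ≤ supNorm L f :=
  ae_restrict_of_ae_restrict_of_subset (fun _ hs => ha.trans hs.1)
    (hf.mem_H.and hf.ae_le_supNorm)

lemma IsSolutionOn.energy_le {ν α a b : ℝ} (hν : 0 < ν) {f u : ℝ → VField}
    (hf : IsForcing L f) (ha : 0 ≤ a) (hab : a ≤ b) (hu : IsSolutionOn L ν α f a b u) :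
    ∀ t ∈ Set.Icc a b, vnorm L 0 (u t) ^ 2 + α ^ 2 * vnorm L 1 (u t) ^ 2 ≤
      Real.exp (-(ν * lam L) * (t - a)) * (vnorm L 0 (u a) ^ 2 + α ^ 2 * vnorm L 1 (u a) ^ 2) +
        supNorm L f ^ 2 / (ν * lam L) / (ν * lam L) := by
  have hlam := lam_pos L
  have hF := hf.supNorm_nonneg
  obtain ⟨C, hC_nonneg, hC⟩ := hu.isPath.exists_bound
  refine hu.isPath.energy_le (by positivity) (by positivity)
    (fun K => hu.isPrimitiveOn hab (hf.intervalIntegrable K ha hab))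
    (Φ := fun s => 2 * (supNorm L f * C) + 2 * (C * C) +
      2 * ν * (C ^ 2 + α ^ 2 * vnorm L 2 (u s) ^ 2)) ?_ ?_ ?_
  · exact continuousOn_const.integrableOn_Icc.add
      ((continuousOn_const.integrableOn_Icc.add (hu.sq_integrable_DA.const_mul _)).const_mul _)
  · filter_upwards [hu.mem_DA, hf.ae_Icc ha, ae_restrict_mem measurableSet_Icc]
      with s hu2 ⟨hfH, hfF⟩ hs
    obtain ⟨hC0, hC1, hC4⟩ := hC s hs
    have := vnorm_nonneg L 0 (u s)
    have := vnorm_nonneg L 1 (u s)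
    refine (absSumLE_energyRate_bardina hν α hfH (hu.mem_V s hs) hu2).mono ?_
    gcongr
  · filter_upwards [hu.mem_DA, hf.ae_Icc ha, ae_restrict_mem measurableSet_Icc]
      with s hu2 ⟨hfH, hfF⟩ hs
    exact tsum_energyRate_bardina_le hν α hfH hfF (hu.mem_V s hs) hu2

lemma IsBardinaSolution.energy_le {ν α α₁ MA MB s t : ℝ} (hν : 0 < ν) (hα : 0 ≤ α)
    (hαα₁ : α ≤ α₁) {f u : ℝ → VField} (hf : IsForcing L f) (hu : IsBardinaSolution L ν α f u)
    (huA : vnorm L 0 (u 0) ≤ MA) (huB : vnorm L 1 (u 0) ≤ MB) (hs : 0 ≤ s) (hst : s ≤ t) :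
    vnorm L 0 (u t) ^ 2 + α ^ 2 * vnorm L 1 (u t) ^ 2 ≤ M1sq L ν α₁ MA MB (supNorm L f) s := by
  have hlam := lam_pos L
  have ht : 0 ≤ t := hs.trans hst
  have hT : 0 < t + 1 := by positivity
  have henergy := (hu (t + 1) hT).energy_le hν hf le_rfl hT.le t ⟨ht, by linarith⟩
  have hexp : Real.exp (-(ν * lam L) * t) ≤ Real.exp (-ν * lam L * s) := by
    rw [Real.exp_le_exp, neg_mul, neg_mul, neg_mul, neg_le_neg_iff]
    gcongr
  have := vnorm_nonneg L 0 (u 0)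
  have := vnorm_nonneg L 1 (u 0)
  rw [sub_zero] at henergy
  rw [M1sq]
  refine henergy.trans (add_le_add ?_ (le_of_eq ?_))
  · gcongr
  · field_simp

end BardinaEnergy

section Nudging

/-- The Fourier multiplier of `P_N`: the indicator of the wave numbers `0 < |K| < N`. -/
def lowIndicator (N : ℕ) (K : Fin 3 → ℤ) : ℝ :=
  {K | 0 < kabs K ∧ kabs K < N}.indicator 1 K

lemma lowIndicator_nonneg (N : ℕ) (K : Fin 3 → ℤ) : 0 ≤ lowIndicator N K :=
  Set.indicator_nonneg (fun _ _ => zero_le_one) K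

lemma lowIndicator_le_one (N : ℕ) (K : Fin 3 → ℤ) : lowIndicator N K ≤ 1 :=
  Set.indicator_le_self' (fun _ _ => zero_le_one) K

lemma lowModes_sub_apply (N : ℕ) (w u : VField) (K : Fin 3 → ℤ) :
    (lowModes N w - lowModes N u) K = lowIndicator N K • (w - u) K := by
  by_cases hK : 0 < kabs K ∧ kabs K < N <;> simp [lowModes, lowIndicator, hK]

lemma leray_lowModes_sub {s : ℕ} {w u : VField} (hg : InV s (w - u)) (N : ℕ) (K : Fin 3 → ℤ) :
    leray (lowModes N w - lowModes N u) K = lowIndicator N K • (w - u) K := by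
  rw [leray_eq_self, lowModes_sub_apply]
  · rw [lowModes_sub_apply, hg.mean_zero, smul_zero]
  · simp only [lowModes_sub_apply, PiLp.smul_apply, smul_mul_assoc]
    rw [← Finset.smul_sum, hg.div_free K, smul_zero]

variable (L : ℝ)

/-- The right-hand side `f - η (I + β² A) P (P_N w - P_N u)` of the nudged system. -/
def nudgedForcing (β η : ℝ) (N : ℕ) (f u w : VField) : VField :=
  f - η • helm L β (leray (lowModes N w - lowModes N u))

variable {L}

lemma nudgedForcing_apply {s : ℕ} {w u : VField} (hg : InV s (w - u)) (f : VField) (β η : ℝ)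
    (N : ℕ) (K : Fin 3 → ℤ) :
    nudgedForcing L β η N f u w K =
      f K - (η * (1 + β ^ 2 * wave L K ^ 2) * lowIndicator N K) • (w - u) K := by
  rw [nudgedForcing, Pi.sub_apply, Pi.smul_apply, helm_apply, leray_lowModes_sub hg, smul_smul,
    smul_smul]

variable [hL : Fact (0 < L)]

lemma modeRhs_nudged_sub {s : ℕ} {w u : VField} (hg : InV s (w - u)) (f : VField) (ν α β η : ℝ)
    (N : ℕ) (K : Fin 3 → ℤ) :
    modeRhs L ν β (nudgedForcing L β η N f u w) w K - modeRhs L ν α f u K =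
      (1 + β ^ 2 * wave L K ^ 2)⁻¹ • (f K - bilin L w w K) - (η * lowIndicator N K) • (w - u) K
        - (ν * wave L K ^ 2) • (w - u) K
        - (1 + α ^ 2 * wave L K ^ 2)⁻¹ • (f K - bilin L u u K) := by
  have hpos := (one_add_mul_wave_pos L β K).ne'
  have hcancel : (1 + β ^ 2 * wave L K ^ 2)⁻¹ *
      (η * (1 + β ^ 2 * wave L K ^ 2) * lowIndicator N K) = η * lowIndicator N K := by
    field_simp
  rw [modeRhs, modeRhs, nudgedForcing_apply hg, sub_right_comm (f K),
    smul_sub _ (f K - _) (_ • _), smul_smul, hcancel, Pi.sub_apply, smul_sub (ν * _) (w K)]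
  abel

/-- `(1 + β² k²) ((1 + β² k²)⁻¹ - (1 + α² k²)⁻¹) = - (β² - α²) k² / (1 + α² k²)` produces the
factor of the residual `f - B(u, u)`. -/
lemma energyRate_nudged {s : ℕ} {w u : VField} (hg : InV s (w - u)) (f : VField) (ν α β η : ℝ)
    (N : ℕ) :
    energyRate L β (w - u) (modeRhs L ν β (nudgedForcing L β η N f u w) w - modeRhs L ν α f u) =
      fun K =>
        2 * (L ^ 3 * (inner ℂ ((w - u) K) (bilin L u u K)).re)
          - 2 * (L ^ 3 * (inner ℂ ((w - u) K) (bilin L w w K)).re)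
          - 2 * (β ^ 2 - α ^ 2) * (L ^ 3 * (wave L K ^ 2 / (1 + α ^ 2 * wave L K ^ 2) *
              (inner ℂ ((w - u) K) (f K - bilin L u u K)).re))
          - 2 * ν * (amp L 1 (w - u) K ^ 2 + β ^ 2 * amp L 2 (w - u) K ^ 2)
          - 2 * η * (lowIndicator N K *
              (amp L 0 (w - u) K ^ 2 + β ^ 2 * amp L 1 (w - u) K ^ 2)) := by
  funext K
  have hself : (inner ℂ ((w - u) K) ((w - u) K)).re = ‖(w - u) K‖ ^ 2 :=
    inner_self_eq_norm_sq (𝕜 := ℂ) ((w - u) K)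
  rw [energyRate, Pi.sub_apply (modeRhs _ _ _ _ _), modeRhs_nudged_sub hg]
  simp only [inner_sub_right, Complex.sub_re, re_inner_real_smul, hself, amp_sq]
  field_simp
  ring

/-- For `|K| ≥ N` the viscosity alone dominates the nudging, since `η / N² ≤ ν λ₁ / 2`. -/
lemma lowIndicator_dissipation {g : VField} (h0 : g 0 = 0) {ν β η : ℝ} (hν : 0 ≤ ν)
    {N : ℕ} (hN : 1 ≤ N) (h_N : η / (N : ℝ) ^ 2 ≤ ν * lam L / 2) (K : Fin 3 → ℤ) :
    η * (amp L 0 g K ^ 2 + β ^ 2 * amp L 1 g K ^ 2)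
        - ν / 2 * (amp L 1 g K ^ 2 + β ^ 2 * amp L 2 g K ^ 2) ≤
      η * (lowIndicator N K * (amp L 0 g K ^ 2 + β ^ 2 * amp L 1 g K ^ 2)) := by
  have hlow : 0 ≤ amp L 0 g K ^ 2 + β ^ 2 * amp L 1 g K ^ 2 := by positivity
  have hshift : amp L 1 g K ^ 2 + β ^ 2 * amp L 2 g K ^ 2 =
      wave L K ^ 2 * (amp L 0 g K ^ 2 + β ^ 2 * amp L 1 g K ^ 2) := by
    simp only [amp_sq]
    ring
  rw [hshift]
  rcases eq_or_ne K 0 with rfl | hK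
  · simp [amp, h0]
  have hk : 0 < kabs K := one_pos.trans_le (one_le_kabs hK)
  by_cases hKN : kabs K < N
  · rw [lowIndicator, Set.indicator_of_mem (Set.mem_ofPred.2 ⟨hk, hKN⟩), Pi.one_apply, one_mul]
    exact sub_le_self _ (by positivity)
  · rw [lowIndicator, Set.indicator_of_notMem fun h => hKN h.2, zero_mul, mul_zero, sub_nonpos,
      ← mul_assoc]
    have : (0 : ℝ) < N := by exact_mod_cast hN
    have hlam := lam_pos L
    have hNK : (N : ℝ) ≤ kabs K := not_lt.1 hKN
    refine mul_le_mul_of_nonneg_right ?_ hlow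
    calc η ≤ ν * lam L / 2 * (N : ℝ) ^ 2 := (div_le_iff₀ (by positivity)).1 h_N
      _ ≤ ν * lam L / 2 * kabs K ^ 2 := by gcongr
      _ = ν / 2 * wave L K ^ 2 := by
        rw [wave, lam]
        ring

end Nudging

section Trilinear

variable {L : ℝ} [hL : Fact (0 < L)]

lemma tri_sub_tri_eq {w u : VField} (hw : InV 1 w) (hu : InV 1 u) :
    tri L w w (w - u) - tri L u u (w - u) = -tri L (w - u) (w - u) u := by
  have hw1 := hw.isH1
  have hu1 := hu.isH1
  have hg1 := hw1.sub hu1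
  have hwww : tri L w w w = 0 := tri_self L hw1 hw.div_free hw1
  have hwuu : tri L w u u = 0 := tri_self L hw1 hw.div_free hu1
  have huww : tri L u w w = 0 := tri_self L hu1 hu.div_free hw1
  have huuu : tri L u u u = 0 := tri_self L hu1 hu.div_free hu1
  have hugg : tri L u (w - u) (w - u) = 0 := tri_self L hu1 hu.div_free hg1
  rw [tri_sub_mid L hu1 hw1 hu1, tri_sub_right L hu1 hw1 hw1 hu1,
    tri_sub_right L hu1 hu1 hw1 hu1, huww, huuu] at hugg
  rw [tri_sub_left L hw1 hu1 hg1, tri_sub_mid L hw1 hw1 hu1, tri_sub_mid L hu1 hw1 hu1,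
    tri_sub_right L hw1 hw1 hw1 hu1, tri_sub_right L hu1 hu1 hw1 hu1, hwuu, hwww, huuu]
  linear_combination hugg

lemma le_of_pow_four_le {r a b : ℝ} (ha : 0 ≤ a) (hb : 0 ≤ b)
    (h : r ^ 4 ≤ 256 * a ^ 3 * b) : r ≤ 3 * a + b := by
  have amgm : 256 * a ^ 3 * b ≤ (3 * a + b) ^ 4 := by
    rw [← sub_nonneg, show (3 * a + b) ^ 4 - 256 * a ^ 3 * b =
      (a - b) ^ 2 * (81 * a ^ 2 + 14 * a * b + b ^ 2) by ring]
    positivity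
  exact le_of_pow_le_pow_left₀ four_ne_zero (by positivity) (h.trans amgm)

lemma IsGNConst.pow_four_mul_vnorm_pow_four_le {c ν α α₀ η Q : ℝ} (hc : IsGNConst L c)
    (hν : 0 < ν) (hα₀ : 0 < α₀) (hα : α₀ ≤ α)
    (hQη : 27 * c ^ 4 * Q ^ 2 / (8 * ν ^ 3 * α₀ ^ 4) ≤ η) {u : VField}
    (hQ : vnorm L 0 u ^ 2 + α ^ 2 * vnorm L 1 u ^ 2 ≤ Q) :
    c ^ 4 * vnorm L 1 u ^ 4 ≤ 8 / 27 * ν ^ 3 * η := by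
  have hc_pos := hc.pos
  have hgrad : α₀ ^ 2 * vnorm L 1 u ^ 2 ≤ Q :=
    calc α₀ ^ 2 * vnorm L 1 u ^ 2 ≤ α ^ 2 * vnorm L 1 u ^ 2 := by gcongr
      _ ≤ Q := (le_add_of_nonneg_left (sq_nonneg _)).trans hQ
  rw [div_le_iff₀ (by positivity)] at hQη
  refine le_of_mul_le_mul_right ?_ (pow_pos hα₀ 4)
  calc c ^ 4 * vnorm L 1 u ^ 4 * α₀ ^ 4 = c ^ 4 * (α₀ ^ 2 * vnorm L 1 u ^ 2) ^ 2 := by ring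
    _ ≤ c ^ 4 * Q ^ 2 := by gcongr
    _ ≤ 8 / 27 * ν ^ 3 * η * α₀ ^ 4 := by linarith

/-- One factor `fourthMoment L g` is bounded with the constant `c`, the other with the absolute
constant of `IsH1.ladyzhenskaya`: only `c ^ 4`, not `c ^ 8`, is controlled by `η`. -/
lemma norm_tri_le_dissipation {c ν α α₀ η Q : ℝ} (hc : IsGNConst L c) (hν : 0 < ν) (hα₀ : 0 < α₀)
    (hα : α₀ ≤ α) (hη : 0 ≤ η) (hQη : 27 * c ^ 4 * Q ^ 2 / (8 * ν ^ 3 * α₀ ^ 4) ≤ η)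
    {g u : VField} (hg : InV 1 g) (hu : InV 1 u)
    (hQ : vnorm L 0 u ^ 2 + α ^ 2 * vnorm L 1 u ^ 2 ≤ Q) :
    ‖tri L g g u‖ ≤ ν / 2 * vnorm L 1 g ^ 2 + 3 * η / 4 * vnorm L 0 g ^ 2 := by
  have h0 := vnorm_nonneg L 0 g
  have h1 := vnorm_nonneg L 1 g
  have h4 := fourthMoment_nonneg L g
  have habs : fourthMoment L g ≤ 2 * vnorm L 0 g * vnorm L 1 g ^ 3 := (hg.isH1.ladyzhenskaya L).2
  have hgn : fourthMoment L g ≤ c ^ 4 * vnorm L 0 g * vnorm L 1 g ^ 3 :=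
    hc.integral_pow_four_le L hg
  have hu4 := hc.pow_four_mul_vnorm_pow_four_le hν hα₀ hα hQη hQ
  have hpow : ‖tri L g g u‖ ^ 4 ≤
      256 * (ν * vnorm L 1 g ^ 2 / 6) ^ 3 * (3 * η / 4 * vnorm L 0 g ^ 2) :=
    calc ‖tri L g g u‖ ^ 4 ≤ fourthMoment L g * fourthMoment L g * vnorm L 1 u ^ 4 :=
          norm_tri_pow_four_le L hg.isH1 hg.isH1 hu.isH1
      _ ≤ (2 * vnorm L 0 g * vnorm L 1 g ^ 3) * (c ^ 4 * vnorm L 0 g * vnorm L 1 g ^ 3) *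
          vnorm L 1 u ^ 4 := by gcongr
      _ = 2 * (c ^ 4 * vnorm L 1 u ^ 4) * (vnorm L 0 g ^ 2 * vnorm L 1 g ^ 6) := by ring
      _ ≤ 2 * (8 / 27 * ν ^ 3 * η) * (vnorm L 0 g ^ 2 * vnorm L 1 g ^ 6) := by gcongr
      _ ≤ 8 / 9 * ν ^ 3 * η * (vnorm L 0 g ^ 2 * vnorm L 1 g ^ 6) := by
          refine mul_le_mul_of_nonneg_right ?_ (by positivity)
          have : 0 ≤ ν ^ 3 * η := by positivity
          linarith
      _ = 256 * (ν * vnorm L 1 g ^ 2 / 6) ^ 3 * (3 * η / 4 * vnorm L 0 g ^ 2) := by ring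
  calc ‖tri L g g u‖ ≤ 3 * (ν * vnorm L 1 g ^ 2 / 6) + 3 * η / 4 * vnorm L 0 g ^ 2 :=
        le_of_pow_four_le (by positivity) (by positivity) hpow
    _ = ν / 2 * vnorm L 1 g ^ 2 + 3 * η / 4 * vnorm L 0 g ^ 2 := by ring

lemma IsGNConst.sqrt_fourthMoment_mul_le {c : ℝ} (hc : IsGNConst L c) {u : VField}
    (hu : InV 1 u) :
    √(fourthMoment L u) * lam L ^ (1 / 4 : ℝ) ≤ c ^ 2 * vnorm L 1 u ^ 2 := by
  have hc_pos := hc.pos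
  have h1 := vnorm_nonneg L 1 u
  have hsqrt : (lam L ^ (1 / 4 : ℝ)) ^ 2 = √(lam L) := by
    rw [← Real.rpow_mul_natCast (lam_pos L).le, Real.sqrt_eq_rpow]
    norm_num
  have hpoincare : √(lam L) * vnorm L 0 u ≤ vnorm L 1 u := by
    refine le_of_sq_le_sq ?_ h1
    rw [mul_pow, Real.sq_sqrt (lam_pos L).le]
    exact lam_mul_vnorm_sq_le L hu.mean_zero (hu.isH1.summable_amp_zero L) (hu.summable_amp L)
  refine le_of_sq_le_sq ?_ (by positivity)
  rw [mul_pow, Real.sq_sqrt (fourthMoment_nonneg L u), hsqrt]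
  calc fourthMoment L u * √(lam L)
      ≤ c ^ 4 * vnorm L 0 u * vnorm L 1 u ^ 3 * √(lam L) :=
        mul_le_mul_of_nonneg_right (hc.integral_pow_four_le L hu) (Real.sqrt_nonneg _)
    _ = c ^ 4 * (√(lam L) * vnorm L 0 u) * vnorm L 1 u ^ 3 := by ring
    _ ≤ c ^ 4 * vnorm L 1 u * vnorm L 1 u ^ 3 := by gcongr
    _ = (c ^ 2 * vnorm L 1 u ^ 2) ^ 2 := by ring

lemma sqrt_fourthMoment_div_le {c α α₀ Q : ℝ} (hc : IsGNConst L c) (hα₀ : 0 < α₀)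
    (hα : α₀ ≤ α) {u : VField} (hu : InV 1 u)
    (hQ : vnorm L 0 u ^ 2 + α ^ 2 * vnorm L 1 u ^ 2 ≤ Q) :
    √(fourthMoment L u) / (α ^ 2 * √(lam L)) ≤ c ^ 2 / (α₀ ^ 4 * lam L ^ (3 / 4 : ℝ)) * Q := by
  have hlam := lam_pos L
  have hα_pos : 0 < α := hα₀.trans_le hα
  have hsplit : lam L ^ (3 / 4 : ℝ) = √(lam L) * lam L ^ (1 / 4 : ℝ) := by
    rw [Real.sqrt_eq_rpow, ← Real.rpow_add hlam]
    norm_num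
  have hgrad : vnorm L 1 u ^ 2 ≤ Q / α ^ 2 := by
    rw [le_div_iff₀' (by positivity)]
    exact (le_add_of_nonneg_left (sq_nonneg _)).trans hQ
  have hQ_nonneg : 0 ≤ Q := le_trans (by positivity) hQ
  calc √(fourthMoment L u) / (α ^ 2 * √(lam L))
      = √(fourthMoment L u) * lam L ^ (1 / 4 : ℝ) / (α ^ 2 * lam L ^ (3 / 4 : ℝ)) := by
        rw [hsplit]
        field_simp
    _ ≤ c ^ 2 * (Q / α ^ 2) / (α ^ 2 * lam L ^ (3 / 4 : ℝ)) := by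
        refine div_le_div_of_nonneg_right ((hc.sqrt_fourthMoment_mul_le hu).trans ?_)
          (by positivity)
        gcongr
    _ = c ^ 2 / (α ^ 4 * lam L ^ (3 / 4 : ℝ)) * Q := by field_simp
    _ ≤ c ^ 2 / (α₀ ^ 4 * lam L ^ (3 / 4 : ℝ)) * Q := by gcongr

end Trilinear

section NudgedEnergy

variable {L : ℝ} [hL : Fact (0 < L)]

lemma absSumLE_lowIndicator_energy {g : VField} (hg : InV 1 g) (β : ℝ) (N : ℕ) :
    AbsSumLE (fun K => lowIndicator N K * (amp L 0 g K ^ 2 + β ^ 2 * amp L 1 g K ^ 2))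
      (vnorm L 0 g ^ 2 + β ^ 2 * vnorm L 1 g ^ 2) := by
  refine AbsSumLE.of_hasSum ((hasSum_amp L (hg.isH1.summable_amp_zero L)).add
    ((hasSum_amp L (hg.summable_amp L)).mul_left (β ^ 2))) fun K => ?_
  have hlow : 0 ≤ amp L 0 g K ^ 2 + β ^ 2 * amp L 1 g K ^ 2 := by positivity
  rw [abs_of_nonneg (mul_nonneg (lowIndicator_nonneg N K) hlow)]
  exact mul_le_of_le_one_left hlow (lowIndicator_le_one N K)

lemma absSumLE_energyRate_nudged {ν α β η M : ℝ} (hν : 0 ≤ ν) (hα : 0 < α) (hη : 0 ≤ η) (N : ℕ)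
    {f u w : VField} (hf : InV 0 f) (hw : InV 1 w) (hu : InV 1 u) (hg : InV 2 (w - u))
    (hM : vnorm L 0 f + √(fourthMoment L u) / (α ^ 2 * √(lam L)) ≤ M) :
    AbsSumLE
      (energyRate L β (w - u) (modeRhs L ν β (nudgedForcing L β η N f u w) w - modeRhs L ν α f u))
      (2 * (√(fourthMoment L u) * vnorm L 1 (w - u))
        + 2 * (√(fourthMoment L w) * vnorm L 1 (w - u))
        + 2 * |β ^ 2 - α ^ 2| * (M * vnorm L 2 (w - u))
        + 2 * ν * (vnorm L 1 (w - u) ^ 2 + β ^ 2 * vnorm L 2 (w - u) ^ 2)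
        + 2 * η * (vnorm L 0 (w - u) ^ 2 + β ^ 2 * vnorm L 1 (w - u) ^ 2)) := by
  have hg1 := hw.sub hu
  have hbilin_u := (absSumLE_inner_bilin L hu (hg1.summable_amp L)).const_mul 2
  have hbilin_w := (absSumLE_inner_bilin L hw (hg1.summable_amp L)).const_mul 2
  have hres := ((absSumLE_inner_residual L hα hu (hg.summable_amp L) (hf.summable_amp L)).mono
    (mul_le_mul_of_nonneg_right hM (vnorm_nonneg L 2 _))).const_mul (2 * (β ^ 2 - α ^ 2))
  have hdiss := (AbsSumLE.of_hasSum (hasSum_dissipation (L := L) hg1 hg β)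
    fun K => (abs_of_nonneg (by positivity)).le).const_mul (2 * ν)
  have hnudge := (absSumLE_lowIndicator_energy (L := L) hg1 β N).const_mul (2 * η)
  rw [energyRate_nudged hg]
  simpa only [abs_two, abs_mul, abs_of_nonneg hν, abs_of_nonneg hη] using
    (((hbilin_u.sub hbilin_w).sub hres).sub hdiss).sub hnudge

lemma neg_two_mul_le_of_abs_le {δ r M G κ : ℝ} (hκ : 0 < κ) (hr : |r| ≤ M * G) :
    -(2 * δ * r) ≤ κ * G ^ 2 + δ ^ 2 * M ^ 2 / κ :=
  calc -(2 * δ * r) ≤ |2 * δ * r| := neg_le_abs _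
    _ = 2 * |δ| * |r| := by rw [abs_mul, abs_mul, abs_two]
    _ ≤ 2 * |δ| * (M * G) := by gcongr
    _ = 2 * G * (|δ| * M) := by ring
    _ ≤ κ * G ^ 2 + κ⁻¹ * (|δ| * M) ^ 2 := two_mul_le_add_mul_sq hκ
    _ = κ * G ^ 2 + δ ^ 2 * M ^ 2 / κ := by
      rw [mul_pow, sq_abs, inv_mul_eq_div]

lemma tsum_energyRate_nudged_le {c ν α α₀ β η Q M : ℝ} (hc : IsGNConst L c) (hν : 0 < ν)
    (hα₀ : 0 < α₀) (hα : α₀ ≤ α) (hβ : 0 < β) (hη : 0 ≤ η) {N : ℕ} (hN : 1 ≤ N)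
    (h_N : η / (N : ℝ) ^ 2 ≤ ν * lam L / 2)
    (hQη : 27 * c ^ 4 * Q ^ 2 / (8 * ν ^ 3 * α₀ ^ 4) ≤ η)
    {f u w : VField} (hf : InV 0 f) (hw : InV 1 w) (hu : InV 1 u) (hg : InV 2 (w - u))
    (hQ : vnorm L 0 u ^ 2 + α ^ 2 * vnorm L 1 u ^ 2 ≤ Q)
    (hM : vnorm L 0 f + √(fourthMoment L u) / (α ^ 2 * √(lam L)) ≤ M) :
    ∑' K, energyRate L β (w - u)
        (modeRhs L ν β (nudgedForcing L β η N f u w) w - modeRhs L ν α f u) K ≤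
      -(η / 2) * (vnorm L 0 (w - u) ^ 2 + β ^ 2 * vnorm L 1 (w - u) ^ 2) +
        (β ^ 2 - α ^ 2) ^ 2 * M ^ 2 / (ν * β ^ 2) := by
  have hg1 := hw.sub hu
  have hbilin_u := hasSum_inner_bilin L hu.isH1 hu.div_free hu.isH1 hg1
  have hbilin_w := hasSum_inner_bilin L hw.isH1 hw.div_free hw.isH1 hg1
  have hres := (absSumLE_inner_residual L (hα₀.trans_le hα) hu (hg.summable_amp L)
    (hf.summable_amp L)).mono (mul_le_mul_of_nonneg_right hM (vnorm_nonneg L 2 _))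
  have henergy := (hasSum_amp L (hg1.isH1.summable_amp_zero L)).add
    ((hasSum_amp L (hg1.summable_amp L)).mul_left (β ^ 2))
  have hdiss := hasSum_dissipation (L := L) hg1 hg β
  have hnudge := (absSumLE_lowIndicator_energy (L := L) hg1 β N).summable.hasSum
  have hsum := ((((hbilin_u.mul_left 2).sub (hbilin_w.mul_left 2)).sub
    (hres.summable.hasSum.mul_left (2 * (β ^ 2 - α ^ 2)))).sub (hdiss.mul_left (2 * ν))).sub
      (hnudge.mul_left (2 * η))
  rw [energyRate_nudged hg, hsum.tsum_eq]
  have hlow := hasSum_le (lowIndicator_dissipation (L := L) (β := β) hg1.mean_zero hν.le hN h_N)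
    ((henergy.mul_left η).sub (hdiss.mul_left (ν / 2))) (hnudge.mul_left η)
  have htri := congrArg Complex.re (tri_sub_tri_eq (L := L) hw hu)
  rw [Complex.sub_re, Complex.neg_re] at htri
  have htri_le := ((neg_le_abs _).trans (Complex.abs_re_le_norm _)).trans
    (norm_tri_le_dissipation hc hν hα₀ hα hη hQη hg1 hu hQ)
  have hyoung := neg_two_mul_le_of_abs_le (δ := β ^ 2 - α ^ 2) (κ := ν * β ^ 2) (by positivity)
    hres.abs_tsum_le
  have : 0 ≤ η * (β ^ 2 * vnorm L 1 (w - u) ^ 2) := by positivity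
  linarith

lemma IsNudgedSolution.isSolutionOn {ν β η a b : ℝ} {N : ℕ} {f u w : ℝ → VField}
    (hw : IsNudgedSolution L ν β η N f u a b w) :
    IsSolutionOn L ν β (fun s => nudgedForcing L β η N (f s) (u s) (w s)) a b w := hw

lemma IsForcing.intervalIntegrable_nudgedForcing {β η a b : ℝ} {N : ℕ} {f u w : ℝ → VField}
    (hf : IsForcing L f) (ha : 0 ≤ a) (hab : a ≤ b) (hg : IsPath L (Set.Icc a b) fun s => w s - u s)
    (K : Fin 3 → ℤ) :
    IntervalIntegrable (fun s => nudgedForcing L β η N (f s) (u s) (w s) K) volume a b := by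
  have hmode := (hg.continuousOn_mode K).intervalIntegrable_of_Icc (μ := volume) hab
  refine ((hf.intervalIntegrable K ha hab).sub
    (hmode.smul (η * (1 + β ^ 2 * wave L K ^ 2) * lowIndicator N K))).congr fun s hs => ?_
  rw [Set.uIoc_of_le hab] at hs
  exact (nudgedForcing_apply (hg.mem s (Set.Ioc_subset_Icc_self hs)) (f s) β η N K).symm

lemma vnorm_sub_sq_le {s : ℕ} {u v : VField} (hu : InV s u) (hv : InV s v) :
    vnorm L s (u - v) ^ 2 ≤ 2 * (vnorm L s u ^ 2 + vnorm L s v ^ 2) :=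
  (pow_le_pow_left₀ (vnorm_nonneg L s _)
    (vnorm_sub_le L (hu.summable_amp L) (hv.summable_amp L)) 2).trans add_sq_le

lemma exists_integrable_absSumLE_energyRate_nudged {ν α β η M a b : ℝ} (hν : 0 ≤ ν) (hα : 0 < α)
    (hη : 0 ≤ η) (N : ℕ) {f u w : ℝ → VField}
    (hf : ∀ᵐ s ∂volume.restrict (Set.Icc a b), InV 0 (f s))
    (hw : IsPath L (Set.Icc a b) w) (hu : IsPath L (Set.Icc a b) u)
    (hw2 : ∀ᵐ s ∂volume.restrict (Set.Icc a b), InV 2 (w s))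
    (hu2 : ∀ᵐ s ∂volume.restrict (Set.Icc a b), InV 2 (u s))
    (hw_sq : IntegrableOn (fun s => vnorm L 2 (w s) ^ 2) (Set.Icc a b))
    (hu_sq : IntegrableOn (fun s => vnorm L 2 (u s) ^ 2) (Set.Icc a b)) (hM_nonneg : 0 ≤ M)
    (hM : ∀ᵐ s ∂volume.restrict (Set.Icc a b),
      vnorm L 0 (f s) + √(fourthMoment L (u s)) / (α ^ 2 * √(lam L)) ≤ M) :
    ∃ Φ : ℝ → ℝ, IntegrableOn Φ (Set.Icc a b) ∧
      ∀ᵐ s ∂volume.restrict (Set.Icc a b), AbsSumLE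
        (energyRate L β (w s - u s) (modeRhs L ν β
          (nudgedForcing L β η N (f s) (u s) (w s)) (w s) - modeRhs L ν α (f s) (u s))) (Φ s) := by
  obtain ⟨Cu, hCu_nonneg, hCu⟩ := hu.exists_bound
  obtain ⟨Cw, hCw_nonneg, hCw⟩ := hw.exists_bound
  obtain ⟨Cg, _, hCg⟩ := (hw.sub hu).exists_bound
  refine ⟨fun s => 2 * (Cu * Cg) + 2 * (Cw * Cg)
    + 2 * |β ^ 2 - α ^ 2| * (M * (1 + 2 * (vnorm L 2 (w s) ^ 2 + vnorm L 2 (u s) ^ 2)))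
    + 2 * ν * (Cg ^ 2 + β ^ 2 * (2 * (vnorm L 2 (w s) ^ 2 + vnorm L 2 (u s) ^ 2)))
    + 2 * η * (Cg ^ 2 + β ^ 2 * Cg ^ 2), ?_, ?_⟩
  · have hconst : ∀ r : ℝ, IntegrableOn (fun _ : ℝ => r) (Set.Icc a b) := fun r =>
      continuousOn_const.integrableOn_Icc
    have hsq := (hw_sq.add hu_sq).const_mul 2
    exact (((hconst _).add ((((hconst 1).add hsq).const_mul M).const_mul _)).add
      (((hconst _).add (hsq.const_mul _)).const_mul _)).add (hconst _)
  · filter_upwards [hf, hw2, hu2, hM, ae_restrict_mem measurableSet_Icc]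
      with s hfs hws hus hMs hs
    obtain ⟨hg0, hg1, -⟩ := hCg s hs
    obtain ⟨-, -, hu4⟩ := hCu s hs
    obtain ⟨-, -, hw4⟩ := hCw s hs
    have := vnorm_nonneg L 0 (w s - u s)
    have := vnorm_nonneg L 1 (w s - u s)
    have hsq := vnorm_sub_sq_le (L := L) hws hus
    have hlin : vnorm L 2 (w s - u s) ≤ 1 + 2 * (vnorm L 2 (w s) ^ 2 + vnorm L 2 (u s) ^ 2) := by
      nlinarith [sq_nonneg (vnorm L 2 (w s - u s) - 1)]
    refine (absSumLE_energyRate_nudged hν hα hη N hfs (hw.mem s hs) (hu.mem s hs) (hws.sub hus)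
      hMs).mono ?_
    gcongr

lemma IsNudgedSolution.energy_sub_le {c ν α α₀ β η Q a b : ℝ} (hc : IsGNConst L c) (hν : 0 < ν)
    (hα₀ : 0 < α₀) (hα : α₀ ≤ α) (hβ : 0 < β) (hη : 0 < η) {N : ℕ} (hN : 1 ≤ N)
    (h_N : η / (N : ℝ) ^ 2 ≤ ν * lam L / 2)
    (hQη : 27 * c ^ 4 * Q ^ 2 / (8 * ν ^ 3 * α₀ ^ 4) ≤ η)
    {f u w : ℝ → VField} (hf : IsForcing L f) (ha : 0 ≤ a) (hab : a ≤ b)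
    (hu : IsSolutionOn L ν α f 0 b u) (hw : IsNudgedSolution L ν β η N f u a b w)
    (hQ : ∀ t ∈ Set.Icc a b, vnorm L 0 (u t) ^ 2 + α ^ 2 * vnorm L 1 (u t) ^ 2 ≤ Q) :
    ∀ t ∈ Set.Icc a b, vnorm L 0 (w t - u t) ^ 2 + β ^ 2 * vnorm L 1 (w t - u t) ^ 2 ≤
      Real.exp (-(η / 2) * (t - a)) *
          (vnorm L 0 (w a - u a) ^ 2 + β ^ 2 * vnorm L 1 (w a - u a) ^ 2)
        + (β ^ 2 - α ^ 2) ^ 2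
            * (c ^ 2 / (α₀ ^ 4 * lam L ^ (3 / 4 : ℝ)) * Q + supNorm L f) ^ 2 / (ν * β ^ 2)
          / (η / 2) := by
  have hsub : Set.Icc a b ⊆ Set.Icc 0 b := Set.Icc_subset_Icc_left ha
  have hw' := hw.isSolutionOn
  have hpath_w := hw'.isPath
  have hpath_u := hu.isPath.mono hsub
  have hpath := hpath_w.sub hpath_u
  have hu2 := ae_restrict_of_ae_restrict_of_subset hsub hu.mem_DA
  have hM : ∀ᵐ s ∂volume.restrict (Set.Icc a b),
      vnorm L 0 (f s) + √(fourthMoment L (u s)) / (α ^ 2 * √(lam L)) ≤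
        c ^ 2 / (α₀ ^ 4 * lam L ^ (3 / 4 : ℝ)) * Q + supNorm L f := by
    filter_upwards [hf.ae_Icc ha, ae_restrict_mem measurableSet_Icc] with s ⟨_, hfF⟩ hs
    rw [add_comm (vnorm L 0 (f s))]
    exact add_le_add (sqrt_fourthMoment_div_le hc hα₀ hα (hpath_u.mem s hs) (hQ s hs)) hfF
  have hM_nonneg : 0 ≤ c ^ 2 / (α₀ ^ 4 * lam L ^ (3 / 4 : ℝ)) * Q + supNorm L f := by
    have hlam := lam_pos L
    have hQ_nonneg : 0 ≤ Q := le_trans (by positivity) (hQ a ⟨le_rfl, hab⟩)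
    have := hf.supNorm_nonneg
    positivity
  have hprim (K) := (hw'.isPrimitiveOn hab (hf.intervalIntegrable_nudgedForcing ha hab hpath K)).sub
    ((hu.isPrimitiveOn (ha.trans hab) (hf.intervalIntegrable K le_rfl (ha.trans hab))).mono
      ha hab le_rfl)
  obtain ⟨Φ, hΦ, hle⟩ := exists_integrable_absSumLE_energyRate_nudged (β := β) hν.le
    (hα₀.trans_le hα) hη.le N ((hf.ae_Icc ha).mono fun _ h => h.1) hpath_w hpath_u hw'.mem_DA hu2
    hw'.sq_integrable_DA (hu.sq_integrable_DA.mono_set hsub) hM_nonneg hM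
  refine hpath.energy_le (by positivity) (by positivity) hprim hΦ hle ?_
  filter_upwards [hf.ae_Icc ha, hw'.mem_DA, hu2, hM, ae_restrict_mem measurableSet_Icc]
    with s ⟨hfH, _⟩ hw2 hu2 hMs hs
  exact tsum_energyRate_nudged_le hc hν hα₀ hα hβ hη.le hN h_N hQη hfH (hpath_w.mem s hs)
    (hpath_u.mem s hs) (hw2.sub hu2) (hQ s hs) hMs

end NudgedEnergy

section ErrorTerm

lemma M2sq_nonneg {L ν c α₀ : ℝ} [Fact (0 < L)] (hν : 0 < ν) (hα₀ : 0 < α₀)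
    (α₁ MA MB MC F t : ℝ) : 0 ≤ M2sq L ν c α₀ α₁ MA MB MC F t := by
  have hlam := lam_pos L
  rw [M2sq]
  positivity

lemma nudging_error_le {L ν c α₀ : ℝ} [Fact (0 < L)] (hν : 0 < ν) (hα₀ : 0 < α₀)
    (α₁ MA MB MC t : ℝ) {F : ℝ} (hF : 0 ≤ F) :
    2 / ν * (c ^ 2 / (α₀ ^ 4 * lam L ^ (3 / 4 : ℝ)) * M1sq L ν α₁ MA MB F t + F) ^ 2 ≤
      4 * (1 / ν * M3 L ν c α₀ α₁ MA MB MC F t ^ 2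
        + ν / α₀ ^ 2 * M2sq L ν c α₀ α₁ MA MB MC F t) := by
  have hlam := lam_pos L
  have hM2 := M2sq_nonneg (L := L) (c := c) hν hα₀ α₁ MA MB MC F t
  have hM1 : 0 ≤ M1sq L ν α₁ MA MB F t := by
    rw [M1sq]
    positivity
  have hM3 : c ^ 2 / (α₀ ^ 4 * lam L ^ (3 / 4 : ℝ)) * M1sq L ν α₁ MA MB F t + F ≤
      M3 L ν c α₀ α₁ MA MB MC F t := by
    rw [M3, add_assoc]
    exact le_add_of_nonneg_left (by positivity)
  calc 2 / ν * (c ^ 2 / (α₀ ^ 4 * lam L ^ (3 / 4 : ℝ)) * M1sq L ν α₁ MA MB F t + F) ^ 2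
      ≤ 2 / ν * M3 L ν c α₀ α₁ MA MB MC F t ^ 2 := by gcongr
    _ ≤ 4 / ν * M3 L ν c α₀ α₁ MA MB MC F t ^ 2
        + 4 * (ν / α₀ ^ 2 * M2sq L ν c α₀ α₁ MA MB MC F t) := by
      refine le_add_of_le_of_nonneg ?_ (by positivity)
      gcongr
      norm_num
    _ = 4 * (1 / ν * M3 L ν c α₀ α₁ MA MB MC F t ^ 2
        + ν / α₀ ^ 2 * M2sq L ν c α₀ α₁ MA MB MC F t) := by ring

end ErrorTerm

end

end Bardina

theorem proposition5p5_general (L : ℝ) [Fact (0 < L)] (ν α α₀ α₁ MA MB c : ℝ) (hν : 0 < ν)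
    (hα₀ : 0 < α₀) (hα₀α : α₀ ≤ α) (hαα₁ : α ≤ α₁) (hc : IsGNConst L c)
    (f : ℝ → VField) (hf : IsForcing L f)
    (u : ℝ → VField) (hu : IsBardinaSolution L ν α f u)
    (huA : vnorm L 0 (u 0) ≤ MA) (huB : vnorm L 1 (u 0) ≤ MB)
    (tn tn1 : ℝ) (htn : 0 ≤ tn) (htn1 : tn < tn1)
    (β η : ℝ) (hβ : 0 < β) (hη : 0 < η) (N : ℕ) (hN : 1 ≤ N)
    (w : ℝ → VField) (hw : IsNudgedSolution L ν β η N f u tn tn1 w)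
    (h_eta : 27 * c ^ 4 * M1sq L ν α₁ MA MB (supNorm L f) tn ^ 2 / (8 * ν ^ 3 * α₀ ^ 4) ≤ η)
    (h_N : η / (N : ℝ) ^ 2 ≤ ν * lam L / 2) :
    ∀ t ∈ Set.Icc tn tn1,
      vnorm L 0 (w t - u t) ^ 2 + β ^ 2 * vnorm L 1 (w t - u t) ^ 2 ≤
        Real.exp (-(η / 2) * (t - tn)) *
            (vnorm L 0 (w tn - u tn) ^ 2 + β ^ 2 * vnorm L 1 (w tn - u tn) ^ 2)
          + 2 / ν * (c ^ 2 / (α₀ ^ 4 * lam L ^ (3 / 4 : ℝ)) * M1sq L ν α₁ MA MB (supNorm L f) tn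
              + supNorm L f) ^ 2
            * (|β ^ 2 - α ^ 2| ^ 2 / (η * β ^ 2)) := by
  intro t ht
  have hα : 0 ≤ α := hα₀.le.trans hα₀α
  have hM1 (s) (hs : s ∈ Set.Icc tn tn1) := hu.energy_le hν hα hαα₁ hf huA huB htn hs.1
  refine (hw.energy_sub_le hc hν hα₀ hα₀α hβ hη hN h_N h_eta hf htn htn1.le
    (hu tn1 (htn.trans_lt htn1)) hM1 t ht).trans_eq (congrArg _ ?_)
  rw [sq_abs]
  field_simp

theorem proposition5p5 (L : ℝ) [Fact (0 < L)]
    (ν α α₀ α₁ MA MB MC c : ℝ) (hν : 0 < ν)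
    (hα₀ : 0 < α₀) (hα₀α : α₀ ≤ α) (hαα₁ : α ≤ α₁)
    (hMA : 0 < MA) (hMB : 0 < MB) (hMC : 0 < MC)
    (hc : IsGNConst L c)
    (f : ℝ → VField) (hf : IsForcing L f)
    (u : ℝ → VField) (hu : IsBardinaSolution L ν α f u)
    (hu0 : InV 2 (u 0)) (huA : vnorm L 0 (u 0) ≤ MA) (huB : vnorm L 1 (u 0) ≤ MB)
    (huC : vnorm L 2 (u 0) ≤ MC)
    (tn tn1 : ℝ) (htn : 0 ≤ tn) (htn1 : tn < tn1)
    (β η : ℝ) (hβ : 0 < β) (hη : 0 < η) (N : ℕ) (hN : 1 ≤ N)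
    (w : ℝ → VField) (hw : IsNudgedSolution L ν β η N f u tn tn1 w)
    (h_eta : 27 * c ^ 4 * M1sq L ν α₁ MA MB (supNorm L f) tn ^ 2 / (8 * ν ^ 3 * α₀ ^ 4) ≤ η)
    (h_N : η / (N : ℝ) ^ 2 ≤ ν * lam L / 2) :
    ∀ t ∈ Set.Icc tn tn1,
      vnorm L 0 (w t - u t) ^ 2 + β ^ 2 * vnorm L 1 (w t - u t) ^ 2 ≤
        Real.exp (-(η / 2) * (t - tn)) *
            (vnorm L 0 (w tn - u tn) ^ 2 + β ^ 2 * vnorm L 1 (w tn - u tn) ^ 2)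
          + 4 * (1 / ν * M3 L ν c α₀ α₁ MA MB MC (supNorm L f) tn ^ 2
              + ν / α₀ ^ 2 * M2sq L ν c α₀ α₁ MA MB MC (supNorm L f) tn)
            * (|β ^ 2 - α ^ 2| ^ 2 / (η * β ^ 2)) := by
  intro t ht
  refine (proposition5p5_general L ν α α₀ α₁ MA MB c hν hα₀ hα₀α hαα₁ hc f hf u hu huA huB tn tn1
    htn htn1 β η hβ hη N hN w hw h_eta h_N t ht).trans ?_
  gcongr _ + ?_ * _
  exact nudging_error_le (L := L) hν hα₀ α₁ MA MB MC tn hf.supNorm_nonneg
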